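/- **Setting.** Fix $N\ge 1$ and complex numbers $\eta\neq 0$, $\xi_1,\dots,\xi_N$, $\bar\zeta_+\neq 0$, $\bar{\mathsf b}_+$. On $\mathcal H=\otimes_{n=1}^N\mathbb C^2$ let $R(\lambda)=\lambda\,\mathrm{I}+\eta\,\mathrm P$ on $\mathbb C^2\otimes\mathbb C^2$ ($\mathrm P$ the permutation), and on $\mathbb C^2_0\otimes\mathcal H$ $$M_0(\lambda)=R_{0N}(\lambda-\xi_N-\tfrac\eta2)\cdots R_{01}(\lambda-\xi_1-\tfrac\eta2),\qquad \hat M_0(\lambda)=(-1)^N\sigma_0^yM_0^{t_0}(-\lambda)\sigma_0^y,$$ $$\bar K_+(\lambda)=\mathrm I+\frac{\lambda+\eta/2}{\bar\zeta_+}\,(\sigma^z+\bar{\mathsf b}_+\sigma^+),\qquad M_0^{t_0}(\lambda)\,\bar K_+^{t_0}(\lambda)\,\hat M_0^{t_0}(\lambda)=\begin{pmatrix}\bar{\mathcal A}_+(\lambda)&\bar{\mathcal C}_+(\lambda)\\ \bar{\mathcal B}_+(\lambda)&\bar{\mathcal D}_+(\lambda)\end{pmatrix}.$$ Let $|0\rangle$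 be the state with all spins up; for a finite family of numbers, $\bar{\mathcal B}_+(\lambda_{I})=\prod_{i\in I}\bar{\mathcal B}_+(\lambda_i)$ (these operators commute). Put $\xi_n^{(0)}=\xi_n+\eta/2$, $\xi_n^{(1)}=\xi_n-\eta/2$, $I_k=\{1,\dots,k\}$ and $$a(\lambda)=\prod_{n=1}^N(\lambda-\xi_n+\tfrac\eta2),\quad d(\lambda)=\prod_{n=1}^N(\lambda-\xi_n-\tfrac\eta2),\quad f(x|y)=\frac{x-y+\eta}{x-y},\quad r(x|y)=\frac{\eta}{(x-y)(x-y+\eta)},\quad \tau(x|y)=a(x)f(y|x).$$ For finite families $X,Y$: $f(X|Y)=\prod_{x\in X,y\in Y}f(x|y)$ and $\tau(X|Y)=\prod_{x\in X}a(x)\,f(Y|X)$; $\pm X$ is the family of all $x$ and $-x$, $x\in X$. For an ordered index set $S$ and signs $\sigma$, $$H_{\sigma_S}(\lambda_S)=\prod_{j\in S}\frac{(-1)^N}{\bar\zeta_+}\,d(-\sigma_j\lambda_j)\frac{2\lambda_j+\eta}{2\lambda_j}\big(\lambda_j+\sigma_j(\bar\zeta_+-\tfrac\eta2)\big)\prod_{i<j;\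 i,j\in S}\frac{\sigma_i\lambda_i+\sigma_j\lambda_j-\eta}{\sigma_i\lambda_i+\sigma_j\lambda_j},$$ and $H(\xi^{(0)}_{\gamma})$ denotes this coefficient with all signs $+1$. Further $$R(\xi_{\gamma_+}|\xi_{\gamma_-}|X|Y)=\frac{\tau(X|Y)\,\tau(\xi^{(0)}_{\gamma_-}|\xi^{(0)}_{\gamma_+})}{\tau(\xi^{(0)}_{\gamma_+\cup\gamma_-}|X)\,f(Y|\xi^{(0)}_{\gamma_+})}.$$ Let $0\le m\le N-1$, $M\ge 0$, $\mu_1,\dots,\mu_M\in\mathbb C$ and $\mu_{M+1}=\xi_{m+1}^{(0)}$; write $\mu_j^\sigma=\sigma_j\mu_j$. For $\gamma_+\subset I_m$, $\alpha_+\subset I_{M+1}$ with $|\gamma_+|=|\alpha_+|=n$, an index set $e\subset I_{M+1}\setminus\alpha_+$ and numbers $\nu_1,\dots,\nu_{M+1}$, put $$S_n(\xi_{\gamma_+}|\nu_{\alpha_+}|\nu_e)=\frac{\prod_{k\in\gamma_+,j\in\alpha_+}(\xi_k^{(0)}-\nu_j+\eta)}{\prod_{i>j;\,i,j\in\gamma_+}(\xi_i-\xi_j)\prod_{i>j;\,i,j\in\alpha_+}(\nu_j-\nu_i)}\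 \det_{j\in\alpha_+,k\in\gamma_+}M_{jk},$$ $$M_{jk}=r(\xi_k^{(0)}|\nu_j)-(1-\delta_{j,M+1})\,r(\nu_j|\xi_k^{(0)})\,\frac{f(\nu_{(\alpha_+\setminus\{j\})\cup e}|\nu_j)}{f(\nu_j|\nu_{(\alpha_+\setminus\{j\})\cup e})}\,\frac{f(\nu_j|\xi^{(0)}_{\gamma_+\cup\{m+1\}})}{f(\xi^{(0)}_{\gamma_+\cup\{m+1\}}|\nu_j)}$$ (the second term is absent for $j=M+1$); rows and columns are in increasing order. $S_n^{-},S_n^{2,2},S_n^{+}$ are the cases $e=\emptyset$, $e=\{a\}$, $e=\{a,p\}$. With $\gamma_-=I_m\setminus\gamma_+$ put $$\mathcal R_n^{2,2}=\sum_{\sigma_{\alpha_+},\sigma_a=\pm}\frac{\eta\,\tau(\mu_a^\sigma|\pm\mu_{I_M-\{a\}}\cup\xi^{(1)}_{I_m})}{(\mu_a^\sigma-\xi^{(1)}_{m+1})\,\tau(\xi^{(0)}_{m+1}|\pm\mu_{I_M-\{a\}}\cup\xi^{(1)}_{I_m})}\,\frac{H_{\sigma_{\alpha_+}}(\mu_{\alpha_+})H_{\sigma_a}(\mu_a)}{H(\xi^{(0)}_{\gamma_+})H(\xi^{(0)}_{m+1})}\,R(\xi_{\gamma_+}|\xi_{\gamma_-}|\mu^\sigma_{\alpha_+}|\pm\mu_{\alpha_-})\,S_n^{2,2}(\xi_{\gamma_+}|\mu^\sigma_{\alpha_+}|\mu_a^\sigma),$$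 $$\mathcal R_n^{-}=\frac{\sum_{\sigma_{\alpha_+}=\pm}H_{\sigma_{\alpha_+}}(\mu_{\alpha_+})\,R(\xi_{\gamma_+}|\xi_{\gamma_-}|\mu^\sigma_{\alpha_+}|\pm\mu_{\alpha_-})\,S_n^{-}(\xi_{\gamma_+}|\mu^\sigma_{\alpha_+})}{H(\xi^{(0)}_{\gamma_+})H(\xi^{(0)}_{m+1})\,\tau(\xi^{(0)}_{m+1}|\pm\mu_{I_M}\cup\xi^{(1)}_{I_m})},$$ $$\mathcal R_n^{+}=\sum_{\sigma_{\alpha_+},\sigma_a,\sigma_p=\pm}R(\xi_{\gamma_+}|\xi_{\gamma_-}|\mu^\sigma_{\alpha_+}|\pm\mu_{\alpha_-})\,S_n^{+}(\xi_{\gamma_+}|\mu^\sigma_{\alpha_+}|\mu_a^\sigma|\mu_p^\sigma)\,\frac{H_{\sigma_{\alpha_+}}(\mu_{\alpha_+})H_{\sigma_a}(\mu_a)H_{\sigma_p}(\mu_p)}{H(\xi^{(0)}_{\gamma_+})H(\xi^{(0)}_{m+1})}$$ $$\qquad\times\frac{\eta^2\,\tau(\mu_a^\sigma|\pm\mu_{I_M-\{a\}}\cup\xi^{(1)}_{I_m})\,\tau(\mu_p^\sigma|\pm\mu_{I_{M+1}-\{a,p\}}\cup\xi^{(1)}_{I_m})}{(\mu_a^\sigma-\xi^{(1)}_{m+1})(\xi^{(0)}_{m+1}-\mu_p^\sigma+\eta)\,\tau(\xi^{(0)}_{m+1}|\pm\mu_{I_M-\{a\}}\cup\xi^{(1)}_{I_m})}.$$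 A term in which $\sigma_{M+1}=-1$ is zero, since $d(\xi_{m+1}^{(0)})=0$. **Genericity.** Assume $\xi_j,\ \xi_j\pm\xi_k\notin\{0,-\eta,\eta\}$ for all $j\ne k$ in $I_N$; $2\xi_k+\eta\neq0$ and $\xi_k+\bar\zeta_+\neq0$ for $k\le m+1$; $\mu_i\ne0$, $\mu_i\pm\mu_j\notin\{0,-\eta,\eta\}$ for $i\neq j$ in $I_M$; and $\pm\mu_i\notin\{\xi_k^{(0)},\xi_k^{(1)},\xi_k^{(0)}+\eta\}$ for $i\in I_M$, $k\le m+1$ (so that no denominator above vanishes). **Proposition.** Under these assumptions $$E^{2,2}_{m+1}\bar{\mathcal B}_+(\mu_{I_M})|0\rangle=\sum_{a=1}^M\ \sum_{n=0}^{\min(m,M)}\ \sum_{\substack{I_{M+1}=\alpha_+\sqcup\alpha_-\sqcup\{a\}\\ I_m=\gamma_+\sqcup\gamma_-,\ |\gamma_+|=|\alpha_+|=n}}\mathcal R_n^{2,2}(\xi_{\gamma_+}|\xi_{\gamma_-}|\mu_{\alpha_+}|\mu_a|\mu_{\alpha_-})\,\bar{\mathcal B}_+(\mu_{\alpha_-}\cup\xi^{(0)}_{\gamma_+})|0\rangle,$$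 $$\sigma^-_{m+1}\bar{\mathcal B}_+(\mu_{I_M})|0\rangle=\sum_{n=0}^{\min(m,M+1)}\ \sum_{\substack{I_{M+1}=\alpha_+\sqcup\alpha_-\\ I_m=\gamma_+\sqcup\gamma_-,\ |\gamma_+|=|\alpha_+|=n}}\mathcal R_n^{-}(\xi_{\gamma_+}|\xi_{\gamma_-}|\mu_{\alpha_+}|\mu_{\alpha_-})\,\bar{\mathcal B}_+(\mu_{\alpha_-}\cup\xi^{(0)}_{\gamma_+})|0\rangle,$$ $$\sigma^+_{m+1}\bar{\mathcal B}_+(\mu_{I_M})|0\rangle=\sum_{a=1}^M\ \sum_{\substack{p=1\\p\ne a}}^{M+1}\ \sum_{n=0}^{\min(m,M)}\ \sum_{\substack{I_{M+1}=\alpha_+\sqcup\alpha_-\sqcup\{a\}\sqcup\{p\}\\ I_m=\gamma_+\sqcup\gamma_-,\ |\gamma_+|=|\alpha_+|=n}}\mathcal R_n^{+}(\xi_{\gamma_+}|\xi_{\gamma_-}|\mu_{\alpha_+}|\mu_a|\mu_p|\mu_{\alpha_-})\,\bar{\mathcal B}_+(\mu_{\alpha_-}\cup\xi^{(0)}_{\gamma_+})|0\rangle.$$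 -/

import Mathlib

open scoped Matrix

noncomputable section

namespace OpenXXX

/-- Operators on the physical space `⊗ₙ ℂ²` of an `N`-site spin-1/2 chain, written as matrices in
the spin basis. A basis vector is a configuration `Fin N → Fin 2`, with `0` = spin up and
`1` = spin down; the sites `1, …, N` are indexed by `Fin N`. -/
abbrev Op (N : ℕ) : Type := Matrix (Fin N → Fin 2) (Fin N → Fin 2) ℂ

/-- The operator acting as the `2 × 2` matrix `X` at site `n` and as the identity elsewhere. -/
def siteOp {N : ℕ} (n : Fin N) (X : Matrix (Fin 2) (Fin 2) ℂ) : Op N :=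
  fun s t => if ∀ k, k ≠ n → s k = t k then X (s n) (t n) else 0

/-- The local operator `E²²` at site `n`. -/
def E22 {N : ℕ} (n : Fin N) : Op N := siteOp n !![0, 0; 0, 1]

/-- The local operator `σ⁻` at site `n`. -/
def sigmaMinus {N : ℕ} (n : Fin N) : Op N := siteOp n !![0, 0; 1, 0]

/-- The local operator `σ⁺` at site `n`. -/
def sigmaPlus {N : ℕ} (n : Fin N) : Op N := siteOp n !![0, 1; 0, 0]

/-- The reference vector `|0⟩`, all spins up. -/
def vacuum (N : ℕ) : (Fin N → Fin 2) → ℂ := Pi.single (fun _ => 0) 1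

/-- A scalar `2 × 2` matrix on the auxiliary space, as an element of `End(H₀ ⊗ H)`. -/
def aux (N : ℕ) (X : Matrix (Fin 2) (Fin 2) ℂ) : Matrix (Fin 2) (Fin 2) (Op N) :=
  X.map (algebraMap ℂ (Op N))

/-- The parameters of the chain: `η`, the inhomogeneities `ξ`, and the parameters `ζ̄₊`, `b̄₊` of
the triangular boundary matrix `K̄₊`. -/
structure Chain (N : ℕ) where
  η : ℂ
  ξ : Fin N → ℂ
  ζ : ℂ
  b : ℂ

namespace Chain

variable {N : ℕ} (P : Chain N)

/-- The rational six-vertex `R`-matrix. -/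
def R6v (lam : ℂ) : Matrix (Fin 2 × Fin 2) (Fin 2 × Fin 2) ℂ := fun p q =>
  lam * (if p = q then 1 else 0) + P.η * (if p = q.swap then 1 else 0)

/-- `R₀ₙ(λ)` as a `2 × 2` matrix (auxiliary space `H₀`) of operators on the chain. -/
def R0 (n : Fin N) (lam : ℂ) : Matrix (Fin 2) (Fin 2) (Op N) :=
  fun i j => siteOp n (fun s t => P.R6v lam (i, s) (j, t))

/-- Bulk monodromy `M₀(λ) = R₀_N(λ - ξ_N - η/2) ⋯ R₀₁(λ - ξ₁ - η/2)`. -/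
def monodromy (lam : ℂ) : Matrix (Fin 2) (Fin 2) (Op N) :=
  ((List.finRange N).reverse.map fun n => P.R0 n (lam - P.ξ n - P.η / 2)).prod

/-- `M̂₀(λ) = (-1)^N σ₀ʸ M₀^{t₀}(-λ) σ₀ʸ`; the transpose is over the auxiliary space only. -/
def monodromyHat (lam : ℂ) : Matrix (Fin 2) (Fin 2) (Op N) :=
  aux N ((-1 : ℂ) ^ N • !![0, -Complex.I; Complex.I, 0]) * (P.monodromy (-lam))ᵀ *
    aux N !![0, -Complex.I; Complex.I, 0]

/-- `K̄₊(λ) = 1 + (λ + η/2)/ζ̄₊ (σᶻ + b̄₊ σ⁺)`. -/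
def Kplus (lam : ℂ) : Matrix (Fin 2) (Fin 2) ℂ :=
  1 + ((lam + P.η / 2) / P.ζ) • (!![1, 0; 0, -1] + P.b • !![0, 1; 0, 0])

/-- `Ū₊^{t₀}(λ) = M₀^{t₀}(λ) K̄₊^{t₀}(λ) M̂₀^{t₀}(λ)`, the matrix with rows `(Ā₊, C̄₊)`,
`(B̄₊, D̄₊)`. -/
def UplusT (lam : ℂ) : Matrix (Fin 2) (Fin 2) (Op N) :=
  (P.monodromy lam)ᵀ * aux N (P.Kplus lam)ᵀ * (P.monodromyHat lam)ᵀ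

/-- The operator `B̄₊(λ)`. -/
def Bplus (lam : ℂ) : Op N := P.UplusT lam 1 0

/-- The boundary separate state `B̄₊(λ₁) ⋯ B̄₊(λ_r) |0⟩`. -/
def sepState (l : List ℂ) : (Fin N → Fin 2) → ℂ := (l.map P.Bplus).prod *ᵥ vacuum N

/-- `ξₙ^{(0)} = ξₙ + η/2`. -/
def ξ0 (n : Fin N) : ℂ := P.ξ n + P.η / 2

/-- `ξₙ^{(1)} = ξₙ - η/2`. -/
def ξ1 (n : Fin N) : ℂ := P.ξ n - P.η / 2

/-- Generic inhomogeneities: `ξⱼ, ξⱼ ± ξₖ ∉ {0, -η, η}` for `j ≠ k`. -/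
def Inhomogeneous : Prop :=
  (∀ j, P.ξ j ∉ ({0, -P.η, P.η} : Set ℂ)) ∧
  ∀ j k, j ≠ k → P.ξ j + P.ξ k ∉ ({0, -P.η, P.η} : Set ℂ) ∧
    P.ξ j - P.ξ k ∉ ({0, -P.η, P.η} : Set ℂ)

/-- `a(λ) = ∏ₙ (λ - ξₙ + η/2)`. -/
def a (lam : ℂ) : ℂ := ∏ n, (lam - P.ξ n + P.η / 2)

/-- `d(λ) = ∏ₙ (λ - ξₙ - η/2)`. -/
def d (lam : ℂ) : ℂ := ∏ n, (lam - P.ξ n - P.η / 2)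

/-- `f(x|y) = (x - y + η)/(x - y)`. -/
def f (x y : ℂ) : ℂ := (x - y + P.η) / (x - y)

/-- `r(x|y) = η/((x - y)(x - y + η))`. -/
def r (x y : ℂ) : ℂ := P.η / ((x - y) * (x - y + P.η))

/-- `f(X|Y) = ∏_{x ∈ X} ∏_{y ∈ Y} f(x|y)` for two finite families of variables. -/
def fProd (X Y : Multiset ℂ) : ℂ := (X.map fun x => (Y.map fun y => P.f x y).prod).prod

/-- `τ(X|Y) = ∏_{x ∈ X} a(x) · f(Y|X)`. -/
def τ (X Y : Multiset ℂ) : ℂ := (X.map P.a).prod * P.fProd Y X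

/-- The coefficient `H_σ(λ)` of the boundary-bulk decomposition, for the variables `λᵢ`, `i ∈ S`,
and the signs `σᵢ`. -/
def H {ι : Type} [LinearOrder ι] (S : Finset ι) (σ : ι → ℤˣ) (lam : ι → ℂ) : ℂ :=
  (∏ j ∈ S, (-1 : ℂ) ^ N / P.ζ * P.d (-(((σ j : ℤ) : ℂ) * lam j)) *
    ((2 * lam j + P.η) / (2 * lam j)) * (lam j + ((σ j : ℤ) : ℂ) * (P.ζ - P.η / 2))) *
  ∏ i ∈ S, ∏ j ∈ S with i < j,
    (((σ j : ℤ) : ℂ) * lam j + ((σ i : ℤ) : ℂ) * lam i - P.η) /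
      (((σ j : ℤ) : ℂ) * lam j + ((σ i : ℤ) : ℂ) * lam i)

/-- The multiset of the values `x i`, `i ∈ S`. -/
def fam {ι : Type} (S : Finset ι) (x : ι → ℂ) : Multiset ℂ := S.val.map x

/-- `± x_S`, the values `x i` and `-x i`, `i ∈ S`. -/
def pmFam {ι : Type} (S : Finset ι) (x : ι → ℂ) : Multiset ℂ := fam S x + fam S (fun i => -x i)

/-- `R(ξ_{γ₊}|ξ_{γ₋}|X|Y) =
τ(X|Y) τ(ξ⁰_{γ₋}|ξ⁰_{γ₊}) / (τ(ξ⁰_{γ₊ ∪ γ₋}|X) f(Y|ξ⁰_{γ₊}))`. -/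
def R (γp γm : Finset (Fin N)) (X Y : Multiset ℂ) : ℂ :=
  P.τ X Y * P.τ (fam γm P.ξ0) (fam γp P.ξ0) /
    (P.τ (fam (γp ∪ γm) P.ξ0) X * P.fProd Y (fam γp P.ξ0))

variable {M : ℕ}

/-- The matrix entry `M_{jk}` of the determinant, for the family of (signed) variables `ν`, the site
`s = m + 1` and the finite set `extra` of indices added to `α₊`: `∅` for `σ⁻`, `{a}` for `E²²`
and `{a, p}` for `σ⁺`. -/
def Mentry (s : Fin N) (γ : Finset (Fin N)) (α extra : Finset (Fin (M + 1)))
    (ν : Fin (M + 1) → ℂ) (j : Fin (M + 1)) (k : Fin N) : ℂ :=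
  P.r (P.ξ0 k) (ν j) - (1 - if j = Fin.last M then 1 else 0) * P.r (ν j) (P.ξ0 k) *
    (P.fProd (fam (α.erase j ∪ extra) ν) {ν j} / P.fProd {ν j} (fam (α.erase j ∪ extra) ν)) *
    (P.fProd {ν j} (fam (insert s γ) P.ξ0) / P.fProd (fam (insert s γ) P.ξ0) {ν j})

/-- `Sₙ(ξ_γ|ν_α|ν_extra)` with `n = |γ| = |α|`; rows and columns of the determinant are in
increasing order of the indices. -/
def S (s : Fin N) (γ : Finset (Fin N)) (α extra : Finset (Fin (M + 1)))
    (ν : Fin (M + 1) → ℂ) : ℂ :=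
  (∏ k ∈ γ, ∏ j ∈ α, (P.ξ0 k - ν j + P.η)) /
    ((∏ i ∈ γ, ∏ j ∈ γ with j < i, (P.ξ i - P.ξ j)) * ∏ i ∈ α, ∏ j ∈ α with j < i, (ν j - ν i)) *
  if h : α.card = γ.card then
    Matrix.det (Matrix.of fun j k : Fin γ.card =>
      P.Mentry s γ α extra ν (α.orderEmbOfFin h j) (γ.orderEmbOfFin rfl k))
  else 0

/-- The sign choices `σᵢ = ±1` for `i ∈ A` (with the irrelevant signs outside `A` put equal
to `1`). -/
def signs (A : Finset (Fin (M + 1))) : Finset (Fin (M + 1) → ℤˣ) :=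
  Fintype.piFinset fun i => if i ∈ A then Finset.univ else {1}

/-- `νᵢ^σ = σᵢ νᵢ`. -/
def signed (σ : Fin (M + 1) → ℤˣ) (ν : Fin (M + 1) → ℂ) : Fin (M + 1) → ℂ :=
  fun i => ((σ i : ℤ) : ℂ) * ν i

/-- `μ₁, …, μ_M, μ_{M+1}` with `μ_{M+1} = ξ⁰_{m+1}`, where `s` is the site `m + 1`. -/
def ext (s : Fin N) (μ : Fin M → ℂ) : Fin (M + 1) → ℂ := Fin.snoc μ (P.ξ0 s)

/-- The coefficient `𝓡ₙ^{2,2}`. Here `s` is the site `m + 1`, so that `Finset.Iio s` is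
`I_m = {1, …, m}`, and `Finset.Iio (Fin.last M)` is `I_M = {1, …, M}`; `ν` is the extended
family `μ₁, …, μ_{M+1}`. -/
def coeff22 (s : Fin N) (ν : Fin (M + 1) → ℂ) (γp γm : Finset (Fin N))
    (αp : Finset (Fin (M + 1))) (a : Fin (M + 1)) (αm : Finset (Fin (M + 1))) : ℂ :=
  ∑ σ ∈ signs (insert a αp),
    P.η * P.τ {signed σ ν a}
        (pmFam ((Finset.Iio (Fin.last M)).erase a) ν + fam (Finset.Iio s) P.ξ1) /
      ((signed σ ν a - P.ξ1 s) * P.τ {P.ξ0 s}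
        (pmFam ((Finset.Iio (Fin.last M)).erase a) ν + fam (Finset.Iio s) P.ξ1)) *
    (P.H αp σ ν * P.H {a} σ ν / (P.H γp 1 P.ξ0 * P.H {s} 1 P.ξ0)) *
    P.R γp γm (fam αp (signed σ ν)) (pmFam αm ν) * P.S s γp αp {a} (signed σ ν)

/-- The coefficient `𝓡ₙ^{-}`. -/
def coeffMinus (s : Fin N) (ν : Fin (M + 1) → ℂ) (γp γm : Finset (Fin N))
    (αp αm : Finset (Fin (M + 1))) : ℂ :=
  (∑ σ ∈ signs αp, P.H αp σ ν * P.R γp γm (fam αp (signed σ ν)) (pmFam αm ν) *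
      P.S s γp αp ∅ (signed σ ν)) /
    (P.H γp 1 P.ξ0 * P.H {s} 1 P.ξ0 *
      P.τ {P.ξ0 s} (pmFam (Finset.Iio (Fin.last M)) ν + fam (Finset.Iio s) P.ξ1))

/-- The coefficient `𝓡ₙ^{+}`. -/
def coeffPlus (s : Fin N) (ν : Fin (M + 1) → ℂ) (γp γm : Finset (Fin N))
    (αp : Finset (Fin (M + 1))) (a p : Fin (M + 1)) (αm : Finset (Fin (M + 1))) : ℂ :=
  ∑ σ ∈ signs (insert a (insert p αp)),
    P.R γp γm (fam αp (signed σ ν)) (pmFam αm ν) * P.S s γp αp {a, p} (signed σ ν) *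
    (P.H αp σ ν * P.H {a} σ ν * P.H {p} σ ν / (P.H γp 1 P.ξ0 * P.H {s} 1 P.ξ0)) *
    (P.η ^ 2 * P.τ {signed σ ν a}
        (pmFam ((Finset.Iio (Fin.last M)).erase a) ν + fam (Finset.Iio s) P.ξ1) *
      P.τ {signed σ ν p}
        (pmFam ((Finset.univ.erase a).erase p) ν + fam (Finset.Iio s) P.ξ1) /
      ((signed σ ν a - P.ξ1 s) * (P.ξ0 s - signed σ ν p + P.η) * P.τ {P.ξ0 s}
        (pmFam ((Finset.Iio (Fin.last M)).erase a) ν + fam (Finset.Iio s) P.ξ1)))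

/-- The state `B̄₊(ν_{α₋} ∪ ξ⁰_{γ₊})|0⟩` (the operators `B̄₊` commute; they are multiplied here in
increasing order of the indices). -/
def newState (ν : Fin (M + 1) → ℂ) (αm : Finset (Fin (M + 1))) (γp : Finset (Fin N)) :
    (Fin N → Fin 2) → ℂ :=
  P.sepState ((αm.sort (· ≤ ·)).map ν ++ (γp.sort (· ≤ ·)).map P.ξ0)

end Chain

end OpenXXX

end

/-! The boundary statement is reduced to a bulk one, and the bulk one is proved first for
eigenvectors of the transfer matrix.

Bulk, with Bethe equations. The monodromy matrix satisfies the Yangian relations, and the solution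
of the quantum inverse problem (`inverse_problem`) expresses a matrix unit at the site `s = m + 1`,
multiplied on the right by the transfer matrices at the inhomogeneities of the sites up to `s`,
through a monodromy entry at `ξ0 s` and the transfer matrices of the sites below `s`. If the
parameters `Λ` satisfy the Bethe equations, `Φ Λ` is a common eigenvector of the transfer matrices
on the right. The local operator then acts, up to the eigenvalue, as a monodromy entry followed by a
product of transfer matrices. The entries `B`, `D`, `C` insert the point `ξ0 s` and remove no, one
or two points (`Φ_insert`, `D_Φ'`, `C_Φ`). The transfer matrices exchange a set of parameters for an
equally large set of inhomogeneities, with a determinant as coefficient (`transfer_prod_Φ`). The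
determinant is found by recursion on the number of transfer matrices: as a function of the newest
point it is rational and decays at infinity, and its partial fraction expansion (`slav_cons`) is the
recursion produced by one more transfer matrix (`exCoeff_rec`).

Bulk, without Bethe equations. Once these equations have eliminated `d`, the formula contains only
`a`. Adding sites on the left multiplies all its terms, on the component with the added spins up, by
one common factor. The inhomogeneities of the added sites can be chosen as the roots of a polynomial
with prescribed values, so that the longer chain satisfies the Bethe equations (`bulk_of_bethe`).
This needs `d ≠ 0` on `Λ`, a restriction lifted by continuity in the inhomogeneities of the sites
beyond `s` (`twistedChain_bulk`).

Boundary. A constant triangular twist of the bulk monodromy absorbs `b̄₊`. Then `B̄₊(λ)` is a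
combination of `B(λ) D(-λ)` and `B(-λ) D(λ)`, and a product of such operators on the vacuum is a sum
over signs of bulk vectors with coefficients `H`, because all unwanted terms cancel in the sum over
signs (`boundary_decomposition`). Parameters at inhomogeneities keep only the sign `+`, since `d`
vanishes there. Both sides of the theorem become sums over signs of bulk vectors, and for fixed
signs they agree by the bulk formula (`term_eq`, `boundary_sum`, and the comparison of weights). -/

open scoped Matrix
noncomputable section
namespace OpenXXX

/-! ### Yangian relations and the quantum inverse problem. -/

section Algebra

/-- The entries of a family of `2 × 2` matrices depending on a spectral parameter. -/
abbrev Entries (A : Type*) := ℂ → Fin 2 → Fin 2 → A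

namespace Entries

variable {A : Type*} [Ring A]

/-- Pointwise matrix product. -/
def mul (T T' : Entries A) : Entries A := fun u i j => ∑ k, T u i k * T' u k j

/-- The identity matrix. -/
def one : Entries A := fun _ i j => if i = j then 1 else 0

theorem mul_assoc (T₁ T₂ T₃ : Entries A) : (T₁.mul T₂).mul T₃ = T₁.mul (T₂.mul T₃) := by
  funext u i j
  simp only [mul, Finset.sum_mul, Finset.mul_sum, _root_.mul_assoc]
  exact Finset.sum_comm

theorem mul_one (T : Entries A) : T.mul one = T := by
  funext u i j
  simp [mul, one]

theorem one_mul (T : Entries A) : (one : Entries A).mul T = T := by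
  funext u i j
  simp [mul, one]

/-- All entries of `T` commute with all entries of `T'`. -/
def Commutes (T T' : Entries A) : Prop :=
  ∀ u v i j k l, Commute (T u i j) (T' v k l)

theorem Commutes.symm {T T' : Entries A} (h : Commutes T T') : Commutes T' T :=
  fun u v i j k l => (h v u k l i j).symm

theorem Commutes.mul_left {T₁ T₂ T : Entries A} (h₁ : Commutes T₁ T) (h₂ : Commutes T₂ T) :
    Commutes (T₁.mul T₂) T := fun u v i j k l =>
  Commute.sum_left _ _ _ fun a _ => (h₁ u v i a k l).mul_left (h₂ u v a j k l)

theorem Commutes.one_left (T : Entries A) : Commutes one T := by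
  intro u v i j k l
  unfold one
  split_ifs
  · exact Commute.one_left _
  · exact Commute.zero_left _

end Entries

variable {A : Type*} [Ring A] [Algebra ℂ A]

/-- The defining relations of the Yangian of `gl₂`. -/
def Yangian (η : ℂ) (T : Entries A) : Prop :=
  ∀ u v i j k l, (u - v) • (T u i j * T v k l - T v k l * T u i j) =
    η • (T v k j * T u i l - T u k j * T v i l)

theorem Yangian.one (η : ℂ) : Yangian η (Entries.one : Entries A) := by
  intro u v i j k l
  simp only [Entries.one]
  fin_cases i <;> fin_cases j <;> fin_cases k <;> fin_cases l <;> simp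

/-- This is the coproduct. As the two factors commute, a product of two entries separates into a
`T₂` pair and a `T₁` pair, and the two relations are applied in turn. Two of the four exchange terms
cancel after renaming the summation indices. -/
theorem Yangian.mul {η : ℂ} {T₂ T₁ : Entries A} (h₂ : Yangian η T₂)
    (h₁ : Yangian η T₁) (hc : T₁.Commutes T₂) : Yangian η (T₂.mul T₁) := by
  intro u v i j k l
  have key : ∀ (u v : ℂ) (i j k l : Fin 2), (T₂.mul T₁) u i j * (T₂.mul T₁) v k l =
      ∑ a, ∑ b, T₂ u i a * T₂ v k b * (T₁ u a j * T₁ v b l) := by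
    intro u v i j k l
    simp only [Entries.mul, Finset.sum_mul_sum]
    refine Finset.sum_congr rfl fun a _ => Finset.sum_congr rfl fun b _ => ?_
    have := (hc u v a j k b).eq
    simp only [mul_assoc]
    rw [← mul_assoc (T₁ u a j), this]
    simp only [mul_assoc]
  have h2 : ∀ a b, (u - v) • (T₂ u i a * T₂ v k b) =
      (u - v) • (T₂ v k b * T₂ u i a) + η • (T₂ v k a * T₂ u i b - T₂ u k a * T₂ v i b) := by
    intro a b
    rw [← h₂ u v i a k b, smul_sub]; abel
  have h1 : ∀ a b, (u - v) • (T₁ u a j * T₁ v b l) =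
      (u - v) • (T₁ v b l * T₁ u a j) + η • (T₁ v b j * T₁ u a l - T₁ u b j * T₁ v a l) := by
    intro a b
    rw [← h₁ u v a j b l, smul_sub]; abel
  have e1 : (u - v) • ((T₂.mul T₁) u i j * (T₂.mul T₁) v k l) =
      (u - v) • ((T₂.mul T₁) v k l * (T₂.mul T₁) u i j) +
      ∑ a, ∑ b, (η • (T₂ v k b * T₂ u i a * (T₁ v b j * T₁ u a l)) -
        η • (T₂ v k b * T₂ u i a * (T₁ u b j * T₁ v a l)) +
        (η • (T₂ v k a * T₂ u i b * (T₁ u a j * T₁ v b l)) -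
         η • (T₂ u k a * T₂ v i b * (T₁ u a j * T₁ v b l)))) := by
    rw [key, key, Finset.sum_comm (f := fun a b => T₂ v k a * T₂ u i b * (T₁ v a l * T₁ u b j))]
    simp only [Finset.smul_sum, ← Finset.sum_add_distrib]
    refine Finset.sum_congr rfl fun a _ => Finset.sum_congr rfl fun b _ => ?_
    rw [← smul_mul_assoc, h2, add_mul, smul_mul_assoc, ← mul_smul_comm, h1, mul_add,
      smul_mul_assoc, sub_mul, smul_sub, smul_sub, mul_sub, mul_smul_comm, mul_smul_comm,
      mul_smul_comm]
    abel
  rw [smul_sub, e1, key v u k j i l, key u v k j i l]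
  simp only [Finset.sum_add_distrib, Finset.sum_sub_distrib, smul_sub, Finset.smul_sum]
  rw [Finset.sum_comm (f := fun a b => η • (T₂ v k b * T₂ u i a * (T₁ v b j * T₁ u a l))),
    Finset.sum_comm (f := fun a b => η • (T₂ v k b * T₂ u i a * (T₁ u b j * T₁ v a l)))]
  abel

/-- Matrix units of a spin-1/2 site inside an algebra. -/
structure MatUnits (e : Fin 2 → Fin 2 → A) : Prop where
  mul : ∀ a b c d, e a b * e c d = if b = c then e a d else 0
  one : e 0 0 + e 1 1 = 1

/-- The Lax matrix of a site, `L(u) = u - ρ + η P`. -/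
def lax (η ρ : ℂ) (e : Fin 2 → Fin 2 → A) : Entries A :=
  fun u i j => (u - ρ) • (if i = j then 1 else 0) + η • e j i

theorem MatUnits.yangian {e : Fin 2 → Fin 2 → A} (he : MatUnits e) (η ρ : ℂ) :
    Yangian η (lax η ρ e) := by
  intro u v i j k l
  simp only [lax, add_mul, mul_add, smul_mul_assoc, mul_smul_comm, he.mul]
  fin_cases i <;> fin_cases j <;> fin_cases k <;> fin_cases l <;>
    simp only [Fin.zero_eta, Fin.mk_one, Fin.isValue, if_true, if_false, mul_one, one_mul, zero_ne_one,
      one_ne_zero, smul_zero, zero_mul, mul_zero] <;> module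

/-- The matrix units `e` commute with all entries of `T`. -/
def UnitsCommute (e : Fin 2 → Fin 2 → A) (T : Entries A) : Prop :=
  ∀ v a b k l, Commute (e a b) (T v k l)

theorem UnitsCommute.lax {e : Fin 2 → Fin 2 → A} {T : Entries A}
    (h : UnitsCommute e T) (η ρ : ℂ) : (lax η ρ e).Commutes T := by
  intro u v i j k l
  unfold OpenXXX.lax
  refine Commute.add_left (Commute.smul_left ?_ _) ((h v j i k l).smul_left _)
  split_ifs
  · exact Commute.one_left _
  · exact Commute.zero_left _

omit [Algebra ℂ A] in
theorem UnitsCommute.mul {e : Fin 2 → Fin 2 → A} {T T' : Entries A}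
    (h : UnitsCommute e T) (h' : UnitsCommute e T') : UnitsCommute e (T.mul T') := 
  fun v a b k l => Commute.sum_right _ _ _ fun c _ => (h v a b k c).mul_right (h' v a b c l)

/-- The transfer matrix. -/
def transfer (T : Entries A) (u : ℂ) : A := T u 0 0 + T u 1 1

section Shift

variable {e : Fin 2 → Fin 2 → A} {W : Entries A} {η ρ : ℂ}

theorem mul_lax_apply (hc : UnitsCommute e W) (u : ℂ) (i j : Fin 2) :
    (W.mul (lax η ρ e)) u i j = (u - ρ) • W u i j + η • ∑ k, e j k * W u i k := by
  simp only [Entries.mul, lax, mul_add, mul_smul_comm, Finset.sum_add_distrib,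
    ← Finset.smul_sum, mul_ite, mul_one, mul_zero, Finset.sum_ite_eq', Finset.mem_univ, if_true,
    (hc _ _ _ _ _).eq]

theorem lax_mul_apply (u : ℂ) (i j : Fin 2) :
    ((lax η ρ e).mul W) u i j = (u - ρ) • W u i j + η • ∑ k, e k i * W u k j := by
  simp only [Entries.mul, lax, add_mul, smul_mul_assoc, Finset.sum_add_distrib,
    ← Finset.smul_sum, ite_mul, one_mul, zero_mul, Finset.sum_ite_eq, Finset.mem_univ, if_true]

theorem transfer_mul_lax (hc : UnitsCommute e W) :
    transfer (W.mul (lax η ρ e)) ρ = η • ∑ a, ∑ b, e a b * W ρ a b := by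
  simp only [transfer, mul_lax_apply hc, sub_self, zero_smul, zero_add, ← smul_add,
    Fin.sum_univ_two]

/-- At `u = ρ` the Lax matrix degenerates to `η` times the permutation, which hands the auxiliary
space over to the site. The unit `e j i` then selects one row of the sum that forms the transfer
matrix. -/
theorem mul_lax_at (he : MatUnits e) (hc : UnitsCommute e W) (i j : Fin 2) :
    (W.mul (lax η ρ e)) ρ i j = e j i * transfer (W.mul (lax η ρ e)) ρ := by
  rw [transfer_mul_lax hc, mul_lax_apply hc, sub_self, zero_smul, zero_add, mul_smul_comm]
  congr 1
  simp only [Finset.mul_sum, ← mul_assoc, he.mul]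
  fin_cases i <;> simp

/-- Up to `η`, the sum is the transfer matrix at `ρ`. The Yangian relation of `W` at the points `u`
and `ρ`, with the second auxiliary space identified with the site, says that this operator carries
the site from the right end of the chain to the left end. -/
theorem shift_mul_lax (he : MatUnits e) (hW : Yangian η W) (hc : UnitsCommute e W) (u : ℂ)
    (i j : Fin 2) :
    (∑ a, ∑ b, e a b * W ρ a b) * (W.mul (lax η ρ e)) u i j =
      ((lax η ρ e).mul W) u i j * ∑ a, ∑ b, e a b * W ρ a b := by
  rw [mul_lax_apply hc, lax_mul_apply]
  have h1 : ∀ a b c d (x y x' y' : Fin 2) (u v : ℂ), e a b * W u x y * (e c d * W v x' y') =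
      (if b = c then e a d else 0) * (W u x y * W v x' y') := by
    intro a b c d x y x' y' u v
    rw [mul_assoc, ← mul_assoc (W u x y), ← (hc u c d x y).eq, ← he.mul]; simp only [mul_assoc]
  have h2 : (∑ a, ∑ b, e a b * W ρ a b) * ((u - ρ) • W u i j) =
      ∑ a, ∑ b, e a b * ((u - ρ) • (W ρ a b * W u i j)) := by
    simp only [Finset.sum_mul, mul_smul_comm, mul_assoc, Finset.smul_sum]
  have h3 : ((u - ρ) • W u i j) * (∑ a, ∑ b, e a b * W ρ a b) =
      ∑ a, ∑ b, e a b * ((u - ρ) • (W u i j * W ρ a b)) := by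
    simp only [Finset.mul_sum, mul_smul_comm, smul_mul_assoc]
    refine Finset.sum_congr rfl fun a _ => Finset.sum_congr rfl fun b _ => ?_
    rw [← mul_assoc, ← (hc u a b i j).eq, mul_assoc]
  have h4 : (∑ a, ∑ b, e a b * W ρ a b) * ∑ k, e j k * W u i k =
      ∑ a, ∑ b, e a b * (W ρ a j * W u i b) := by
    simp only [Finset.sum_mul]
    refine Finset.sum_congr rfl fun a _ => ?_
    simp only [Finset.mul_sum, h1]
    rw [Finset.sum_comm]
    refine Finset.sum_congr rfl fun b _ => ?_
    rw [Finset.sum_eq_single j (fun c _ hc => by simp [hc]) (by simp)]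
    simp
  have h5 : (∑ k, e k i * W u k j) * (∑ a, ∑ b, e a b * W ρ a b) =
      ∑ a, ∑ b, e a b * (W u a j * W ρ i b) := by
    simp only [Finset.sum_mul]
    refine Finset.sum_congr rfl fun a _ => ?_
    simp only [Finset.mul_sum, h1]
    rw [Finset.sum_eq_single i (fun c _ hc => by simp [hc.symm]) (by simp)]
    simp
  rw [mul_add, add_mul, h2, h3, mul_smul_comm, smul_mul_assoc, h4, h5]
  simp only [Finset.smul_sum, ← Finset.sum_add_distrib, ← mul_smul_comm, ← mul_add]
  refine Finset.sum_congr rfl fun a _ => Finset.sum_congr rfl fun b _ => ?_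
  simp only [mul_smul_comm (_ : ℂ) (W _ _ _)]
  congr 1
  have := hW u ρ i j a b
  rw [smul_sub, smul_sub, sub_eq_iff_eq_add] at this
  rw [this]; abel

end Shift

/-- A site: its inhomogeneity and its matrix units. -/
abbrev Site (A : Type*) := ℂ × (Fin 2 → Fin 2 → A)

/-- The product of the Lax matrices of a list of sites. -/
def laxProd (η : ℂ) : List (Site A) → Entries A
  | [] => Entries.one
  | p :: l => (lax η p.1 p.2).mul (laxProd η l)

theorem laxProd_concat (η : ℂ) (l : List (Site A)) (p : Site A) :
    laxProd η (l ++ [p]) = (laxProd η l).mul (lax η p.1 p.2) := by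
  induction l with
  | nil => simp only [List.nil_append, laxProd, Entries.mul_one, Entries.one_mul]
  | cons q l ih => simp only [List.cons_append, laxProd, ih, Entries.mul_assoc]

/-- The matrix units of a list of sites satisfy their relations and commute with each other. -/
def SitesIndep (l : List (Site A)) : Prop :=
  (∀ p ∈ l, MatUnits p.2) ∧ l.Pairwise fun p q => ∀ a b c d, Commute (p.2 a b) (q.2 c d)

theorem unitsCommute_lax {e e' : Fin 2 → Fin 2 → A} (h : ∀ a b c d, Commute (e a b) (e' c d))
    (η ρ : ℂ) : UnitsCommute e (lax η ρ e') := by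
  intro v a b k l
  unfold lax
  refine Commute.add_right (Commute.smul_right ?_ _) ((h _ _ _ _).smul_right _)
  split_ifs
  · exact Commute.one_right _
  · exact Commute.zero_right _

theorem unitsCommute_laxProd {e : Fin 2 → Fin 2 → A} {l : List (Site A)}
    (h : ∀ p ∈ l, ∀ a b c d, Commute (e a b) (p.2 c d)) (η : ℂ) :
    UnitsCommute e (laxProd η l) := by
  induction l with
  | nil =>
    intro v a b k l
    exact (Entries.Commutes.one_left (fun _ _ _ => e a b) v 0 k l 0 0).symm
  | cons p l ih =>
    exact UnitsCommute.mul (unitsCommute_lax (h p (by simp)) η p.1)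
      (ih fun q hq => h q (by simp [hq]))

theorem commutes_laxProd {W : Entries A} {l : List (Site A)}
    (h : ∀ p ∈ l, UnitsCommute p.2 W) (η : ℂ) : (laxProd η l).Commutes W := by
  induction l with
  | nil => exact Entries.Commutes.one_left W
  | cons p l ih =>
    exact Entries.Commutes.mul_left ((h p (by simp)).lax η p.1)
      (ih fun q hq => h q (by simp [hq]))

theorem SitesIndep.yangian {l : List (Site A)} (h : SitesIndep l) (η : ℂ) :
    Yangian η (laxProd η l) := by
  induction l with
  | nil => exact Yangian.one η
  | cons p l ih =>
    have h2 := List.pairwise_cons.1 h.2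
    exact Yangian.mul ((h.1 p (by simp)).yangian η p.1)
      (ih ⟨fun q hq => h.1 q (by simp [hq]), h2.2⟩)
      ((unitsCommute_laxProd h2.1 η).lax η p.1).symm

/-- The solution of the quantum inverse problem at the site `s`, with the sites `l` on its right. -/
theorem inverse_problem {η : ℂ} (s : Site A) (l : List (Site A)) (hl : SitesIndep (s :: l))
    (W : Entries A) (hW : Yangian η W) (hc : ∀ p ∈ s :: l, UnitsCommute p.2 W) (i j : Fin 2) :
    (l.reverse.map fun p => transfer (W.mul (laxProd η (s :: l))) p.1).prod *
        (W.mul (laxProd η (s :: l))) s.1 i j =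
      s.2 j i * ((l.reverse.map fun p => transfer (W.mul (laxProd η (s :: l))) p.1).prod *
        transfer (W.mul (laxProd η (s :: l))) s.1) := by
  induction l using List.reverseRecOn generalizing W with
  | nil =>
    simpa [laxProd, Entries.mul_one] using mul_lax_at (hl.1 s (by simp)) (hc s (by simp)) i j
  | append_singleton l p ih =>
    have hl' : SitesIndep ((s :: l) ++ [p]) := by simpa using hl
    have hpw := List.pairwise_append.1 hl'.2
    have hsl : SitesIndep (s :: l) := ⟨fun q hq => hl'.1 q (by simp at hq ⊢; tauto), hpw.1⟩
    have hp : MatUnits p.2 := hl'.1 p (by simp)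
    have hpc : UnitsCommute p.2 W := hc p (by simp)
    have hpl : UnitsCommute p.2 (laxProd η (s :: l)) :=
      unitsCommute_laxProd (fun q hq a b c d => (hpw.2.2 q hq p (by simp) c d a b).symm) η
    have hT : Yangian η (W.mul (laxProd η (s :: l))) :=
      hW.mul (hsl.yangian η) (commutes_laxProd (fun q hq => hc q (by simp at hq ⊢; tauto)) η)
    have hpT : UnitsCommute p.2 (W.mul (laxProd η (s :: l))) := hpc.mul hpl
    have hsplit : laxProd η (s :: (l ++ [p])) = (laxProd η (s :: l)).mul (lax η p.1 p.2) :=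
      laxProd_concat η (s :: l) p
    rw [hsplit, ← Entries.mul_assoc]
    have hW' : Yangian η ((lax η p.1 p.2).mul W) :=
      (hp.yangian η p.1).mul hW (hpc.lax η p.1).symm
    -- The last site, once moved to the left end, counts as part of `W`, so the induction hypothesis
    -- applies to the shorter list.
    have key := ih hsl ((lax η p.1 p.2).mul W) hW' (by
      intro q hq
      refine UnitsCommute.mul (unitsCommute_lax (fun a b c d => ?_) η p.1)
        (hc q (by simp at hq ⊢; tauto))
      exact hpw.2.2 q hq p (by simp) a b c d)
    rw [Entries.mul_assoc] at key
    generalize W.mul (laxProd η (s :: l)) = T at *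
    set Y := ∑ a, ∑ b, p.2 a b * T p.1 a b with hY
    have hsh : ∀ u i j, Y * (T.mul (lax η p.1 p.2)) u i j = ((lax η p.1 p.2).mul T) u i j * Y :=
      fun u i j => shift_mul_lax hp hT hpT u i j
    have htr : ∀ u, Y * transfer (T.mul (lax η p.1 p.2)) u =
        transfer ((lax η p.1 p.2).mul T) u * Y := by
      intro u; simp only [transfer, mul_add, add_mul, hsh]
    have hprod : ∀ l' : List (Site A),
        Y * (l'.map fun q => transfer (T.mul (lax η p.1 p.2)) q.1).prod =
        (l'.map fun q => transfer ((lax η p.1 p.2).mul T) q.1).prod * Y := by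
      intro l'
      induction l' with
      | nil => simp
      | cons q l' ih' =>
        simp only [List.map_cons, List.prod_cons]
        rw [← mul_assoc, htr, mul_assoc, ih', mul_assoc]
    simp only [List.reverse_append, List.reverse_singleton, List.singleton_append, List.map_cons,
      List.prod_cons]
    -- Because of the reversal, the leftmost factor is the transfer matrix at the last site, that is
    -- `η • Y`. It is pushed to the right end, turning each factor into the one of the shifted
    -- chain, and pushed back after `key`.
    rw [transfer_mul_lax hpT, ← hY]
    simp only [smul_mul_assoc, mul_smul_comm]
    congr 1
    rw [hprod, mul_assoc, hsh, ← mul_assoc, key, mul_assoc, mul_assoc, ← htr, ← mul_assoc _ Y,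
      ← hprod, mul_assoc]

end Algebra
end OpenXXX
end

/-! ### Action of the monodromy entries on the vectors `Φ`. -/

open scoped Matrix
noncomputable section
namespace OpenXXX

/-- `f(x|y) = (x - y + η)/(x - y)`. -/
def ff (η x y : ℂ) : ℂ := (x - y + η) / (x - y)

/-- Reversing the sign of `η` makes the exchange relation of `A` with `B` into that of `D` with `B`;
one induction thus covers both. -/
theorem ff_neg (η x y : ℂ) : ff (-η) x y = ff η y x := by
  unfold ff
  rw [← neg_div_neg_eq]
  congr 1 <;> ring

theorem ff_ne_zero {η x y : ℂ} (h : x - y + η ≠ 0) (hxy : x ≠ y) : ff η x y ≠ 0 :=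
  div_ne_zero h (sub_ne_zero.2 hxy)

/-- A highest weight representation of the Yangian. -/
structure HighestWeight (η : ℂ) (V : Type) [AddCommGroup V] [Module ℂ V] where
  T : Entries (Module.End ℂ V)
  yangian : Yangian η T
  Ω : V
  a : ℂ → ℂ
  d : ℂ → ℂ
  hA : ∀ u, T u 0 0 Ω = a u • Ω
  hD : ∀ u, T u 1 1 Ω = d u • Ω
  hC : ∀ u, T u 1 0 Ω = 0

theorem sum_insert_of_eq_zero {V : Type} [AddCommMonoid V] {z : ℂ} {W : Finset ℂ} {g : ℂ → V}
    {v : V} (h : g z = 0) (h' : ∑ b ∈ W, g b = v) : ∑ b ∈ insert z W, g b = v := by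
  rw [Finset.sum_insert_zero h, h']

theorem eq_zero_of_smul {V : Type} [AddCommGroup V] [Module ℂ V] {c : ℂ} {v : V} (hc : c ≠ 0)
    (h : c • v = 0) : v = 0 := (smul_eq_zero.1 h).resolve_left hc

namespace HighestWeight

variable {η : ℂ} {V : Type} [AddCommGroup V] [Module ℂ V] (Y : HighestWeight η V)

theorem rel_apply (u v : ℂ) (i j k l : Fin 2) (w : V) :
    (u - v) • (Y.T u i j (Y.T v k l w) - Y.T v k l (Y.T u i j w)) =
      η • (Y.T v k j (Y.T u i l w) - Y.T u k j (Y.T v i l w)) := by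
  have := congrArg (fun F : Module.End ℂ V => F w) (Y.yangian u v i j k l)
  simpa using this

/-- The relation and its mirror image give the commutator times `u - v + η` and times `v - u + η`.
The two factors add up to `2 * η`, so no condition on `u` and `v` is needed. -/
theorem commute_B (hη : η ≠ 0) (u v : ℂ) : Commute (Y.T u 0 1) (Y.T v 0 1) := by
  have h1 := Y.yangian u v 0 1 0 1
  rw [← sub_eq_zero] at h1
  have h2 : (u - v + η) • (Y.T u 0 1 * Y.T v 0 1 - Y.T v 0 1 * Y.T u 0 1) = 0 := by
    rw [← h1]; module
  have h3 := Y.yangian v u 0 1 0 1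
  rw [← sub_eq_zero] at h3
  have h4 : (v - u + η) • (Y.T u 0 1 * Y.T v 0 1 - Y.T v 0 1 * Y.T u 0 1) = 0 := by
    rw [← neg_eq_zero, ← h3]; module
  have h5 : (2 * η) • (Y.T u 0 1 * Y.T v 0 1 - Y.T v 0 1 * Y.T u 0 1) = 0 := by
    have := congrArg₂ (· + ·) h2 h4
    simp only [← add_smul, add_zero] at this
    rw [← this]; congr 1; ring
  exact sub_eq_zero.1 ((smul_eq_zero.1 h5).resolve_left (by simp [hη]))

theorem A_B (x y : ℂ) (h : x ≠ y) (w : V) : Y.T x 0 0 (Y.T y 0 1 w) =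
    ff η y x • Y.T y 0 1 (Y.T x 0 0 w) + (η / (x - y)) • Y.T x 0 1 (Y.T y 0 0 w) := by
  have h0 : x - y ≠ 0 := sub_ne_zero.2 h
  have h1 : y - x ≠ 0 := sub_ne_zero.2 h.symm
  have h2 := Y.rel_apply y x 0 1 0 0 w
  rw [← sub_eq_zero] at h2 ⊢
  refine eq_zero_of_smul h1 ?_
  rw [← neg_eq_zero, ← h2, ff]
  match_scalars <;> field_simp <;> ring

theorem D_B (x y : ℂ) (h : x ≠ y) (w : V) : Y.T x 1 1 (Y.T y 0 1 w) =
    ff (-η) y x • Y.T y 0 1 (Y.T x 1 1 w) + (-η / (x - y)) • Y.T x 0 1 (Y.T y 1 1 w) := by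
  have h0 : x - y ≠ 0 := sub_ne_zero.2 h
  have h1 : y - x ≠ 0 := sub_ne_zero.2 h.symm
  have h2 := Y.rel_apply x y 1 1 0 1 w
  rw [← sub_eq_zero] at h2 ⊢
  refine eq_zero_of_smul h0 ?_
  rw [← h2, ff]
  match_scalars <;> field_simp <;> ring

theorem C_B (x y : ℂ) (h : x ≠ y) (w : V) : Y.T x 1 0 (Y.T y 0 1 w) =
    Y.T y 0 1 (Y.T x 1 0 w) +
      (η / (x - y)) • (Y.T y 0 0 (Y.T x 1 1 w) - Y.T x 0 0 (Y.T y 1 1 w)) := by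
  have h0 : x - y ≠ 0 := sub_ne_zero.2 h
  have h2 := Y.rel_apply x y 1 0 0 1 w
  rw [← sub_eq_zero] at h2 ⊢
  refine eq_zero_of_smul h0 ?_
  rw [← h2]
  match_scalars <;> field_simp

/-- The vector `∏_{x ∈ I} B(x) Ω`. -/
def Φ (I : Finset ℂ) : V := (I.toList.map fun x => Y.T x 0 1).prod Y.Ω

theorem Φ_toFinset (hη : η ≠ 0) (l : List ℂ) (hl : l.Nodup) :
    (l.map fun x => Y.T x 0 1).prod Y.Ω = Y.Φ l.toFinset := by
  unfold Φ
  congr 1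
  refine List.Perm.prod_eq' ?_ ?_
  · exact ((List.toFinset_toList hl).map _).symm
  · rw [List.pairwise_map]
    exact List.pairwise_of_forall fun x y => Y.commute_B hη x y

theorem Φ_empty : Y.Φ ∅ = Y.Ω := by simp [Φ]

theorem Φ_insert (hη : η ≠ 0) {x : ℂ} {I : Finset ℂ} (hx : x ∉ I) :
    Y.Φ (insert x I) = Y.T x 0 1 (Y.Φ I) := by
  have := Y.Φ_toFinset hη (x :: I.toList) (by simp [hx, Finset.nodup_toList])
  simp only [List.toFinset_cons, Finset.toList_toFinset] at this
  rw [← this]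
  simp [Φ]

/-- Action on `Φ I` of an operator which is exchanged with `B` as `A` and `D` are. -/
theorem exchange_action (hη : η ≠ 0) (κ : ℂ) (O : ℂ → Module.End ℂ V) (o : ℂ → ℂ)
    (hO : ∀ x y, x ≠ y → ∀ w, O x (Y.T y 0 1 w) =
      ff κ y x • Y.T y 0 1 (O x w) + (κ / (x - y)) • Y.T x 0 1 (O y w))
    (ho : ∀ x, O x Y.Ω = o x • Y.Ω) (I : Finset ℂ) :
    ∀ x, x ∉ I → O x (Y.Φ I) = (o x * ∏ y ∈ I, ff κ y x) • Y.Φ I +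
      ∑ p ∈ I, (κ / (x - p) * (o p * ∏ y ∈ I.erase p, ff κ y p)) • Y.Φ (insert x (I.erase p)) := by
  induction I using Finset.induction_on with
  | empty => intro x _; simp [Φ_empty, ho]
  | insert z I hz ih =>
    intro x hx
    have hxz : x ≠ z := fun h => hx (by simp [h])
    have hxI : x ∉ I := fun h => hx (by simp [h])
    rw [Y.Φ_insert hη hz, hO x z hxz, ih x hxI, ih z hz]
    simp only [map_add, map_smul, map_sum, smul_add, Finset.smul_sum]
    rw [← Y.Φ_insert hη hz, ← Y.Φ_insert hη hxI, Finset.prod_insert hz, Finset.sum_insert hz,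
      Finset.erase_insert hz]
    have key : ∑ p ∈ I, (κ / (x - p) * (o p * ∏ y ∈ (insert z I).erase p, ff κ y p)) •
          Y.Φ (insert x ((insert z I).erase p)) =
        ∑ p ∈ I, ff κ z x • (κ / (x - p) * (o p * ∏ y ∈ I.erase p, ff κ y p)) •
          Y.T z 0 1 (Y.Φ (insert x (I.erase p))) +
        ∑ p ∈ I, (κ / (x - z)) • (κ / (z - p) * (o p * ∏ y ∈ I.erase p, ff κ y p)) •
          Y.T x 0 1 (Y.Φ (insert z (I.erase p))) := by
      rw [← Finset.sum_add_distrib]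
      refine Finset.sum_congr rfl fun p hp => ?_
      have hzp : z ≠ p := fun h => hz (h ▸ hp)
      have hxp : x ≠ p := fun h => hxI (h ▸ hp)
      have hz' : z ∉ I.erase p := fun h => hz (Finset.mem_of_mem_erase h)
      have hx' : x ∉ I.erase p := fun h => hxI (Finset.mem_of_mem_erase h)
      rw [Finset.erase_insert_of_ne hzp, Finset.prod_insert hz',
        ← Y.Φ_insert hη (by simp [hxz.symm, hz'] : z ∉ insert x (I.erase p)),
        ← Y.Φ_insert hη (by simp [hxz, hx'] : x ∉ insert z (I.erase p)),
        Finset.insert_comm z x, smul_smul, smul_smul, ← add_smul]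
      congr 1
      have h1 : x - z ≠ 0 := sub_ne_zero.2 hxz
      have h1' : z - x ≠ 0 := sub_ne_zero.2 hxz.symm
      have h2 : x - p ≠ 0 := sub_ne_zero.2 hxp
      have h3 : z - p ≠ 0 := sub_ne_zero.2 hzp
      -- The point `p` is exchanged for `x` either directly, past `z`, or by way of `z`; this
      -- three-term identity adds the two contributions.
      have : κ / (x - p) * ff κ z p = ff κ z x * (κ / (x - p)) + κ / (x - z) * (κ / (z - p)) := by
        unfold ff; field_simp; ring
      linear_combination (o p * ∏ y ∈ I.erase p, ff κ y p) * this
    rw [key]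
    module

theorem A_Φ (hη : η ≠ 0) {I : Finset ℂ} {x : ℂ} (hx : x ∉ I) :
    Y.T x 0 0 (Y.Φ I) = (Y.a x * ∏ y ∈ I, ff η y x) • Y.Φ I +
      ∑ p ∈ I, (η / (x - p) * (Y.a p * ∏ y ∈ I.erase p, ff η y p)) •
        Y.Φ (insert x (I.erase p)) :=
  Y.exchange_action hη η (fun x => Y.T x 0 0) Y.a Y.A_B Y.hA I x hx

theorem D_Φ (hη : η ≠ 0) {I : Finset ℂ} {x : ℂ} (hx : x ∉ I) :
    Y.T x 1 1 (Y.Φ I) = (Y.d x * ∏ y ∈ I, ff η x y) • Y.Φ I +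
      ∑ p ∈ I, (-η / (x - p) * (Y.d p * ∏ y ∈ I.erase p, ff η p y)) •
        Y.Φ (insert x (I.erase p)) := by
  have := Y.exchange_action hη (-η) (fun x => Y.T x 1 1) Y.d Y.D_B Y.hD I x hx
  simpa only [ff_neg] using this

/-- The diagonal term becomes the term `p = x` of the sum, with prefactor `η / η = 1`. The action
then reads as the removal of one point from `insert x I`, with `x` on the same footing as the
others. -/
theorem A_Φ' (hη : η ≠ 0) {I : Finset ℂ} {x : ℂ} (hx : x ∉ I) (h : ∀ p ∈ I, x - p + η ≠ 0) :
    Y.T x 0 0 (Y.Φ I) = ∑ p ∈ insert x I,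
      (η / (x - p + η) * (Y.a p * ∏ y ∈ (insert x I).erase p, ff η y p)) •
        Y.Φ ((insert x I).erase p) := by
  rw [Y.A_Φ hη hx, Finset.sum_insert hx, Finset.erase_insert hx]
  congr 1
  · congr 1; rw [sub_self, zero_add, div_self hη, one_mul]
  · refine Finset.sum_congr rfl fun p hp => ?_
    have hxp : x ≠ p := fun h => hx (h ▸ hp)
    have hx' : x ∉ I.erase p := fun h => hx (Finset.mem_of_mem_erase h)
    rw [Finset.erase_insert_of_ne hxp, Finset.prod_insert hx']
    congr 1
    have h1 : x - p ≠ 0 := sub_ne_zero.2 hxp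
    have h2 := h p hp
    unfold ff
    field_simp

theorem D_Φ' (hη : η ≠ 0) {I : Finset ℂ} {x : ℂ} (hx : x ∉ I) (h : ∀ p ∈ I, p - x + η ≠ 0) :
    Y.T x 1 1 (Y.Φ I) = ∑ p ∈ insert x I,
      (η / (p - x + η) * (Y.d p * ∏ y ∈ (insert x I).erase p, ff η p y)) •
        Y.Φ ((insert x I).erase p) := by
  rw [Y.D_Φ hη hx, Finset.sum_insert hx, Finset.erase_insert hx]
  congr 1
  · congr 1; rw [sub_self, zero_add, div_self hη, one_mul]
  · refine Finset.sum_congr rfl fun p hp => ?_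
    have hxp : x ≠ p := fun h => hx (h ▸ hp)
    have hx' : x ∉ I.erase p := fun h => hx (Finset.mem_of_mem_erase h)
    rw [Finset.erase_insert_of_ne hxp, Finset.prod_insert hx']
    congr 1
    have h1 : x - p ≠ 0 := sub_ne_zero.2 hxp
    have h1' : p - x ≠ 0 := sub_ne_zero.2 hxp.symm
    have h2 := h p hp
    have : -η / (x - p) = η / (p - x + η) * ff η p x := by
      unfold ff; field_simp; ring
    rw [this]; ring

/-- Since `C` annihilates `Ω`, only its commutators with the factors `B` contribute. Each leaves a
`D` and an `A`, and each of these removes one point. Moving `C` past one more `B` reduces the claim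
to an identity of rational functions for every ordered pair of removed points. -/
theorem C_Φ (hη : η ≠ 0) (I : Finset ℂ) : ∀ x, x ∉ I →
    (∀ p ∈ insert x I, ∀ q ∈ insert x I, p - q + η ≠ 0) →
    Y.T x 1 0 (Y.Φ I) = ∑ b ∈ insert x I, ∑ p ∈ (insert x I).erase b,
      (η / (b - x + η) * (Y.d b * ∏ y ∈ (insert x I).erase b, ff η b y) *
        (η / (x - p + η) * (Y.a p * ∏ y ∈ ((insert x I).erase b).erase p, ff η y p))) •
        Y.Φ (((insert x I).erase b).erase p) := by
  induction I using Finset.induction_on with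
  | empty => intro x _ _; simp [Φ_empty, Y.hC]
  | insert z I hz ih =>
    intro x hx h
    have hxz : x ≠ z := fun h => hx (by simp [h])
    have hzx : z ≠ x := hxz.symm
    have hxI : x ∉ I := fun h => hx (by simp [h])
    have hzW : z ∉ insert x I := by simp [hzx, hz]
    have hxW : x ∉ insert z I := hx
    have hx0 : x - z ≠ 0 := sub_ne_zero.2 hxz
    have hx1 : z - x ≠ 0 := sub_ne_zero.2 hzx
    have hzx1 : z - x + η ≠ 0 := h z (by simp) x (by simp)
    have hxz1 : x - z + η ≠ 0 := h x (by simp) z (by simp)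
    rw [Y.Φ_insert hη hz, Y.C_B x z hxz,
      ih x hxI fun p hp q hq => h p (by simp at hp ⊢; tauto) q (by simp at hq ⊢; tauto),
      Y.D_Φ' hη hxI fun p hp => h p (by simp [hp]) x (by simp),
      Y.D_Φ' hη hz fun p hp => h p (by simp [hp]) z (by simp)]
    simp only [map_sum, map_smul, smul_sub]
    set W := insert x I with hW
    have hWz : insert x (insert z I) = insert z W := Finset.insert_comm _ _ _
    have hWx : (insert z W).erase x = insert z I := by
      rw [← hWz, Finset.erase_insert hxW]
    rw [hWz]
    -- The three contributions are brought to sums over the same pairs `(b, p)` from `insert z W`,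
    -- with coefficient zero for the pairs that do not occur.
    have e1 : ∑ b ∈ W, ∑ p ∈ W.erase b, (η / (b - x + η) * (Y.d b * ∏ y ∈ W.erase b, ff η b y) *
        (η / (x - p + η) * (Y.a p * ∏ y ∈ (W.erase b).erase p, ff η y p))) •
          Y.T z 0 1 (Y.Φ ((W.erase b).erase p)) =
        ∑ b ∈ insert z W, ∑ p ∈ (insert z W).erase b, (if b = z ∨ p = z then 0 else
          (η / (b - x + η) * (Y.d b * ∏ y ∈ W.erase b, ff η b y) *
        (η / (x - p + η) * (Y.a p * ∏ y ∈ (W.erase b).erase p, ff η y p)))) •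
          Y.Φ (((insert z W).erase b).erase p) := by
      refine Eq.symm (sum_insert_of_eq_zero ?_ ?_)
      · exact Finset.sum_eq_zero fun p _ => by simp
      refine Eq.symm (Finset.sum_congr rfl fun b hb => ?_)
      have hzb : z ≠ b := fun h => hzW (h ▸ hb)
      rw [Finset.erase_insert_of_ne hzb,
        Finset.sum_insert fun h => hzW (Finset.mem_of_mem_erase h), if_pos (Or.inr rfl), zero_smul,
        zero_add]
      refine Finset.sum_congr rfl fun p hp => ?_
      have hzp : z ≠ p := fun h => hzW (h ▸ Finset.mem_of_mem_erase hp)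
      rw [Finset.erase_insert_of_ne hzp, if_neg (by tauto), Y.Φ_insert hη
        fun h => hzW (Finset.mem_of_mem_erase (Finset.mem_of_mem_erase h))]
    have e2 : ∑ b ∈ W, (η / (b - x + η) * (Y.d b * ∏ y ∈ W.erase b, ff η b y)) •
          Y.T z 0 0 (Y.Φ (W.erase b)) =
        ∑ b ∈ insert z W, ∑ p ∈ (insert z W).erase b, (if b = z then 0 else
          (η / (b - x + η) * (Y.d b * ∏ y ∈ W.erase b, ff η b y) *
        (η / (z - p + η) * (Y.a p * ∏ y ∈ ((insert z W).erase b).erase p, ff η y p)))) •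
          Y.Φ (((insert z W).erase b).erase p) := by
      refine Eq.symm (sum_insert_of_eq_zero ?_ ?_)
      · exact Finset.sum_eq_zero fun p _ => by simp
      refine Eq.symm (Finset.sum_congr rfl fun b hb => ?_)
      have hzb : z ≠ b := fun h => hzW (h ▸ hb)
      rw [Finset.erase_insert_of_ne hzb, Y.A_Φ' hη (fun h => hzW (Finset.mem_of_mem_erase h))
        fun p hp => h z (by simp) p (by simp [hW] at hp ⊢; tauto), Finset.smul_sum]
      refine Finset.sum_congr rfl fun p hp => ?_
      rw [if_neg hzb.symm, smul_smul]
    have e3 : ∑ b ∈ insert z I, (η / (b - z + η) *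
          (Y.d b * ∏ y ∈ (insert z I).erase b, ff η b y)) •
          Y.T x 0 0 (Y.Φ ((insert z I).erase b)) =
        ∑ b ∈ insert z W, ∑ p ∈ (insert z W).erase b, (if b = x then 0 else
          (η / (b - z + η) * (Y.d b * ∏ y ∈ (insert z I).erase b, ff η b y) *
        (η / (x - p + η) * (Y.a p * ∏ y ∈ ((insert z W).erase b).erase p, ff η y p)))) •
          Y.Φ (((insert z W).erase b).erase p) := by
      rw [← hWz]
      refine Eq.symm (sum_insert_of_eq_zero ?_ ?_)
      · exact Finset.sum_eq_zero fun p _ => by simp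
      refine Eq.symm (Finset.sum_congr rfl fun b hb => ?_)
      have hxb : x ≠ b := fun h => hxW (h ▸ hb)
      rw [Finset.erase_insert_of_ne hxb, Y.A_Φ' hη (fun h => hxW (Finset.mem_of_mem_erase h))
        fun p hp => h x (by simp) p (by simp at hp ⊢; tauto), Finset.smul_sum]
      refine Finset.sum_congr rfl fun p hp => ?_
      rw [if_neg hxb.symm, smul_smul]
    rw [e1, e2, e3]
    simp only [Finset.smul_sum, ← Finset.sum_sub_distrib, ← Finset.sum_add_distrib]
    refine Finset.sum_congr rfl fun b hb => Finset.sum_congr rfl fun p hp => ?_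
    rw [smul_smul, smul_smul, ← sub_smul, ← add_smul]
    congr 1
    have hbp : b ≠ p := (Finset.ne_of_mem_erase hp).symm
    have hb' : b ∈ insert x (insert z I) := hWz ▸ hb
    have hp' : p ∈ insert x (insert z I) := hWz ▸ Finset.mem_of_mem_erase hp
    have n1 := h b hb' x (by simp)
    have n2 := h b hb' z (by simp)
    have n3 := h x (by simp) p hp'
    have n4 := h z (by simp) p hp'
    have F1z : b ≠ z → ∏ y ∈ (insert z W).erase b, ff η b y =
        ff η b z * ∏ y ∈ W.erase b, ff η b y := fun hbz => by
      rw [Finset.erase_insert_of_ne (Ne.symm hbz),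
        Finset.prod_insert fun h => hzW (Finset.mem_of_mem_erase h)]
    have F1x : b ≠ x → ∏ y ∈ (insert z W).erase b, ff η b y =
        ff η b x * ∏ y ∈ (insert z I).erase b, ff η b y := fun hbx => by
      rw [← hWz, Finset.erase_insert_of_ne (Ne.symm hbx),
        Finset.prod_insert fun h => hxW (Finset.mem_of_mem_erase h)]
    have F2z : b ≠ z → p ≠ z → ∏ y ∈ ((insert z W).erase b).erase p, ff η y p =
        ff η z p * ∏ y ∈ (W.erase b).erase p, ff η y p := fun hbz hpz => by
      rw [Finset.erase_insert_of_ne (Ne.symm hbz), Finset.erase_insert_of_ne (Ne.symm hpz),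
        Finset.prod_insert fun h => hzW (Finset.mem_of_mem_erase (Finset.mem_of_mem_erase h))]
    clear e1 e2 e3 ih
    -- The products contain the factors of `x` and `z` only if these points are not removed, hence
    -- the case distinctions.
    by_cases hbz : b = z
    · rw [if_pos (Or.inl hbz), if_pos hbz, if_neg (hbz ▸ hzx), F1x (hbz ▸ hzx), hbz]
      simp only [sub_self, zero_add, div_self hη]
      generalize ∏ y ∈ (insert z I).erase z, ff η z y = P1
      generalize ∏ y ∈ ((insert z W).erase z).erase p, ff η y p = P2
      unfold ff
      field_simp
      ring
    · have b1 : b - z ≠ 0 := sub_ne_zero.2 hbz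
      rw [if_neg hbz]
      have hx3 : b ≠ x → ∏ y ∈ (insert z I).erase b, ff η b y =
          ff η b z * (∏ y ∈ W.erase b, ff η b y) / ff η b x := fun hbx => by
        have := F1x hbx
        rw [F1z hbz] at this
        rw [this, mul_div_cancel_left₀ _ (ff_ne_zero n1 hbx)]
      by_cases hpz : p = z
      · rw [if_pos (Or.inr hpz), F1z hbz, hpz]
        simp only [sub_self, zero_add, div_self hη]
        by_cases hbx : b = x
        · rw [if_pos hbx, hbx]
          simp only [sub_self, zero_add, div_self hη]
          generalize ∏ y ∈ W.erase x, ff η x y = P1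
          generalize ∏ y ∈ ((insert z W).erase x).erase z, ff η y z = P2
          unfold ff
          field_simp
          ring
        · rw [if_neg hbx, hx3 hbx]
          have b2 : b - x ≠ 0 := sub_ne_zero.2 hbx
          generalize ∏ y ∈ W.erase b, ff η b y = P1
          generalize ∏ y ∈ ((insert z W).erase b).erase z, ff η y z = P2
          unfold ff
          field_simp
          ring
      · rw [if_neg (by tauto), F1z hbz, F2z hbz hpz]
        have p1 : z - p ≠ 0 := sub_ne_zero.2 (Ne.symm hpz)
        by_cases hbx : b = x
        · rw [if_pos hbx, hbx]
          simp only [sub_self, zero_add, div_self hη]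
          generalize ∏ y ∈ W.erase x, ff η x y = P1
          generalize ∏ y ∈ (W.erase x).erase p, ff η y p = P2
          unfold ff
          field_simp
          ring
        · rw [if_neg hbx, hx3 hbx]
          have b2 : b - x ≠ 0 := sub_ne_zero.2 hbx
          generalize ∏ y ∈ W.erase b, ff η b y = P1
          generalize ∏ y ∈ (W.erase b).erase p, ff η y p = P2
          unfold ff
          field_simp
          ring

/-- The action of the transfer matrix. -/
theorem transfer_Φ (hη : η ≠ 0) {I : Finset ℂ} {x : ℂ} (hx : x ∉ I) (hd : Y.d x = 0) :
    transfer Y.T x (Y.Φ I) = (Y.a x * ∏ y ∈ I, ff η y x) • Y.Φ I +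
      ∑ p ∈ I, (η / (x - p) * (Y.a p * ∏ y ∈ I.erase p, ff η y p -
        Y.d p * ∏ y ∈ I.erase p, ff η p y)) • Y.Φ (insert x (I.erase p)) := by
  rw [transfer, LinearMap.add_apply, Y.A_Φ hη hx, Y.D_Φ hη hx, hd, zero_mul, zero_smul, zero_add,
    add_assoc, ← Finset.sum_add_distrib]
  congr 1
  refine Finset.sum_congr rfl fun p _ => ?_
  rw [← add_smul]
  congr 1
  ring

end HighestWeight
end OpenXXX
end

/-! ### The exchange determinant and its partial fraction expansion. -/

open scoped Matrix
noncomputable section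
namespace OpenXXX

theorem prod_erase_eq_prod_ite' {ι R : Type*} [DecidableEq ι] [CommMonoid R] {s : Finset ι}
    {a : ι} (ha : a ∈ s) (g : ι → R) :
    ∏ j ∈ s.erase a, g j = ∏ j ∈ s, if j = a then 1 else g j := by
  rw [← Finset.mul_prod_erase s (fun j => if j = a then 1 else g j) ha, if_pos rfl, one_mul]
  exact Finset.prod_congr rfl fun j hj => by rw [if_neg (Finset.ne_of_mem_erase hj)]

theorem prod_erase_eq_prod_ite {ι R : Type*} [Fintype ι] [DecidableEq ι] [CommMonoid R] (a : ι)
    (g : ι → R) : ∏ j ∈ Finset.univ.erase a, g j = ∏ j, if j = a then 1 else g j :=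
  prod_erase_eq_prod_ite' (Finset.mem_univ a) g

theorem prod_erase_fin {n : ℕ} {R : Type*} [CommMonoid R] (i : Fin (n + 1)) (g : Fin (n + 1) → R) :
    ∏ j ∈ Finset.univ.erase i, g j = ∏ j, g (i.succAbove j) := by
  rw [prod_erase_eq_prod_ite, Fin.prod_univ_succAbove _ i, if_pos rfl, one_mul]
  exact Finset.prod_congr rfl fun j _ => by rw [if_neg (Fin.succAbove_ne i j)]

theorem prod_erase_succ {n : ℕ} {R : Type*} [CommMonoid R] (k : Fin n) (g : Fin (n + 1) → R) :
    ∏ j ∈ Finset.univ.erase k.succ, g j = g 0 * ∏ j ∈ Finset.univ.erase k, g j.succ := by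
  rw [prod_erase_eq_prod_ite, prod_erase_eq_prod_ite, Fin.prod_univ_succ,
    if_neg (Fin.succ_ne_zero k).symm]
  simp [Fin.succ_inj]

/-- The Vandermonde determinant `∏_{i < j} (v j - v i)`. -/
def vdm {n : ℕ} (v : Fin n → ℂ) : ℂ := (Matrix.vandermonde v).det

theorem vdm_perm {n : ℕ} (v : Fin n → ℂ) (σ : Equiv.Perm (Fin n)) :
    vdm (v ∘ σ) = ((Equiv.Perm.sign σ : ℤ) : ℂ) * vdm v := by
  unfold vdm
  rw [← Matrix.det_permute]
  rfl

theorem vdm_cons {n : ℕ} (x : ℂ) (v : Fin n → ℂ) :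
    vdm (Fin.cons x v : Fin (n + 1) → ℂ) = (∏ k, (v k - x)) * vdm v := by
  rw [vdm, vdm, Matrix.det_vandermonde, Matrix.det_vandermonde, Fin.prod_univ_succ]
  simp [Fin.prod_Ioi_succ]

/-- Bringing the variable `i` to the front is a cycle of sign `(-1) ^ i`. -/
theorem vdm_succAbove {n : ℕ} (v : Fin (n + 1) → ℂ) (i : Fin (n + 1)) :
    (-1) ^ (i : ℕ) * vdm v = (∏ k, (v (i.succAbove k) - v i)) * vdm (v ∘ i.succAbove) := by
  have h1 := vdm_cons (v i) (v ∘ i.succAbove)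
  simp only [Function.comp_apply] at h1
  rw [← h1]
  have := Fin.cons_removeNth_eq_comp_cycleRange_symm v i
  have h2 : (i.removeNth v) = v ∘ i.succAbove := rfl
  rw [h2] at this
  rw [this, vdm_perm]
  simp [Equiv.Perm.sign_symm, Fin.sign_cycleRange]

theorem vdm_ne_zero {n : ℕ} {v : Fin n → ℂ} (h : Function.Injective v) : vdm v ≠ 0 :=
  Matrix.det_vandermonde_ne_zero_iff.2 h

/-- The matrix of the exchange coefficient, with the common denominators taken out. -/
def slavMat (η : ℂ) {n : ℕ} (lam x w : Fin n → ℂ) : Matrix (Fin n) (Fin n) ℂ :=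
  Matrix.of fun j k => η / (x k - lam j) * (∏ i ∈ Finset.univ.erase k, (x i - lam j + η) -
    w j * ∏ i ∈ Finset.univ.erase k, (x i - lam j - η))

/-- The coefficient of the exchange of the variables `lam` for the variables `x`. -/
def slav (η : ℂ) {n : ℕ} (lam x w : Fin n → ℂ) : ℂ :=
  (slavMat η lam x w).det / (vdm x * vdm (-lam))

theorem sign_ne_zero {n : ℕ} (σ : Equiv.Perm (Fin n)) : ((Equiv.Perm.sign σ : ℤ) : ℂ) ≠ 0 := by
  rcases Int.units_eq_one_or (Equiv.Perm.sign σ) with h | h <;> simp [h]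

/-- Determinant and Vandermonde factor acquire the same sign. With the analogous invariance in `x`,
the coefficient depends only on the two sets of variables. -/
theorem slav_perm_left (η : ℂ) {n : ℕ} (lam x w : Fin n → ℂ) (σ : Equiv.Perm (Fin n)) :
    slav η (lam ∘ σ) x (w ∘ σ) = slav η lam x w := by
  have h1 : slavMat η (lam ∘ σ) x (w ∘ σ) = (slavMat η lam x w).submatrix σ id := rfl
  have h2 : -(lam ∘ σ) = (-lam) ∘ σ := rfl
  unfold slav
  rw [h1, h2, Matrix.det_permute, vdm_perm, mul_left_comm, mul_div_mul_left _ _ (sign_ne_zero σ)]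

theorem slav_perm_right (η : ℂ) {n : ℕ} (lam x w : Fin n → ℂ) (σ : Equiv.Perm (Fin n)) :
    slav η lam (x ∘ σ) w = slav η lam x w := by
  have h1 : slavMat η lam (x ∘ σ) w = (slavMat η lam x w).submatrix id σ := by
    ext j k
    have : ∀ g : Fin n → ℂ, ∏ i ∈ Finset.univ.erase k, g (σ i) =
        ∏ i ∈ Finset.univ.erase (σ k), g i := by
      intro g
      rw [prod_erase_eq_prod_ite, prod_erase_eq_prod_ite,
        ← Equiv.prod_comp σ fun j => if j = σ k then 1 else g j]
      simp
    simp only [slavMat, Matrix.of_apply, Matrix.submatrix_apply, Function.comp_apply, id]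
    rw [this fun i => x i - lam j + η, this fun i => x i - lam j - η]
  unfold slav
  rw [h1, Matrix.det_permute', vdm_perm, mul_assoc, mul_div_mul_left _ _ (sign_ne_zero σ)]

/-- Lagrange interpolation at the poles; the degree bound excludes a polynomial part. -/
theorem partial_fractions {ι : Type*} [Fintype ι] [DecidableEq ι] {v : ι → ℂ}
    (hv : Function.Injective v) {P : Polynomial ℂ} (hP : P.natDegree < Fintype.card ι) {x : ℂ}
    (hx : ∀ i, x ≠ v i) : P.eval x / ∏ i, (x - v i) =
      ∑ i, P.eval (v i) / (∏ j ∈ Finset.univ.erase i, (v i - v j)) / (x - v i) := by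
  have h1 : P.degree < (Finset.univ : Finset ι).card :=
    lt_of_le_of_lt Polynomial.degree_le_natDegree (by exact_mod_cast hP)
  have h2 := congrArg (Polynomial.eval x) (Lagrange.eq_interpolate (v := v) hv.injOn h1)
  rw [Lagrange.eval_interpolate_not_at_node _ fun i _ => hx i, Lagrange.eval_nodal] at h2
  have h3 : ∏ i, (x - v i) ≠ 0 := Finset.prod_ne_zero_iff.2 fun i _ => sub_ne_zero.2 (hx i)
  rw [h2, mul_div_cancel_left₀ _ h3]
  refine Finset.sum_congr rfl fun i _ => ?_
  rw [Lagrange.nodalWeight, Finset.prod_inv_distrib]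
  field_simp

section Interpolation

variable (η : ℂ) {n : ℕ} (lam : Fin (n + 1) → ℂ) (x₀ : Fin n → ℂ) (w : Fin (n + 1) → ℂ)

/-- The part of the entries of `slavMat` in the column of the new variable which does not depend
on it. -/
def slavCol (i : Fin (n + 1)) : ℂ := ∏ k, (x₀ k - lam i + η) - w i * ∏ k, (x₀ k - lam i - η)

/-- Coefficients of the entries of `slavMat` that are affine in the new variable. -/
def slavLin (i : Fin (n + 1)) (k : Fin n) : ℂ :=
  η / (x₀ k - lam i) * (∏ j ∈ Finset.univ.erase k, (x₀ j - lam i + η) -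
    w i * ∏ j ∈ Finset.univ.erase k, (x₀ j - lam i - η))

def slavConst (i : Fin (n + 1)) (k : Fin n) : ℂ :=
  η / (x₀ k - lam i) * ((-lam i + η) * ∏ j ∈ Finset.univ.erase k, (x₀ j - lam i + η) -
    w i * ((-lam i - η) * ∏ j ∈ Finset.univ.erase k, (x₀ j - lam i - η)))

theorem slavMat_cons_zero (x : ℂ) (i : Fin (n + 1)) :
    slavMat η lam (Fin.cons x x₀ : Fin (n + 1) → ℂ) w i 0 =
      η / (x - lam i) * slavCol η lam x₀ w i := by
  simp only [slavMat, Matrix.of_apply, prod_erase_fin, Fin.cons_zero, Fin.zero_succAbove,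
    Fin.cons_succ, slavCol]

theorem slavMat_cons_succ (x : ℂ) (i : Fin (n + 1)) (k : Fin n) :
    slavMat η lam (Fin.cons x x₀ : Fin (n + 1) → ℂ) w i k.succ =
      x * slavLin η lam x₀ w i k + slavConst η lam x₀ w i k := by
  simp only [slavMat, Matrix.of_apply, prod_erase_succ, Fin.cons_zero,
    Fin.cons_succ, slavLin, slavConst]
  ring

open Polynomial in
/-- The determinant of `slavMat` times `∏ (x - lam i)`, as a polynomial in the new variable. -/
def slavPoly : ℂ[X] := ∑ i : Fin (n + 1), (-1) ^ (i : ℕ) *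
  (C (η * slavCol η lam x₀ w i) * ∏ j, (X - C (lam (i.succAbove j)))) *
  Matrix.det ((X : ℂ[X]) •
    ((Matrix.of (slavLin η lam x₀ w)).submatrix i.succAbove id).map C +
    ((Matrix.of (slavConst η lam x₀ w)).submatrix i.succAbove id).map C)

-- In each term of the expansion along the new column, `n` linear factors remain from the product
-- over `lam`, and the minor has `n` columns affine in the new variable.
open Polynomial in
theorem natDegree_slavPoly : (slavPoly η lam x₀ w).natDegree ≤ 2 * n := by
  refine natDegree_sum_le_of_forall_le _ _ fun i _ => ?_
  refine natDegree_mul_le.trans ?_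
  have h1 := natDegree_det_X_add_C_le
    ((Matrix.of (slavLin η lam x₀ w)).submatrix i.succAbove id)
    ((Matrix.of (slavConst η lam x₀ w)).submatrix i.succAbove id)
  rw [Fintype.card_fin] at h1
  have h2 : ((-1 : ℂ[X]) ^ (i : ℕ) * (C (η * slavCol η lam x₀ w i) *
      ∏ j, (X - C (lam (i.succAbove j))))).natDegree ≤ n := by
    rw [show (-1 : ℂ[X]) ^ (i : ℕ) = C ((-1) ^ (i : ℕ)) by simp]
    refine (natDegree_C_mul_le _ _).trans ((natDegree_C_mul_le _ _).trans ?_)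
    refine (natDegree_prod_le _ _).trans ?_
    simp
  omega

theorem eval_slavPoly (x : ℂ) : (slavPoly η lam x₀ w).eval x =
    ∑ i : Fin (n + 1), (-1) ^ (i : ℕ) *
      (η * slavCol η lam x₀ w i * ∏ j, (x - lam (i.succAbove j))) *
      ((slavMat η lam (Fin.cons x x₀ : Fin (n + 1) → ℂ) w).submatrix i.succAbove Fin.succ).det := by
  rw [slavPoly, Polynomial.eval_finsetSum]
  refine Finset.sum_congr rfl fun i _ => ?_
  simp only [Polynomial.eval_mul, Polynomial.eval_pow, Polynomial.eval_neg, Polynomial.eval_one,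
    Polynomial.eval_C, Polynomial.eval_prod, Polynomial.eval_sub, Polynomial.eval_X]
  congr 1
  rw [← Polynomial.coe_evalRingHom, RingHom.map_det]
  congr 1
  ext a k
  simp only [Polynomial.coe_evalRingHom, RingHom.mapMatrix_apply, Matrix.map_apply, Matrix.add_apply,
    Matrix.smul_apply, smul_eq_mul, Polynomial.eval_add, Polynomial.eval_mul, Polynomial.eval_X,
    Polynomial.eval_C, Matrix.submatrix_apply, Matrix.of_apply, id, slavMat_cons_succ]

theorem eval_slavPoly_of_ne {x : ℂ} (hx : ∀ i, x ≠ lam i) : (slavPoly η lam x₀ w).eval x =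
    (slavMat η lam (Fin.cons x x₀ : Fin (n + 1) → ℂ) w).det * ∏ i, (x - lam i) := by
  rw [eval_slavPoly, Matrix.det_succ_column_zero, Finset.sum_mul]
  refine Finset.sum_congr rfl fun i _ => ?_
  rw [slavMat_cons_zero, Fin.prod_univ_succAbove _ i]
  have := sub_ne_zero.2 (hx i)
  field_simp

/-- When the new variable meets `x₀ k`, two columns coincide. The zero of the Vandermonde factor at
this point therefore produces no pole. -/
theorem eval_slavPoly_node (hx : ∀ i k, x₀ k ≠ lam i) (k : Fin n) :
    (slavPoly η lam x₀ w).eval (x₀ k) = 0 := by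
  rw [eval_slavPoly_of_ne _ _ _ _ fun i => hx i k, Matrix.det_zero_of_column_eq
    (i := 0) (j := k.succ) (Fin.succ_ne_zero k).symm, zero_mul]
  intro i
  rw [slavMat_cons_zero, slavCol]
  simp only [slavMat, Matrix.of_apply, prod_erase_succ, Fin.cons_zero, Fin.cons_succ]
  rw [← Finset.mul_prod_erase Finset.univ (fun j => x₀ j - lam i + η) (Finset.mem_univ k),
    ← Finset.mul_prod_erase Finset.univ (fun j => x₀ j - lam i - η) (Finset.mem_univ k)]

/-- At `lam i` only the term `i` of the column expansion survives. The factors of the new variable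
come out of the rows of its minor and leave a smaller `slavMat`, with `w` rescaled by their ratio.
-/
theorem eval_slavPoly_lam (hg : ∀ i j, i ≠ j → lam i - lam j + η ≠ 0)
    (i : Fin (n + 1)) :
    (slavPoly η lam x₀ w).eval (lam i) = (-1) ^ (i : ℕ) *
      (η * slavCol η lam x₀ w i * ∏ j, (lam i - lam (i.succAbove j))) *
      ((∏ j, (lam i - lam (i.succAbove j) + η)) *
        (slavMat η (lam ∘ i.succAbove) x₀ fun j => w (i.succAbove j) *
          ((lam i - lam (i.succAbove j) - η) / (lam i - lam (i.succAbove j) + η))).det) := by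
  rw [eval_slavPoly, Finset.sum_eq_single i]
  · congr 1
    rw [← Matrix.det_mul_column]
    congr 1
    ext a k
    have := hg i (i.succAbove a) (Fin.succAbove_ne i a).symm
    simp only [slavMat, Matrix.of_apply, Matrix.submatrix_apply, prod_erase_succ, Fin.cons_zero,
      Fin.cons_succ, Function.comp_apply]
    generalize ∏ j ∈ Finset.univ.erase k, (x₀ j - lam (i.succAbove a) + η) = P1
    generalize ∏ j ∈ Finset.univ.erase k, (x₀ j - lam (i.succAbove a) - η) = P2
    field_simp
  · intro j _ hj
    obtain ⟨a, ha⟩ := Fin.exists_succAbove_eq hj.symm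
    rw [Finset.prod_eq_zero (Finset.mem_univ a) (by rw [ha, sub_self])]
    ring
  · simp

/-- Recursion for the exchange coefficients: partial fractions in the new variable `x`. -/
theorem slav_cons (hl : Function.Injective lam)
    (hg : ∀ i j, i ≠ j → lam i - lam j + η ≠ 0) (hx₀ : Function.Injective x₀)
    (hlx : ∀ i k, x₀ k ≠ lam i) (Q : Finset ℂ) (hQl : ∀ i, lam i ∉ Q) (hQx : ∀ k, x₀ k ∉ Q)
    (x : ℂ) (hxl : ∀ i, x ≠ lam i) (hxx : ∀ k, x ≠ x₀ k) (hxQ : x ∉ Q) :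
    slav η lam (Fin.cons x x₀ : Fin (n + 1) → ℂ) w * ∏ y ∈ Q, ff η x y =
      ∑ i, (∏ j, ff η (lam i) (lam (i.succAbove j))) *
        slav η (lam ∘ i.succAbove) x₀ (fun j => w (i.succAbove j) *
          ((lam i - lam (i.succAbove j) - η) / (lam i - lam (i.succAbove j) + η))) *
        (η / (x - lam i) * (∏ k, ff η (x₀ k) (lam i) - w i * ∏ k, ff η (lam i) (x₀ k))) *
        ∏ y ∈ Q, ff η (lam i) y +
      ∑ p ∈ Q, slav η lam (Fin.cons p x₀ : Fin (n + 1) → ℂ) w * (∏ y ∈ Q.erase p, ff η p y) *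
        (η / (x - p)) := by
  classical
  -- The candidate poles are the `lam i`, the zeros `x₀ k` of the Vandermonde factor and the points
  -- of `Q`, in all `2 n + 1 + |Q|`. The numerator has degree at most `2 n + |Q|`.
  let v : Fin (n + 1) ⊕ (Fin n ⊕ Q) → ℂ := Sum.elim lam (Sum.elim x₀ Subtype.val)
  have hv : Function.Injective v := by
    rintro (i | k | p) (j | l | q) h <;> simp only [v, Sum.elim_inl, Sum.elim_inr] at h
    · rw [hl h]
    · exact absurd h.symm (hlx i l)
    · exact absurd (h ▸ q.2) (hQl i)
    · exact absurd h (hlx j k)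
    · rw [hx₀ h]
    · exact absurd (h ▸ q.2) (hQx k)
    · exact absurd (h ▸ p.2) (hQl j)
    · exact absurd (h ▸ p.2) (hQx l)
    · rw [Subtype.ext h]
  set P : Polynomial ℂ := slavPoly η lam x₀ w * ∏ y ∈ Q, (Polynomial.X - Polynomial.C (y - η))
    with hPdef
  have hP : P.natDegree < Fintype.card (Fin (n + 1) ⊕ (Fin n ⊕ Q)) := by
    have h1 := natDegree_slavPoly η lam x₀ w
    have h2 : (∏ y ∈ Q, (Polynomial.X - Polynomial.C (y - η))).natDegree ≤ Q.card := by
      refine (Polynomial.natDegree_prod_le _ _).trans ?_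
      simp only [Polynomial.natDegree_X_sub_C, Finset.sum_const, smul_eq_mul, mul_one, le_refl]
    have h3 := Polynomial.natDegree_mul_le (p := slavPoly η lam x₀ w)
      (q := ∏ y ∈ Q, (Polynomial.X - Polynomial.C (y - η)))
    rw [← hPdef] at h3
    simp only [Fintype.card_sum, Fintype.card_fin, Fintype.card_coe]
    omega
  have hxv : ∀ i, x ≠ v i := by
    rintro (i | k | p)
    · exact hxl i
    · exact hxx k
    · exact fun h => hxQ (h ▸ p.2)
  have hPe : ∀ z, P.eval z = (slavPoly η lam x₀ w).eval z * ∏ y ∈ Q, (z - y + η) := by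
    intro z
    rw [hPdef, Polynomial.eval_mul, Polynomial.eval_prod]
    congr 1
    refine Finset.prod_congr rfl fun y _ => ?_
    simp only [Polynomial.eval_sub, Polynomial.eval_X, Polynomial.eval_C]
    ring
  have key := partial_fractions hv hP hxv
  have hQ1 : ∀ z : ℂ, ∏ y : Q, (z - y) = ∏ y ∈ Q, (z - y) := fun z =>
    Finset.prod_coe_sort Q fun y => z - y
  have hQ2 : ∀ p : Q, ∏ y : Q, (if y = p then 1 else (p : ℂ) - y) = ∏ y ∈ Q.erase p, ((p : ℂ) - y) :=
    fun p => by
      rw [prod_erase_eq_prod_ite' p.2, ← Finset.prod_coe_sort Q]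
      simp only [Subtype.ext_iff]
  simp only [prod_erase_eq_prod_ite, Fintype.sum_sum_type, Fintype.prod_sum_type, v, Sum.elim_inl,
    Sum.elim_inr, reduceCtorEq, if_false, Sum.inl.injEq, Sum.inr.injEq, hPe,
    eval_slavPoly_node η lam x₀ w hlx, zero_mul, zero_div, Finset.sum_const_zero, zero_add, hQ1,
    hQ2] at key
  simp only [← prod_erase_eq_prod_ite, prod_erase_fin] at key
  have hvx := vdm_ne_zero hx₀
  have hvl : vdm (-lam) ≠ 0 := vdm_ne_zero (neg_injective.comp hl)
  have hsgn : ∀ z, ∏ k, (x₀ k - z) = (-1) ^ n * ∏ k, (z - x₀ k) := by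
    intro z
    rw [← Fin.prod_const, ← Finset.prod_mul_distrib]
    exact Finset.prod_congr rfl fun k _ => by ring
  have hone : ((-1 : ℂ) ^ n) * (-1) ^ n = 1 := by rw [← mul_pow]; simp
  -- Used twice: at `x` with all of `Q`, and at a pole `p ∈ Q` with `Q.erase p`.
  have hval : ∀ z, (∀ i, z ≠ lam i) → (∀ k, z ≠ x₀ k) → ∀ Q' : Finset ℂ,
      slav η lam (Fin.cons z x₀ : Fin (n + 1) → ℂ) w * ∏ y ∈ Q', ff η z y =
      (-1) ^ n / (vdm x₀ * vdm (-lam)) * ((slavPoly η lam x₀ w).eval z * (∏ y ∈ Q', (z - y + η)) /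
        ((∏ i, (z - lam i)) * ((∏ k, (z - x₀ k)) * ∏ y ∈ Q', (z - y)))) := by
    intro z hzl hzx Q'
    rw [eval_slavPoly_of_ne _ _ _ _ hzl, slav, vdm_cons, hsgn]
    simp only [ff, Finset.prod_div_distrib]
    have h1 : ∏ i, (z - lam i) ≠ 0 := Finset.prod_ne_zero_iff.2 fun i _ => sub_ne_zero.2 (hzl i)
    have h2 : ∏ k, (z - x₀ k) ≠ 0 := Finset.prod_ne_zero_iff.2 fun i _ => sub_ne_zero.2 (hzx i)
    have h3 : ((-1 : ℂ) ^ n) ≠ 0 := pow_ne_zero _ (by norm_num)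
    rw [show (slavMat η lam (Fin.cons z x₀ : Fin (n + 1) → ℂ) w).det =
      ((-1 : ℂ) ^ n) * (-1) ^ n * (slavMat η lam (Fin.cons z x₀ : Fin (n + 1) → ℂ) w).det by
        rw [hone, one_mul]]
    field_simp
    rw [pow_two, hone, one_mul]
  rw [hval x hxl hxx, key, mul_add, Finset.mul_sum, Finset.mul_sum]
  congr 1
  · refine Finset.sum_congr rfl fun i _ => ?_
    have e1 : ∏ k, ff η (x₀ k) (lam i) - w i * ∏ k, ff η (lam i) (x₀ k) =
        slavCol η lam x₀ w i / ((-1) ^ n * ∏ k, (lam i - x₀ k)) := by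
      have : ∀ k, ff η (lam i) (x₀ k) = (x₀ k - lam i - η) / (x₀ k - lam i) := fun k => by
        rw [ff, ← neg_div_neg_eq]; congr 1 <;> ring
      simp only [this]
      rw [slavCol, ← hsgn]
      simp only [ff, Finset.prod_div_distrib]
      ring
    have e2 := vdm_succAbove (-lam) i
    simp only [Pi.neg_apply] at e2
    have e3 : ∏ k, (-lam (i.succAbove k) - -lam i) = ∏ k, (lam i - lam (i.succAbove k)) :=
      Finset.prod_congr rfl fun k _ => by ring
    rw [e3] at e2
    have hA : ∏ k, (lam i - lam (i.succAbove k)) ≠ 0 := Finset.prod_ne_zero_iff.2 fun k _ =>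
      sub_ne_zero.2 fun h => Fin.succAbove_ne i k (hl h).symm
    have hX : ∏ k, (lam i - x₀ k) ≠ 0 := Finset.prod_ne_zero_iff.2 fun k _ =>
      sub_ne_zero.2 fun h => hlx i k h.symm
    have hV : vdm ((-lam) ∘ i.succAbove) ≠ 0 := vdm_ne_zero
      ((neg_injective.comp hl).comp Fin.succAbove_right_injective)
    have hs : ((-1 : ℂ) ^ (i : ℕ)) * (-1) ^ (i : ℕ) = 1 := by rw [← mul_pow]; simp
    have e4 : vdm (-lam) = (-1) ^ (i : ℕ) *
        ((∏ k, (lam i - lam (i.succAbove k))) * vdm ((-lam) ∘ i.succAbove)) := by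
      rw [← e2, ← mul_assoc, hs, one_mul]
    rw [e1, eval_slavPoly_lam η lam x₀ w hg, e4, slav,
      show -(lam ∘ i.succAbove) = (-lam) ∘ i.succAbove from rfl]
    simp only [ff, Finset.prod_div_distrib]
    have hs' : ((-1 : ℂ) ^ (i : ℕ)) ≠ 0 := pow_ne_zero _ (by norm_num)
    have hn' : ((-1 : ℂ) ^ n) ≠ 0 := pow_ne_zero _ (by norm_num)
    have hxi : x - lam i ≠ 0 := sub_ne_zero.2 (hxl i)
    generalize (slavMat η (lam ∘ i.succAbove) x₀ _).det = δ
    field_simp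
    rw [pow_two, hone]
    ring
  · rw [← Finset.sum_coe_sort Q]
    refine Finset.sum_congr rfl fun p _ => ?_
    rw [hval p (fun i h => hQl i (h ▸ p.2)) fun k h => hQx k (h ▸ p.2),
      ← Finset.mul_prod_erase Q (fun y => (p : ℂ) - y + η) p.2, sub_self, zero_add]
    ring

end Interpolation

end OpenXXX
end

/-! ### Exchange coefficients over finite sets and products of transfer matrices. -/

open scoped Matrix
noncomputable section
namespace OpenXXX

theorem exists_perm_of_range_eq {n : ℕ} {v v' : Fin n → ℂ} (hv : Function.Injective v)
    (hv' : Function.Injective v') (h : Set.range v' = Set.range v) :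
    ∃ σ : Equiv.Perm (Fin n), v' = v ∘ σ := by
  refine ⟨(Equiv.ofInjective v' hv').trans ((Equiv.setCongr h).trans
    (Equiv.ofInjective v hv).symm), ?_⟩
  funext i
  have := Equiv.apply_ofInjective_symm hv ((Equiv.setCongr h) (Equiv.ofInjective v' hv' i))
  simp only [Function.comp_apply, Equiv.trans_apply]
  rw [this]
  rfl

theorem slav_congr_range (η : ℂ) {n : ℕ} {lam lam' x x' : Fin n → ℂ}
    (hl : Function.Injective lam) (hl' : Function.Injective lam') (hx : Function.Injective x)
    (hx' : Function.Injective x') (h1 : Set.range lam' = Set.range lam)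
    (h2 : Set.range x' = Set.range x) (w : ℂ → ℂ) :
    slav η lam' x' (w ∘ lam') = slav η lam x (w ∘ lam) := by
  obtain ⟨σ, rfl⟩ := exists_perm_of_range_eq hl hl' h1
  obtain ⟨τ, rfl⟩ := exists_perm_of_range_eq hx hx' h2
  rw [slav_perm_right, ← Function.comp_assoc, slav_perm_left]

/-- The exchange coefficient for finite sets of variables. -/
def chat (η : ℂ) (w : ℂ → ℂ) (α γ : Finset ℂ) : ℂ :=
  if h : α.card = γ.card then
    slav η (fun i => (α.equivFin.symm i : ℂ)) (fun i => (γ.equivFin.symm (Fin.cast h i) : ℂ))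
      (w ∘ fun i => (α.equivFin.symm i : ℂ))
  else 0

theorem chat_of_card_ne (η : ℂ) (w : ℂ → ℂ) {α γ : Finset ℂ} (h : α.card ≠ γ.card) :
    chat η w α γ = 0 := dif_neg h

/-- Permutation invariance of `slav` makes the enumerations chosen in `chat` irrelevant. -/
theorem chat_eq (η : ℂ) (w : ℂ → ℂ) {n : ℕ} {lam x : Fin n → ℂ} (hl : Function.Injective lam)
    (hx : Function.Injective x) {α γ : Finset ℂ} (hα : ∀ z, z ∈ α ↔ ∃ i, lam i = z)
    (hγ : ∀ z, z ∈ γ ↔ ∃ i, x i = z) : chat η w α γ = slav η lam x (w ∘ lam) := by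
  have h1 : α = Finset.univ.map ⟨lam, hl⟩ := by ext z; simp [hα]
  have h2 : γ = Finset.univ.map ⟨x, hx⟩ := by ext z; simp [hγ]
  have c1 : α.card = n := by rw [h1]; simp
  have c2 : γ.card = n := by rw [h2]; simp
  subst c1
  rw [chat, dif_pos c2.symm]
  refine slav_congr_range η hl ?_ hx ?_ ?_ ?_ w
  · exact Subtype.val_injective.comp α.equivFin.symm.injective
  · exact Subtype.val_injective.comp (γ.equivFin.symm.injective.comp (Fin.cast_injective _))
  · ext z
    rw [Set.mem_range, Set.mem_range, ← hα]
    exact ⟨fun ⟨i, hi⟩ => hi ▸ (α.equivFin.symm i).2,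
      fun h => ⟨α.equivFin ⟨z, h⟩, by simp⟩⟩
  · ext z
    rw [Set.mem_range, Set.mem_range, ← hγ]
    exact ⟨fun ⟨i, hi⟩ => hi ▸ (γ.equivFin.symm _).2,
      fun h => ⟨Fin.cast c2 (γ.equivFin ⟨z, h⟩), by simp⟩⟩

theorem chat_congr (η : ℂ) {w w' : ℂ → ℂ} {α : Finset ℂ} (h : ∀ z ∈ α, w z = w' z)
    (γ : Finset ℂ) : chat η w α γ = chat η w' α γ := by
  unfold chat
  split_ifs
  · congr 1
    funext i
    exact h _ (α.equivFin.symm i).2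
  · rfl

theorem exists_enum (α : Finset ℂ) {n : ℕ} (h : α.card = n) : ∃ lam : Fin n → ℂ,
    Function.Injective lam ∧ ∀ z, z ∈ α ↔ ∃ i, lam i = z := by
  subst h
  exact ⟨fun i => α.equivFin.symm i, Subtype.val_injective.comp α.equivFin.symm.injective,
    fun z => ⟨fun h => ⟨α.equivFin ⟨z, h⟩, by simp⟩, fun ⟨i, hi⟩ => hi ▸ (α.equivFin.symm i).2⟩⟩

theorem prod_enum {α : Finset ℂ} {n : ℕ} {lam : Fin n → ℂ} (hl : Function.Injective lam)
    (hα : ∀ z, z ∈ α ↔ ∃ i, lam i = z) (g : ℂ → ℂ) : ∏ z ∈ α, g z = ∏ i, g (lam i) := by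
  have h1 : α = Finset.univ.map ⟨lam, hl⟩ := by ext z; simp [hα]
  rw [h1, Finset.prod_map]; rfl

theorem sum_enum {α : Finset ℂ} {n : ℕ} {lam : Fin n → ℂ} (hl : Function.Injective lam)
    (hα : ∀ z, z ∈ α ↔ ∃ i, lam i = z) (g : ℂ → ℂ) : ∑ z ∈ α, g z = ∑ i, g (lam i) := by
  have h1 : α = Finset.univ.map ⟨lam, hl⟩ := by ext z; simp [hα]
  rw [h1, Finset.sum_map]; rfl

/-- The recursion `slav_cons` freed from enumerations. If `α` does not have exactly one element more
than `γ`, all terms vanish by the default value of `chat`. -/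
theorem chat_insert (η : ℂ) (w : ℂ → ℂ) {α γ Q : Finset ℂ} {x : ℂ}
    (hg : ∀ p ∈ α, ∀ q ∈ α, p ≠ q → p - q + η ≠ 0) (hαγ : Disjoint α γ) (hαQ : Disjoint α Q)
    (hγQ : Disjoint γ Q) (hxα : x ∉ α) (hxγ : x ∉ γ) (hxQ : x ∉ Q) :
    chat η w α (insert x γ) * ∏ y ∈ Q, ff η x y =
      ∑ j ∈ α, (∏ y ∈ α.erase j, ff η j y) *
        chat η (fun z => w z * ((j - z - η) / (j - z + η))) (α.erase j) γ *
        (η / (x - j) * (∏ k ∈ γ, ff η k j - w j * ∏ k ∈ γ, ff η j k)) * ∏ y ∈ Q, ff η j y +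
      ∑ p ∈ Q, chat η w α (insert p γ) * (∏ y ∈ Q.erase p, ff η p y) * (η / (x - p)) := by
  by_cases hc : α.card = γ.card + 1
  · obtain ⟨lam, hl, hα⟩ := exists_enum α hc
    obtain ⟨x₀, hx₀, hγ⟩ := exists_enum γ rfl
    have hla : ∀ i, lam i ∈ α := fun i => (hα _).2 ⟨i, rfl⟩
    have hxa : ∀ i, x₀ i ∈ γ := fun i => (hγ _).2 ⟨i, rfl⟩
    have hcons : ∀ z, z ∉ γ → chat η w α (insert z γ) =
        slav η lam (Fin.cons z x₀ : Fin (γ.card + 1) → ℂ) (w ∘ lam) := by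
      intro z hz
      refine chat_eq η w hl ?_ hα ?_
      · exact Fin.cons_injective_iff.2 ⟨fun ⟨k, hk⟩ => hz (hk ▸ hxa k), hx₀⟩
      · intro y
        rw [Finset.mem_insert, hγ]
        constructor
        · rintro (rfl | ⟨i, rfl⟩)
          · exact ⟨0, rfl⟩
          · exact ⟨i.succ, rfl⟩
        · rintro ⟨i, rfl⟩
          refine Fin.cases (Or.inl rfl) (fun i => Or.inr ⟨i, rfl⟩) i
    have herase : ∀ i : Fin (γ.card + 1), ∀ z, z ∈ α.erase (lam i) ↔ ∃ k, (lam ∘ i.succAbove) k = z := by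
      intro i z
      rw [Finset.mem_erase, hα]
      constructor
      · rintro ⟨h1, k, rfl⟩
        obtain ⟨a, rfl⟩ := Fin.exists_succAbove_eq fun h : k = i => h1 (h ▸ rfl)
        exact ⟨a, rfl⟩
      · rintro ⟨k, rfl⟩
        exact ⟨fun h => Fin.succAbove_ne i k (hl h), _, rfl⟩
    have hle : ∀ i : Fin (γ.card + 1), Function.Injective (lam ∘ i.succAbove) :=
      fun i => hl.comp Fin.succAbove_right_injective
    rw [hcons x hxγ, slav_cons η lam x₀ (w ∘ lam) hl
      (fun i j hij => hg _ (hla i) _ (hla j) fun h => hij (hl h)) hx₀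
      (fun i k h => Finset.disjoint_left.1 hαγ (hla i) (h ▸ hxa k)) Q
      (fun i h => Finset.disjoint_left.1 hαQ (hla i) h)
      (fun k h => Finset.disjoint_left.1 hγQ (hxa k) h) x (fun i h => hxα (h ▸ hla i))
      (fun k h => hxγ (h ▸ hxa k)) hxQ, sum_enum hl hα]
    congr 1
    · refine Finset.sum_congr rfl fun i _ => ?_
      rw [prod_enum (hle i) (herase i), chat_eq η _ (hle i) hx₀ (herase i) hγ,
        prod_enum hx₀ hγ, prod_enum hx₀ hγ]
      rfl
    · refine Finset.sum_congr rfl fun p hp => ?_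
      rw [hcons p fun h => Finset.disjoint_left.1 hγQ h hp]
  · rw [chat_of_card_ne η w (by rwa [Finset.card_insert_of_notMem hxγ]), zero_mul,
      Finset.sum_eq_zero, Finset.sum_eq_zero, add_zero]
    · intro p hp
      rw [chat_of_card_ne η w (by
        rwa [Finset.card_insert_of_notMem fun h => Finset.disjoint_left.1 hγQ h hp])]
      ring
    · intro j hj
      rw [chat_of_card_ne η _ (by
        rw [Finset.card_erase_of_mem hj]
        have := Finset.card_pos.2 ⟨j, hj⟩
        omega)]
      ring

theorem sum_powerset_sdiff {V : Type} [AddCommMonoid V] (Z : Finset ℂ) (g : Finset ℂ → ℂ → V) :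
    ∑ α ∈ Z.powerset, ∑ p ∈ Z \ α, g α p = ∑ α ∈ Z.powerset, ∑ p ∈ α, g (α.erase p) p := by
  rw [Finset.sum_sigma', Finset.sum_sigma']
  refine Finset.sum_bij' (fun a _ => ⟨insert a.2 a.1, a.2⟩) (fun a _ => ⟨a.1.erase a.2, a.2⟩)
    ?_ ?_ ?_ ?_ ?_
  · rintro ⟨α, p⟩ h
    simp only [Finset.mem_sigma, Finset.mem_powerset, Finset.mem_sdiff] at h ⊢
    exact ⟨Finset.insert_subset h.2.1 h.1, Finset.mem_insert_self _ _⟩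
  · rintro ⟨α, p⟩ h
    simp only [Finset.mem_sigma, Finset.mem_powerset, Finset.mem_sdiff] at h ⊢
    exact ⟨(Finset.erase_subset _ _).trans h.1, h.1 h.2, Finset.notMem_erase _ _⟩
  · rintro ⟨α, p⟩ h
    simp only [Finset.mem_sigma, Finset.mem_powerset, Finset.mem_sdiff] at h
    simp only [Finset.erase_insert h.2.2]
  · rintro ⟨α, p⟩ h
    simp only [Finset.mem_sigma] at h
    simp only [Finset.insert_erase h.2]
  · rintro ⟨α, p⟩ h
    simp only [Finset.mem_sigma, Finset.mem_powerset, Finset.mem_sdiff] at h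
    simp only [Finset.erase_insert h.2.2]

theorem sum_powerset_mem {V : Type} [AddCommMonoid V] (Z : Finset ℂ) (g : Finset ℂ → ℂ → V) :
    ∑ α ∈ Z.powerset, ∑ p ∈ α, g α p = ∑ α ∈ Z.powerset, ∑ p ∈ Z \ α, g (insert p α) p := by
  rw [sum_powerset_sdiff Z fun α p => g (insert p α) p]
  refine Finset.sum_congr rfl fun α _ => Finset.sum_congr rfl fun p hp => ?_
  rw [Finset.insert_erase hp]

/-- The ratio entering the second term of the entries of the determinant. -/
def exW (η : ℂ) (ρ : ℂ → ℂ) (Z α : Finset ℂ) (z : ℂ) : ℂ :=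
  ρ z * ((∏ y ∈ Z \ α, ff η z y) / ∏ y ∈ Z \ α, ff η y z)

/-- The coefficient of the exchange of `α` for `γ` in the action of `∏_{y ∈ K} t(y)` on `Φ Z`,
without the factors `a`. -/
def exCoeff (η : ℂ) (ρ : ℂ → ℂ) (Z K γ α : Finset ℂ) : ℂ :=
  (∏ z ∈ α, ∏ y ∈ Z \ α, ff η y z) * chat η (exW η ρ Z α) α γ *
    ∏ y ∈ K \ γ, ∏ z ∈ Z \ α ∪ γ, ff η z y

/-- The new point `x` enters in two ways: it replaces a `p` of `Z` still present, which adds `p` to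
`α`, or a `p` of `K` that came in earlier, which takes `p` out of the set of used inhomogeneities.
The two sums match the residues at `α` and at `K \ γ` in `chat_insert`. -/
theorem exCoeff_rec (η : ℂ) (ρ a : ℂ → ℂ) {Z K γ α : Finset ℂ} {x : ℂ}
    (hg : ∀ p ∈ Z, ∀ q ∈ Z, p ≠ q → p - q + η ≠ 0) (hZK : Disjoint Z K) (hxZ : x ∉ Z)
    (hxK : x ∉ K) (hα : α ⊆ Z) (hγ : γ ⊆ K) :
    (∏ z ∈ α, a z) * (∏ y ∈ insert x K \ insert x γ, a y) *
        exCoeff η ρ Z (insert x K) (insert x γ) α =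
      ∑ p ∈ α, (∏ z ∈ α.erase p, a z) * (∏ y ∈ K \ γ, a y) * exCoeff η ρ Z K γ (α.erase p) *
        (η / (x - p) * (a p * ∏ y ∈ Z \ α ∪ γ, ff η y p -
          ρ p * a p * ∏ y ∈ Z \ α ∪ γ, ff η p y)) +
      ∑ p ∈ K \ γ, (∏ z ∈ α, a z) * (∏ y ∈ K \ insert p γ, a y) *
        exCoeff η ρ Z K (insert p γ) α * (η / (x - p) * (a p * ∏ y ∈ Z \ α ∪ γ, ff η y p)) := by
  have hxγ : x ∉ γ := fun h => hxK (hγ h)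
  have hdZ : Disjoint (Z \ α) γ := (hZK.mono_left Finset.sdiff_subset).mono_right hγ
  have hKx : insert x K \ insert x γ = K \ γ := by
    ext z; simp only [Finset.mem_sdiff, Finset.mem_insert]
    constructor
    · tauto
    · rintro ⟨h1, h2⟩
      exact ⟨Or.inr h1, by rintro (rfl | h); exacts [hxK h1, h2 h]⟩
  have hxJ : x ∉ Z \ α ∪ γ := by simp [hxZ, hxγ]
  set Q := K \ γ with hQ
  have main := chat_insert η (exW η ρ Z α) (α := α) (γ := γ) (Q := Q) (x := x)
    (fun p hp q hq => hg p (hα hp) q (hα hq)) ((hZK.mono_left hα).mono_right hγ)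
    ((hZK.mono_left hα).mono_right Finset.sdiff_subset) Finset.disjoint_sdiff
    (fun h => hxZ (hα h)) hxγ (fun h => hxK (Finset.sdiff_subset h))
  -- The presence of `x` among the new points supplies the factor `∏ y ∈ Q, ff η x y` that
  -- accompanies `chat` in `chat_insert`.
  have e0 : (∏ z ∈ α, a z) * (∏ y ∈ Q, a y) * exCoeff η ρ Z (insert x K) (insert x γ) α =
      (∏ z ∈ α, a z) * (∏ y ∈ Q, a y) * (∏ z ∈ α, ∏ y ∈ Z \ α, ff η y z) *
      (∏ y ∈ Q, ∏ z ∈ Z \ α ∪ γ, ff η z y) *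
        (chat η (exW η ρ Z α) α (insert x γ) * ∏ y ∈ Q, ff η x y) := by
    rw [exCoeff, hKx, Finset.union_insert]
    simp only [Finset.prod_insert hxJ, Finset.prod_mul_distrib]
    ring
  rw [hKx, e0, main, mul_add, Finset.mul_sum, Finset.mul_sum]
  congr 1
  · refine Finset.sum_congr rfl fun p hp => ?_
    have hpJ : p ∉ Z \ α ∪ γ := by
      simp only [Finset.mem_union, Finset.mem_sdiff, not_or, not_and, not_not]
      exact ⟨fun _ => hp, fun h => Finset.disjoint_left.1 hZK (hα hp) (hγ h)⟩
    have hpZ : p ∉ Z \ α := fun h => hpJ (Finset.mem_union_left _ h)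
    have h1 : Z \ α.erase p = insert p (Z \ α) := Finset.sdiff_erase (hα hp)
    -- Returning `p` to `Z \ α` changes `exW` by exactly the ratio by which `slav_cons` rescales
    -- `w`.
    have hw : ∀ z ∈ α.erase p, exW η ρ Z (α.erase p) z =
        exW η ρ Z α z * ((p - z - η) / (p - z + η)) := by
      intro z hz
      have hzp : z ≠ p := Finset.ne_of_mem_erase hz
      have h2 : z - p ≠ 0 := sub_ne_zero.2 hzp
      have h3 : p - z ≠ 0 := sub_ne_zero.2 hzp.symm
      have h4 : p - z + η ≠ 0 := hg p (hα hp) z (hα (Finset.mem_of_mem_erase hz)) hzp.symm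
      have h5 : ff η z p / ff η p z = (p - z - η) / (p - z + η) := by
        unfold ff; field_simp; ring
      rw [exW, h1, Finset.prod_insert hpZ, Finset.prod_insert hpZ, mul_div_mul_comm, h5, exW]
      ring
    have hne : ∏ y ∈ Z \ α, ff η y p ≠ 0 := Finset.prod_ne_zero_iff.2 fun y hy => by
      have hyp : y ≠ p := fun h => hpZ (h ▸ hy)
      exact ff_ne_zero (hg y (Finset.sdiff_subset hy) p (hα hp) hyp) hyp
    rw [exCoeff, chat_congr η hw, h1, Finset.insert_union,
      Finset.prod_union hdZ, Finset.prod_union hdZ, ← Finset.mul_prod_erase α a hp,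
      ← Finset.mul_prod_erase α _ hp]
    simp only [Finset.prod_insert hpZ, Finset.prod_insert hpJ, Finset.prod_mul_distrib]
    have hW : exW η ρ Z α p * ∏ y ∈ Z \ α, ff η y p = ρ p * ∏ y ∈ Z \ α, ff η p y := by
      rw [exW, mul_assoc, div_mul_cancel₀ _ hne]
    linear_combination (-(∏ z ∈ α.erase p, a z) * a p * (∏ y ∈ Q, a y) *
      (∏ z ∈ α.erase p, ∏ y ∈ Z \ α, ff η y z) * (∏ y ∈ Q, ∏ z ∈ Z \ α ∪ γ, ff η z y) *
      (∏ y ∈ α.erase p, ff η p y) * chat η (fun z => exW η ρ Z α z * ((p - z - η) / (p - z + η)))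
        (α.erase p) γ * (η / (x - p)) * (∏ k ∈ γ, ff η p k) * ∏ y ∈ Q, ff η p y) * hW
  · refine Finset.sum_congr rfl fun p hp => ?_
    have hpJ : p ∉ Z \ α ∪ γ := by
      simp only [Finset.mem_union, Finset.mem_sdiff, not_or, not_and, not_not]
      exact ⟨fun h => absurd (Finset.sdiff_subset hp) (Finset.disjoint_left.1 hZK h),
        (Finset.mem_sdiff.1 hp).2⟩
    have h1 : K \ insert p γ = Q.erase p := by
      rw [hQ, Finset.sdiff_insert]
    rw [exCoeff, h1, Finset.union_insert, ← Finset.mul_prod_erase Q a hp,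
      ← Finset.mul_prod_erase Q (fun y => ∏ z ∈ Z \ α ∪ γ, ff η z y) hp]
    simp only [Finset.prod_insert hpJ, Finset.prod_mul_distrib]
    ring

namespace HighestWeight

variable {η : ℂ} {V : Type} [AddCommGroup V] [Module ℂ V] (Y : HighestWeight η V)

/-- The result of the action of `∏_{y ∈ K} t(y)` on `Φ Z`, where `d = ρ a` on `Z`. -/
def exState (ρ : ℂ → ℂ) (K Z : Finset ℂ) : V :=
  ∑ γ ∈ K.powerset, ∑ α ∈ Z.powerset,
    ((∏ z ∈ α, Y.a z) * (∏ y ∈ K \ γ, Y.a y) * exCoeff η ρ Z K γ α) • Y.Φ (Z \ α ∪ γ)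

theorem chat_empty_left (η : ℂ) (w : ℂ → ℂ) : chat η w ∅ ∅ = 1 := by
  rw [chat_eq η w (n := 0) (lam := Fin.elim0) (x := Fin.elim0) (fun i => i.elim0)
    (fun i => i.elim0) (by simp) (by simp)]
  simp [slav, vdm]

theorem exState_empty (ρ : ℂ → ℂ) (Z : Finset ℂ) : Y.exState ρ ∅ Z = Y.Φ Z := by
  rw [exState, Finset.powerset_empty, Finset.sum_singleton, Finset.sum_eq_single ∅]
  · simp [exCoeff, chat_empty_left]
  · intro α _ hα
    rw [exCoeff, chat_of_card_ne η _ (by simpa using hα)]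
    simp
  · simp

/-- Induction on the number of transfer matrices. The direct term of `transfer_Φ` keeps `γ`, while
its exchange terms lead to `insert x γ`, where `exCoeff_rec` adds up the coefficients. -/
theorem transfer_prod_Φ (hη : η ≠ 0) (ρ : ℂ → ℂ) {Z : Finset ℂ}
    (hg : ∀ p ∈ Z, ∀ q ∈ Z, p ≠ q → p - q + η ≠ 0) (hZ : ∀ z ∈ Z, Y.d z = ρ z * Y.a z)
    (l : List ℂ) (hl : l.Nodup) (hlZ : ∀ x ∈ l, x ∉ Z) (hd : ∀ x ∈ l, Y.d x = 0) :
    (l.map (transfer Y.T)).prod (Y.Φ Z) = Y.exState ρ l.toFinset Z := by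
  induction l with
  | nil => simp [exState_empty]
  | cons x l ih =>
    have hl' := List.nodup_cons.1 hl
    have hxZ : x ∉ Z := hlZ x (by simp)
    rw [List.map_cons, List.prod_cons, Module.End.mul_apply,
      ih hl'.2 (fun y hy => hlZ y (by simp [hy])) (fun y hy => hd y (by simp [hy])),
      List.toFinset_cons]
    have hxK : x ∉ l.toFinset := by simpa using hl'.1
    have hZK : Disjoint Z l.toFinset := Finset.disjoint_left.2 fun z hz hzl =>
      hlZ z (by simp [List.mem_toFinset.1 hzl]) hz
    -- For points of `K` already exchanged in, only the `A` part of an exchange term remains.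
    have hdK : ∀ y ∈ l.toFinset, Y.d y = 0 := fun y hy => hd y (by simp [List.mem_toFinset.1 hy])
    generalize l.toFinset = K at *
    have step : ∀ γ ∈ K.powerset, ∀ α ∈ Z.powerset,
        transfer Y.T x (((∏ z ∈ α, Y.a z) * (∏ y ∈ K \ γ, Y.a y) * exCoeff η ρ Z K γ α) •
          Y.Φ (Z \ α ∪ γ)) =
        ((∏ z ∈ α, Y.a z) * (∏ y ∈ insert x K \ γ, Y.a y) * exCoeff η ρ Z (insert x K) γ α) •
          Y.Φ (Z \ α ∪ γ) +
        (∑ p ∈ Z \ α, ((∏ z ∈ α, Y.a z) * (∏ y ∈ K \ γ, Y.a y) * exCoeff η ρ Z K γ α *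
          (η / (x - p) * (Y.a p * ∏ y ∈ (Z \ α ∪ γ).erase p, ff η y p -
            ρ p * Y.a p * ∏ y ∈ (Z \ α ∪ γ).erase p, ff η p y))) •
            Y.Φ (insert x ((Z \ α ∪ γ).erase p)) +
        ∑ p ∈ γ, ((∏ z ∈ α, Y.a z) * (∏ y ∈ K \ γ, Y.a y) * exCoeff η ρ Z K γ α *
          (η / (x - p) * (Y.a p * ∏ y ∈ (Z \ α ∪ γ).erase p, ff η y p))) •
            Y.Φ (insert x ((Z \ α ∪ γ).erase p))) := by
      intro γ hγ α hα
      have hγK := Finset.mem_powerset.1 hγ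
      have hαZ := Finset.mem_powerset.1 hα
      have hdis : Disjoint (Z \ α) γ := (hZK.mono_left Finset.sdiff_subset).mono_right hγK
      have hxγ : x ∉ γ := fun h => hxK (hγK h)
      have hxJ : x ∉ Z \ α ∪ γ := by simp [hxZ, hxγ]
      rw [map_smul, Y.transfer_Φ hη hxJ (hd x (by simp)), Finset.sum_union hdis, smul_add, smul_add,
        smul_smul]
      congr 1
      · congr 1
        rw [Finset.insert_sdiff_of_notMem _ hxγ,
          Finset.prod_insert (fun h => hxK (Finset.sdiff_subset h)), exCoeff, exCoeff,
          Finset.insert_sdiff_of_notMem _ hxγ,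
          Finset.prod_insert (fun h => hxK (Finset.sdiff_subset h))]
        ring
      · rw [Finset.smul_sum, Finset.smul_sum]
        congr 1
        · refine Finset.sum_congr rfl fun p hp => ?_
          rw [smul_smul, hZ p (Finset.sdiff_subset hp)]
        · refine Finset.sum_congr rfl fun p hp => ?_
          rw [smul_smul, hdK p (hγK hp), zero_mul, sub_zero]
    rw [exState, map_sum]
    simp only [map_sum]
    rw [Finset.sum_congr rfl fun γ hγ => Finset.sum_congr rfl (step γ hγ)]
    simp only [Finset.sum_add_distrib]
    -- Subsets of `insert x K` without `x` match the direct terms, those with `x` the exchange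
    -- terms.
    rw [exState, Finset.sum_powerset_insert hxK]
    congr 1
    have s1 : ∀ γ ∈ K.powerset, ∑ α ∈ Z.powerset, ∑ p ∈ Z \ α, ((∏ z ∈ α, Y.a z) *
          (∏ y ∈ K \ γ, Y.a y) * exCoeff η ρ Z K γ α *
          (η / (x - p) * (Y.a p * ∏ y ∈ (Z \ α ∪ γ).erase p, ff η y p -
            ρ p * Y.a p * ∏ y ∈ (Z \ α ∪ γ).erase p, ff η p y))) •
            Y.Φ (insert x ((Z \ α ∪ γ).erase p)) =
        ∑ α ∈ Z.powerset, ∑ p ∈ α, ((∏ z ∈ α.erase p, Y.a z) *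
          (∏ y ∈ K \ γ, Y.a y) * exCoeff η ρ Z K γ (α.erase p) *
          (η / (x - p) * (Y.a p * ∏ y ∈ (Z \ α ∪ γ), ff η y p -
            ρ p * Y.a p * ∏ y ∈ (Z \ α ∪ γ), ff η p y))) •
            Y.Φ (Z \ α ∪ insert x γ) := by
      intro γ hγ
      rw [sum_powerset_sdiff]
      refine Finset.sum_congr rfl fun α hα => Finset.sum_congr rfl fun p hp => ?_
      have hαZ := Finset.mem_powerset.1 hα
      have : (Z \ α.erase p ∪ γ).erase p = Z \ α ∪ γ := by
        rw [Finset.sdiff_erase (hαZ hp), Finset.insert_union, Finset.erase_insert]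
        simp only [Finset.mem_union, Finset.mem_sdiff, not_or, not_and, not_not]
        exact ⟨fun _ => hp, fun h =>
          Finset.disjoint_left.1 hZK (hαZ hp) (Finset.mem_powerset.1 hγ h)⟩
      rw [this, Finset.union_insert]
    have s2 : ∑ γ ∈ K.powerset, ∑ α ∈ Z.powerset, ∑ p ∈ γ, ((∏ z ∈ α, Y.a z) *
          (∏ y ∈ K \ γ, Y.a y) * exCoeff η ρ Z K γ α *
          (η / (x - p) * (Y.a p * ∏ y ∈ (Z \ α ∪ γ).erase p, ff η y p))) •
            Y.Φ (insert x ((Z \ α ∪ γ).erase p)) =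
        ∑ γ ∈ K.powerset, ∑ α ∈ Z.powerset, ∑ p ∈ K \ γ, ((∏ z ∈ α, Y.a z) *
          (∏ y ∈ K \ insert p γ, Y.a y) * exCoeff η ρ Z K (insert p γ) α *
          (η / (x - p) * (Y.a p * ∏ y ∈ (Z \ α ∪ γ), ff η y p))) •
            Y.Φ (Z \ α ∪ insert x γ) := by
      rw [Finset.sum_comm, Finset.sum_comm (s := K.powerset)]
      refine Finset.sum_congr rfl fun α hα => ?_
      rw [sum_powerset_mem]
      refine Finset.sum_congr rfl fun γ hγ => Finset.sum_congr rfl fun p hp => ?_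
      have : (Z \ α ∪ insert p γ).erase p = Z \ α ∪ γ := by
        rw [Finset.union_insert, Finset.erase_insert]
        simp only [Finset.mem_union, Finset.mem_sdiff, not_or, not_and, not_not]
        exact ⟨fun h => absurd (Finset.sdiff_subset hp) (Finset.disjoint_left.1 hZK h),
          (Finset.mem_sdiff.1 hp).2⟩
      rw [this, Finset.union_insert]
    rw [Finset.sum_congr rfl s1, s2, ← Finset.sum_add_distrib]
    refine Finset.sum_congr rfl fun γ hγ => ?_
    rw [← Finset.sum_add_distrib]
    refine Finset.sum_congr rfl fun α hα => ?_
    rw [exCoeff_rec η ρ Y.a hg hZK hxZ hxK (Finset.mem_powerset.1 hα) (Finset.mem_powerset.1 hγ),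
      add_smul, Finset.sum_smul, Finset.sum_smul]

end HighestWeight
end OpenXXX
end

/-! ### Local operators on eigenvectors of the transfer matrix. -/

open scoped Matrix
noncomputable section
namespace OpenXXX

/-- A highest weight representation of the Yangian with distinguished sites: the monodromy matrix
factorizes into a matrix `W`, the Lax matrix of the site `s`, and those of the sites `l`. -/
structure SpinChain (η : ℂ) (V : Type) [AddCommGroup V] [Module ℂ V] extends
    HighestWeight η V where
  W : Entries (Module.End ℂ V)
  s : Site (Module.End ℂ V)
  l : List (Site (Module.End ℂ V))
  hT : T = W.mul (laxProd η (s :: l))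
  hW : Yangian η W
  hl : SitesIndep (s :: l)
  hc : ∀ p ∈ s :: l, UnitsCommute p.2 W
  hd : ∀ p ∈ s :: l, d p.1 = 0

/-- The ratio `d/a` that the Bethe equations prescribe on `Λ`. -/
def betheRatio (η : ℂ) (Λ : Finset ℂ) (z : ℂ) : ℂ :=
  if z ∈ Λ then (∏ y ∈ Λ.erase z, ff η y z) / ∏ y ∈ Λ.erase z, ff η z y else 0

/-- The genericity assumptions on the spectral parameters `Λ`, the point `x` and the points `K`. -/
structure GenericPoints (η : ℂ) (Λ : Finset ℂ) (x : ℂ) (K : Finset ℂ) : Prop where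
  shift : ∀ p ∈ insert x Λ, ∀ q ∈ insert x Λ, p - q + η ≠ 0
  x_notMem : x ∉ Λ
  x_notMem_K : x ∉ K
  disj : Disjoint Λ K
  shift_K : ∀ y ∈ K, ∀ z ∈ Λ, y - z + η ≠ 0

/-- The action of `X` on `Φ Λ`, expanded over the vectors `exState`. -/
def HighestWeight.BulkFormula {η : ℂ} {V : Type} [AddCommGroup V] [Module ℂ V]
    (Y : HighestWeight η V) (Λ : Finset ℂ) (x : ℂ) (K : Finset ℂ) (X : Module.End ℂ V)
    {ι : Type} (S : Finset ι) (D : ι → Finset ℂ) (k : ι → ℂ) : Prop :=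
  ((∏ y ∈ insert x K, Y.a y) * ∏ y ∈ insert x K, ∏ z ∈ Λ, ff η z y) • X (Y.Φ Λ) =
    ∑ i ∈ S, ((∏ z ∈ D i, Y.a z) * k i) •
      Y.exState (betheRatio η Λ) K (insert x Λ \ D i)

namespace SpinChain

variable {η : ℂ} {V : Type} [AddCommGroup V] [Module ℂ V] (C : SpinChain η V)

/-- The inhomogeneities of the sites `l`. -/
def K : Finset ℂ := (C.l.map Prod.fst).toFinset

theorem d_K {y : ℂ} (hy : y ∈ C.K) : C.d y = 0 := by
  obtain ⟨p, hp, rfl⟩ := List.mem_map.1 (List.mem_toFinset.1 hy)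
  exact C.hd p (by simp [hp])

theorem d_s : C.d C.s.1 = 0 := C.hd C.s (by simp)

/-- The Bethe equations. -/
def Bethe (Λ : Finset ℂ) : Prop := ∀ z ∈ Λ, C.d z = betheRatio η Λ z * C.a z

variable {C} {Λ : Finset ℂ}

/-- The coefficient of every unwanted vector contains `a p * ∏ ff y p - d p * ∏ ff p y`, which the
Bethe equation at `p` annihilates. -/
theorem transfer_bethe (hη : η ≠ 0) (hg : GenericPoints η Λ C.s.1 C.K) (hB : C.Bethe Λ) {u : ℂ}
    (hu : u ∉ Λ) (hd : C.d u = 0) :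
    transfer C.T u (C.Φ Λ) = (C.a u * ∏ y ∈ Λ, ff η y u) • C.Φ Λ := by
  rw [C.transfer_Φ hη hu hd, Finset.sum_eq_zero, add_zero]
  intro p hp
  have h : ∏ y ∈ Λ.erase p, ff η p y ≠ 0 := Finset.prod_ne_zero_iff.2 fun y hy =>
    ff_ne_zero (hg.shift p (by simp [hp]) y (by simp [Finset.mem_of_mem_erase hy]))
      (Finset.ne_of_mem_erase hy).symm
  rw [hB p hp, betheRatio, if_pos hp]
  field_simp
  simp

theorem transfer_prod_bethe (hη : η ≠ 0) (hg : GenericPoints η Λ C.s.1 C.K) (hB : C.Bethe Λ)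
    (l : List ℂ) (hl : l.Nodup) (h : ∀ u ∈ l, u ∉ Λ ∧ C.d u = 0) :
    (l.map (transfer C.T)).prod (C.Φ Λ) =
      ((∏ y ∈ l.toFinset, C.a y) * ∏ y ∈ l.toFinset, ∏ z ∈ Λ, ff η z y) • C.Φ Λ := by
  induction l with
  | nil => simp
  | cons u l ih =>
    have hu := h u (by simp)
    have hl' := List.nodup_cons.1 hl
    have hu' : u ∉ l.toFinset := by simpa using hl'.1
    rw [List.map_cons, List.prod_cons, Module.End.mul_apply, ih hl'.2 fun v hv => h v (by simp [hv]),
      map_smul, transfer_bethe hη hg hB hu.1 hu.2, smul_smul, List.toFinset_cons,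
      Finset.prod_insert hu', Finset.prod_insert hu']
    congr 1
    ring

theorem reverse_map (l : List (Site (Module.End ℂ V))) (T : Entries (Module.End ℂ V)) :
    (l.reverse.map fun p => transfer T p.1) = ((l.map Prod.fst).reverse.map (transfer T)) := by
  simp [List.map_reverse, Function.comp_def]

/-- In the inverse problem the transfer matrices next to the vector act on `Φ Λ` as scalars. Their
eigenvalue stays as a factor on the left instead of being inverted, so that both sides can later be
continued in the inhomogeneities. -/
theorem site_apply_bethe (hη : η ≠ 0) (hn : ((C.s :: C.l).map Prod.fst).Nodup)
    (hg : GenericPoints η Λ C.s.1 C.K) (hB : C.Bethe Λ) (i j : Fin 2) :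
    ((∏ y ∈ insert C.s.1 C.K, C.a y) * ∏ y ∈ insert C.s.1 C.K, ∏ z ∈ Λ, ff η z y) •
        C.s.2 j i (C.Φ Λ) =
      ((C.l.map Prod.fst).reverse.map (transfer C.T)).prod (C.T C.s.1 i j (C.Φ Λ)) := by
  have h := inverse_problem C.s C.l C.hl C.W C.hW C.hc i j
  rw [← C.hT, reverse_map] at h
  have h' := congrArg (fun F : Module.End ℂ V => F (C.Φ Λ)) h
  simp only [Module.End.mul_apply] at h'
  rw [List.map_cons, List.nodup_cons] at hn
  have hK : ((C.l.map Prod.fst).reverse).toFinset = C.K := by simp [K]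
  have hxK : C.s.1 ∉ C.K := by simpa only [K, List.mem_toFinset] using hn.1
  rw [h', transfer_bethe hη hg hB hg.x_notMem C.d_s, map_smul, transfer_prod_bethe hη hg hB _
    (List.nodup_reverse.2 hn.2), map_smul, map_smul, hK, smul_smul, Finset.prod_insert hxK,
    Finset.prod_insert hxK]
  · congr 1
    ring
  · intro u hu
    have : u ∈ C.K := by simpa [K] using hu
    exact ⟨Finset.disjoint_right.1 hg.disj this, C.d_K this⟩

/-- The value zero of `betheRatio` outside `Λ` agrees with `d` at the site `s`, so one ratio serves
all subsets of `Λ` and the new point. -/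
theorem transfer_prod_Φ_bethe (hη : η ≠ 0) (hn : ((C.s :: C.l).map Prod.fst).Nodup)
    (hg : GenericPoints η Λ C.s.1 C.K) (hB : C.Bethe Λ) {Z : Finset ℂ} (hZ : Z ⊆ insert C.s.1 Λ) :
    ((C.l.map Prod.fst).reverse.map (transfer C.T)).prod (C.Φ Z) =
      C.exState (betheRatio η Λ) C.K Z := by
  rw [List.map_cons, List.nodup_cons] at hn
  have hK : ((C.l.map Prod.fst).reverse).toFinset = C.K := by simp [K]
  have hK' : ∀ u ∈ (C.l.map Prod.fst).reverse, u ∈ C.K := fun u hu => by simpa [K] using hu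
  rw [← hK]
  refine C.transfer_prod_Φ hη _ (fun p hp q hq _ => hg.shift p (hZ hp) q (hZ hq)) ?_ _
    (List.nodup_reverse.2 hn.2) (fun u hu hu' => ?_) fun u hu => C.d_K (hK' u hu)
  · intro z hz
    rcases Finset.mem_insert.1 (hZ hz) with rfl | h
    · rw [C.d_s, betheRatio, if_neg hg.x_notMem, zero_mul]
    · exact hB z h
  · rcases Finset.mem_insert.1 (hZ hu') with rfl | h
    · exact hg.x_notMem_K (hK' _ hu)
    · exact Finset.disjoint_left.1 hg.disj h (hK' u hu)

/-- The coefficient of the removal of `b` in the action of `D`. -/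
def removeD (η : ℂ) (Λ : Finset ℂ) (x b : ℂ) : ℂ :=
  (∏ y ∈ Λ.erase b, ff η y b) * (η / (b - x))

/-- The coefficient of the removal of `b` and `p` in the action of `C`. -/
def removeC (η : ℂ) (Λ : Finset ℂ) (x b p : ℂ) : ℂ :=
  removeD η Λ x b * ((∏ y ∈ ((insert x Λ).erase b).erase p, ff η y p) * (η / (x - p + η)))

/-- The Bethe equation trades `d b` for `a b`. From here on `d` is absent from the coefficients,
which is why the formula can be transferred between chains of different length. -/
theorem bethe_D_coeff (hg : GenericPoints η Λ C.s.1 C.K) (hB : C.Bethe Λ) {b : ℂ} (hb : b ∈ Λ) :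
    η / (b - C.s.1 + η) * (C.d b * ∏ y ∈ (insert C.s.1 Λ).erase b, ff η b y) =
      C.a b * removeD η Λ C.s.1 b := by
  have h : ∏ y ∈ Λ.erase b, ff η b y ≠ 0 := Finset.prod_ne_zero_iff.2 fun y hy =>
    ff_ne_zero (hg.shift b (by simp [hb]) y (by simp [Finset.mem_of_mem_erase hy]))
      (Finset.ne_of_mem_erase hy).symm
  have hxb : C.s.1 ≠ b := fun h => hg.x_notMem (h ▸ hb)
  have h1 : b - C.s.1 ≠ 0 := sub_ne_zero.2 hxb.symm
  have h2 : b - C.s.1 + η ≠ 0 := hg.shift b (by simp [hb]) _ (by simp)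
  rw [Finset.erase_insert_of_ne hxb, Finset.prod_insert fun h =>
    hg.x_notMem (Finset.mem_of_mem_erase h), hB b hb, betheRatio, if_pos hb, removeD]
  generalize ∏ y ∈ Λ.erase b, ff η b y = P1 at *
  unfold ff
  field_simp

theorem bulk_minus_bethe (hη : η ≠ 0) (hn : ((C.s :: C.l).map Prod.fst).Nodup)
    (hg : GenericPoints η Λ C.s.1 C.K) (hB : C.Bethe Λ) :
    C.BulkFormula Λ C.s.1 C.K (C.s.2 1 0) {()} (fun _ => ∅) fun _ => 1 := by
  rw [HighestWeight.BulkFormula, site_apply_bethe hη hn hg hB, ← C.Φ_insert hη hg.x_notMem,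
    transfer_prod_Φ_bethe hη hn hg hB subset_rfl]
  simp

/-- The entry is `D`. Its removal of the new point itself drops out because `d` vanishes there. -/
theorem bulk_E22_bethe (hη : η ≠ 0) (hn : ((C.s :: C.l).map Prod.fst).Nodup)
    (hg : GenericPoints η Λ C.s.1 C.K) (hB : C.Bethe Λ) :
    C.BulkFormula Λ C.s.1 C.K (C.s.2 1 1) Λ (fun b => {b}) (removeD η Λ C.s.1) := by
  rw [HighestWeight.BulkFormula, site_apply_bethe hη hn hg hB, C.D_Φ' hη hg.x_notMem
    fun p hp => hg.shift p (by simp [hp]) _ (by simp), Finset.sum_insert hg.x_notMem, C.d_s]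
  simp only [zero_mul, mul_zero, zero_smul, zero_add, map_sum, map_smul]
  refine Finset.sum_congr rfl fun b hb => ?_
  rw [transfer_prod_Φ_bethe hη hn hg hB (Finset.erase_subset _ _), bethe_D_coeff hg hB hb,
    Finset.prod_singleton, Finset.sdiff_singleton_eq_erase]

/-- The entry is `C`. The point `b` removed with a factor `d` must lie in `Λ`, whereas the point `p`
removed with a factor `a` may be the new one. -/
theorem bulk_plus_bethe (hη : η ≠ 0) (hn : ((C.s :: C.l).map Prod.fst).Nodup)
    (hg : GenericPoints η Λ C.s.1 C.K) (hB : C.Bethe Λ) :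
    C.BulkFormula Λ C.s.1 C.K (C.s.2 0 1) (Λ.sigma fun b => (insert C.s.1 Λ).erase b)
      (fun i => {i.1, i.2}) (fun i => removeC η Λ C.s.1 i.1 i.2) := by
  rw [HighestWeight.BulkFormula, site_apply_bethe hη hn hg hB, C.C_Φ hη _ _ hg.x_notMem hg.shift,
    Finset.sum_insert hg.x_notMem, C.d_s]
  simp only [zero_mul, mul_zero, zero_smul, zero_add, map_sum, map_smul, Finset.sum_const_zero]
  rw [Finset.sum_sigma]
  refine Finset.sum_congr rfl fun b hb => Finset.sum_congr rfl fun p hp => ?_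
  rw [transfer_prod_Φ_bethe hη hn hg hB ((Finset.erase_subset _ _).trans (Finset.erase_subset _ _)),
    bethe_D_coeff hg hB hb, Finset.prod_pair (Finset.ne_of_mem_erase hp).symm]
  congr 1
  · simp only [removeC]
    ring
  · congr 1
    ext z
    simp only [Finset.mem_erase, Finset.mem_sdiff, Finset.mem_insert, Finset.mem_singleton]
    tauto

end SpinChain
end OpenXXX
end

/-! ### Adding sites to dispose of the Bethe equations. -/

open scoped Matrix
noncomputable section
namespace OpenXXX

section Map

variable {A B : Type*} [Ring A] [Algebra ℂ A] [Ring B] [Algebra ℂ B] (φ : A →ₐ[ℂ] B)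

/-- The image of `T` under an algebra homomorphism. -/
def Entries.map (T : Entries A) : Entries B := fun u i j => φ (T u i j)

theorem Entries.map_mul (T T' : Entries A) : (T.mul T').map φ = (T.map φ).mul (T'.map φ) := by
  funext u i j
  simp [Entries.map, Entries.mul]

theorem Yangian.map {η : ℂ} {T : Entries A} (h : Yangian η T) : Yangian η (T.map φ) := by
  intro u v i j k l
  have := congrArg φ (h u v i j k l)
  simpa [Entries.map] using this

/-- The image of a site under an algebra homomorphism. -/
def Site.map (p : Site A) : Site B := (p.1, fun a b => φ (p.2 a b))

theorem laxProd_map (η : ℂ) (l : List (Site A)) :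
    (laxProd η l).map φ = laxProd η (l.map (Site.map φ)) := by
  induction l with
  | nil =>
    funext u i j
    simp only [laxProd, Entries.map, Entries.one, List.map_nil]
    split_ifs <;> simp
  | cons p l ih =>
    rw [laxProd, Entries.map_mul, ih, List.map_cons, laxProd]
    congr 1
    funext u i j
    simp only [Entries.map, lax, Site.map, map_add, map_smul]
    split_ifs <;> simp

theorem SitesIndep.map {l : List (Site A)} (h : SitesIndep l) :
    SitesIndep (l.map (Site.map φ)) := by
  refine ⟨fun p hp => ?_, ?_⟩
  · obtain ⟨q, hq, rfl⟩ := List.mem_map.1 hp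
    refine ⟨fun a b c d => ?_, ?_⟩
    · simp only [Site.map, ← _root_.map_mul, (h.1 q hq).mul]
      split_ifs <;> simp
    · simp only [Site.map, ← map_add, (h.1 q hq).one, map_one]
  · rw [List.pairwise_map]
    exact h.2.imp fun h a b c d => (h a b c d).map φ

end Map

section Extend

variable {V : Type} [AddCommGroup V] [Module ℂ V]

/-- The componentwise action on `ℂ² ⊗ V`. -/
def liftEnd (V : Type) [AddCommGroup V] [Module ℂ V] :
    Module.End ℂ V →ₐ[ℂ] Module.End ℂ (Fin 2 → V) where
  toFun F := F.compLeft (Fin 2)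
  map_one' := rfl
  map_mul' _ _ := rfl
  map_zero' := rfl
  map_add' _ _ := rfl
  commutes' _ := rfl

theorem liftEnd_apply (F : Module.End ℂ V) (v : Fin 2 → V) (c : Fin 2) :
    liftEnd V F v c = F (v c) := rfl

/-- The matrix units of the first factor of `ℂ² ⊗ V`. -/
def newUnit (V : Type) [AddCommGroup V] [Module ℂ V] (a b : Fin 2) :
    Module.End ℂ (Fin 2 → V) :=
  LinearMap.pi fun c => if c = a then LinearMap.proj b else 0

theorem newUnit_apply (a b c : Fin 2) (v : Fin 2 → V) :
    newUnit V a b v c = if c = a then v b else 0 := by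
  simp only [newUnit, LinearMap.pi_apply]
  split_ifs <;> rfl

theorem newUnit_matUnits : MatUnits (newUnit V) := by
  refine ⟨fun a b c d => ?_, ?_⟩
  · refine LinearMap.ext fun v => funext fun x => ?_
    rw [Module.End.mul_apply, newUnit_apply, newUnit_apply]
    by_cases h : b = c
    · simp only [h, if_true, newUnit_apply]
    · simp [h]
  · refine LinearMap.ext fun v => funext fun x => ?_
    rw [LinearMap.add_apply, Pi.add_apply, newUnit_apply, newUnit_apply]
    fin_cases x <;> simp

theorem newUnit_commute (a b : Fin 2) (F : Module.End ℂ V) :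
    Commute (newUnit V a b) (liftEnd V F) := by
  refine LinearMap.ext fun v => funext fun x => ?_
  rw [Module.End.mul_apply, Module.End.mul_apply, newUnit_apply, liftEnd_apply, liftEnd_apply,
    newUnit_apply]
  split_ifs <;> simp

namespace SpinChain

variable {η : ℂ} (C : SpinChain η V)

theorem extend_apply (ρ : ℂ) (T : Entries (Module.End ℂ V)) (u : ℂ) (i j : Fin 2)
    (v : Fin 2 → V) (c : Fin 2) :
    ((lax η ρ (newUnit V)).mul (T.map (liftEnd V))) u i j v c =
      (u - ρ) • T u i j (v c) + η • T u c j (v i) := by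
  rw [lax_mul_apply]
  simp only [LinearMap.add_apply, LinearMap.smul_apply, LinearMap.sum_apply, Pi.add_apply,
    Pi.smul_apply, Finset.sum_apply, Module.End.mul_apply, newUnit_apply, Entries.map,
    liftEnd_apply, Finset.sum_ite_eq, Finset.mem_univ, if_true]

/-- The chain with a further site of inhomogeneity `ρ` on the left. -/
def extend (ρ : ℂ) : SpinChain η (Fin 2 → V) where
  T := (lax η ρ (newUnit V)).mul (C.T.map (liftEnd V))
  yangian := (newUnit_matUnits.yangian η ρ).mul (C.yangian.map _)
    (UnitsCommute.lax (fun _ a b _ _ => newUnit_commute a b _) η ρ).symm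
  Ω := Pi.single 0 C.Ω
  a u := (u - ρ + η) * C.a u
  d u := (u - ρ) * C.d u
  hA u := by
    funext c
    rw [extend_apply]
    fin_cases c <;> simp [C.hA, C.hC] <;> module
  hD u := by
    funext c
    rw [extend_apply]
    fin_cases c <;> simp [C.hD] ; module
  hC u := by
    funext c
    rw [extend_apply]
    fin_cases c <;> simp [C.hC]
  W := (lax η ρ (newUnit V)).mul (C.W.map (liftEnd V))
  s := Site.map (liftEnd V) C.s
  l := C.l.map (Site.map (liftEnd V))
  hT := by
    conv_lhs => rw [C.hT]
    rw [Entries.map_mul, laxProd_map, Entries.mul_assoc, List.map_cons]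
  hW := (newUnit_matUnits.yangian η ρ).mul (C.hW.map _)
    (UnitsCommute.lax (fun _ a b _ _ => newUnit_commute a b _) η ρ).symm
  hl := C.hl.map (liftEnd V)
  hc p hp := by
    rw [← List.map_cons] at hp
    obtain ⟨q, hq, rfl⟩ := List.mem_map.1 hp
    refine UnitsCommute.mul (unitsCommute_lax (fun a b c d => (newUnit_commute c d _).symm) η ρ) ?_
    exact fun v a b k l => (C.hc q hq v a b k l).map (liftEnd V)
  hd p hp := by
    rw [← List.map_cons] at hp
    obtain ⟨q, hq, rfl⟩ := List.mem_map.1 hp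
    simp only [Site.map, C.hd q hq, mul_zero]

theorem extend_sites (ρ : ℂ) : (((C.extend ρ).s :: (C.extend ρ).l).map Prod.fst) =
    (C.s :: C.l).map Prod.fst := by
  simp [extend, Site.map, Function.comp_def]

theorem extend_K (ρ : ℂ) : (C.extend ρ).K = C.K := by
  simp [K, extend, Site.map, Function.comp_def]

/-- On the component with the new spin up, `B(u)` of the longer chain involves no other component
and is `u - ρ + η` times the old `B(u)`. -/
theorem extend_Φ (hη : η ≠ 0) (ρ : ℂ) (I : Finset ℂ) :
    (C.extend ρ).Φ I 0 = (∏ u ∈ I, (u - ρ + η)) • C.Φ I := by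
  induction I using Finset.induction_on with
  | empty => rw [HighestWeight.Φ_empty, HighestWeight.Φ_empty]; simp [extend]
  | insert x I hx ih =>
    rw [HighestWeight.Φ_insert _ hη hx, HighestWeight.Φ_insert _ hη hx, Finset.prod_insert hx]
    have : (C.extend ρ).T x 0 1 = ((lax η ρ (newUnit V)).mul (C.T.map (liftEnd V))) x 0 1 := rfl
    rw [this, extend_apply, ih, map_smul]
    module

/-- Points of `α` and `K \ γ` contribute their factor through `a`, the points of `Z \ α` and `γ`
through `Φ`. The total is therefore the same for all terms. -/
theorem extend_exState (hη : η ≠ 0) (r : ℂ) (ρ : ℂ → ℂ) {K Z : Finset ℂ} (hZK : Disjoint Z K) :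
    (C.extend r).exState ρ K Z 0 =
      ((∏ u ∈ Z, (u - r + η)) * ∏ u ∈ K, (u - r + η)) • C.exState ρ K Z := by
  rw [HighestWeight.exState, HighestWeight.exState, Finset.sum_apply, Finset.smul_sum]
  refine Finset.sum_congr rfl fun γ hγ => ?_
  rw [Finset.sum_apply, Finset.smul_sum]
  refine Finset.sum_congr rfl fun α hα => ?_
  have hd : Disjoint (Z \ α) γ :=
    (hZK.mono_left Finset.sdiff_subset).mono_right (Finset.mem_powerset.1 hγ)
  rw [Pi.smul_apply, extend_Φ C hη, smul_smul, smul_smul, Finset.prod_union hd,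
    ← Finset.prod_sdiff (Finset.mem_powerset.1 hα), ← Finset.prod_sdiff (Finset.mem_powerset.1 hγ)]
  simp only [extend, Finset.prod_mul_distrib]
  congr 1
  ring

end SpinChain

end Extend

/-- A formula for the action of local operators that holds under the Bethe equations holds if these
can be satisfied after adding sites with the inhomogeneities `r`. -/
theorem SpinChain.bulk_of_extension {η : ℂ} (hη : η ≠ 0) {Λ : Finset ℂ} {xs : List ℂ} {x : ℂ}
    {K : Finset ℂ} (hg : GenericPoints η Λ x K) (i j : Fin 2) {ι : Type} (S : Finset ι)
    (D : ι → Finset ℂ) (hD : ∀ i ∈ S, D i ⊆ insert x Λ) (k : ι → ℂ)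
    (hB : ∀ (V : Type) [AddCommGroup V] [Module ℂ V] (C : SpinChain η V),
      (C.s :: C.l).map Prod.fst = xs → C.s.1 = x → C.K = K → C.Bethe Λ →
        C.BulkFormula Λ x K (C.s.2 j i) S D k) (r : List ℂ) :
    ∀ (V : Type) [AddCommGroup V] [Module ℂ V] (C : SpinChain η V),
      (C.s :: C.l).map Prod.fst = xs → C.s.1 = x → C.K = K →
      (∀ z ∈ Λ, C.d z * (r.map fun ρ => z - ρ).prod =
        betheRatio η Λ z * (C.a z * (r.map fun ρ => z - ρ + η).prod)) →
      (∀ y ∈ insert x Λ ∪ K, ∀ ρ ∈ r, y - ρ + η ≠ 0) →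
        C.BulkFormula Λ x K (C.s.2 j i) S D k := by
  induction r with
  | nil =>
    intro V _ _ C h1 h2 h3 h4 _
    exact hB V C h1 h2 h3 fun z hz => by simpa using h4 z hz
  | cons ρ r ih =>
    intro V _ _ C h1 h2 h3 h4 h5
    have key := ih (Fin 2 → V) (C.extend ρ) (by rw [extend_sites, h1]) h2 (by rw [extend_K, h3])
      (fun z hz => by
        have := h4 z hz
        simp only [List.map_cons, List.prod_cons] at this
        simp only [extend]
        linear_combination this)
      fun y hy q hq => h5 y hy q (by simp [hq])
    have hne : ∀ I ⊆ insert x Λ ∪ K, ∏ u ∈ I, (u - ρ + η) ≠ 0 := fun I hI =>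
      Finset.prod_ne_zero_iff.2 fun u hu => h5 u (hI hu) ρ (by simp)
    have hdis : Disjoint (insert x Λ) K := Finset.disjoint_insert_left.2 ⟨hg.x_notMem_K, hg.disj⟩
    -- Only the component with the added spin up is kept; the local operator does not touch the
    -- added site.
    have h0 := congrFun key 0
    rw [Pi.smul_apply] at h0
    have hs : (C.extend ρ).s.2 j i = liftEnd V (C.s.2 j i) := rfl
    rw [hs, liftEnd_apply, extend_Φ C hη, map_smul, smul_smul, Finset.sum_apply] at h0
    have hterm : ∀ i ∈ S, (((∏ z ∈ D i, (C.extend ρ).a z) * k i) •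
        (C.extend ρ).exState (betheRatio η Λ) K (insert x Λ \ D i)) 0 =
        ((∏ u ∈ insert x Λ, (u - ρ + η)) * ∏ u ∈ K, (u - ρ + η)) •
          (((∏ z ∈ D i, C.a z) * k i) • C.exState (betheRatio η Λ) K (insert x Λ \ D i)) := by
      intro i hi
      rw [Pi.smul_apply, extend_exState C hη ρ _ (hdis.mono_left Finset.sdiff_subset), smul_smul,
        smul_smul, ← Finset.prod_sdiff (hD i hi)]
      simp only [extend, Finset.prod_mul_distrib]
      congr 1
      ring
    rw [Finset.sum_congr rfl hterm, ← Finset.smul_sum] at h0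
    -- Left and right carry the same product of `u - ρ + η` over `insert x Λ` and `K`, nonzero by
    -- assumption.
    have hlhs : ((∏ y ∈ insert x K, (C.extend ρ).a y) *
        ∏ y ∈ insert x K, ∏ z ∈ Λ, ff η z y) * ∏ u ∈ Λ, (u - ρ + η) =
        ((∏ u ∈ insert x Λ, (u - ρ + η)) * ∏ u ∈ K, (u - ρ + η)) *
        ((∏ y ∈ insert x K, C.a y) * ∏ y ∈ insert x K, ∏ z ∈ Λ, ff η z y) := by
      simp only [extend, Finset.prod_mul_distrib]
      rw [Finset.prod_insert (f := fun u => u - ρ + η) hg.x_notMem,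
        Finset.prod_insert (f := fun u => u - ρ + η) hg.x_notMem_K]
      ring
    rw [hlhs, mul_smul] at h0
    exact smul_right_injective V (mul_ne_zero (hne _ Finset.subset_union_left)
      (hne _ Finset.subset_union_right)) h0

open Polynomial in
/-- A monic polynomial with prescribed values, in terms of its roots. -/
theorem exists_roots_of_values (Q : Finset ℂ) (v : ℂ → ℂ) :
    ∃ r : List ℂ, ∀ q ∈ Q, (r.map fun ρ => q - ρ).prod = v q := by
  classical
  set I := Lagrange.interpolate Q id v
  set n := Lagrange.nodal Q id
  have hI : I.degree < n.degree := by
    rw [Lagrange.degree_nodal]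
    exact Lagrange.degree_interpolate_lt _ Function.injective_id.injOn
  -- Adding the nodal polynomial makes the interpolant monic without changing its values on `Q`.
  have hm : (n + I).Monic := (Lagrange.nodal_monic (s := Q) (v := id)).add_of_left hI
  have hs := IsAlgClosed.splits (n + I)
  refine ⟨(n + I).roots.toList, fun q hq => ?_⟩
  have h := congrArg (eval q) (hs.eq_prod_roots)
  rw [hm.leadingCoeff, C_1, one_mul, eval_multiset_prod, Multiset.map_map, eval_add] at h
  have h1 : eval q n = 0 := Lagrange.eval_nodal_at_node (v := id) hq
  have h2 : eval q I = v q :=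
    Lagrange.eval_interpolate_at_node v Function.injective_id.injOn hq
  rw [h1, h2, zero_add] at h
  rw [h, ← Multiset.coe_toList (n + I).roots]
  simp

/-- The formula for the action of local operators holds without the Bethe equations. -/
theorem SpinChain.bulk_of_bethe {η : ℂ} (hη : η ≠ 0) {Λ : Finset ℂ} {xs : List ℂ} {x : ℂ}
    {K : Finset ℂ} (hg : GenericPoints η Λ x K) (i j : Fin 2) {ι : Type} (S : Finset ι)
    (D : ι → Finset ℂ) (hD : ∀ i ∈ S, D i ⊆ insert x Λ) (k : ι → ℂ)
    (hB : ∀ (V : Type) [AddCommGroup V] [Module ℂ V] (C : SpinChain η V),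
      (C.s :: C.l).map Prod.fst = xs → C.s.1 = x → C.K = K → C.Bethe Λ →
        C.BulkFormula Λ x K (C.s.2 j i) S D k)
    {V : Type} [AddCommGroup V] [Module ℂ V] (C : SpinChain η V)
    (h1 : (C.s :: C.l).map Prod.fst = xs) (h2 : C.s.1 = x) (h3 : C.K = K)
    (hd : ∀ z ∈ Λ, C.d z ≠ 0) : C.BulkFormula Λ x K (C.s.2 j i) S D k := by
  classical
  -- The shifted points `y + η` avoid `Λ`, so the values prescribed below do not conflict.
  have hΛ : ∀ z ∈ Λ, z - η ∉ Λ := fun z hz h => by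
    have := hg.shift (z - η) (by simp [h]) z (by simp [hz])
    exact this (by ring)
  have hxK : ∀ y ∈ insert x K, y + η ∉ Λ := by
    intro y hy h
    rcases Finset.mem_insert.1 hy with rfl | hy
    · exact hg.shift y (by simp) _ (Finset.mem_insert_of_mem h) (by ring)
    · exact hg.shift_K y hy _ h (by ring)
  -- With `p(u) = ∏ (u - ρ)`, the Bethe equations of the longer chain read `d z * p(z) = betheRatio
  -- z * a z * p(z + η)`. They are solved by `p(z) = betheRatio z * a z` and `p(z + η) = d z`. At
  -- the remaining points `y + η` the value `1` keeps the factors to be cancelled nonzero.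
  obtain ⟨r, hr⟩ := exists_roots_of_values (Λ ∪ (insert x Λ ∪ K).image (· + η)) fun q =>
    if q ∈ Λ then betheRatio η Λ q * C.a q else if q - η ∈ Λ then C.d (q - η) else 1
  have e1 : ∀ z ∈ Λ, (r.map fun ρ => z - ρ).prod = betheRatio η Λ z * C.a z := fun z hz => by
    rw [hr z (by simp [hz]), if_pos hz]
  have e2 : ∀ y ∈ insert x Λ ∪ K, (r.map fun ρ => y - ρ + η).prod =
      if y ∈ Λ then C.d y else 1 := fun y hy => by
    have h := hr (y + η) (Finset.mem_union_right _ (Finset.mem_image_of_mem _ hy))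
    have hy' : y + η ∉ Λ := by
      by_cases hyΛ : y ∈ Λ
      · exact fun h' => hΛ _ h' (by simpa using hyΛ)
      · refine hxK y ?_
        simp only [Finset.mem_union, Finset.mem_insert] at hy ⊢
        tauto
    rw [if_neg hy', add_sub_cancel_right] at h
    rw [← h]
    congr 2
    funext ρ
    ring
  refine SpinChain.bulk_of_extension hη hg i j S D hD k hB r V C h1 h2 h3 (fun z hz => ?_) ?_
  · rw [e1 z hz, e2 z (by simp [hz]), if_pos hz]
    ring
  · intro y hy ρ hρ h0
    have := e2 y hy
    rw [List.prod_eq_zero (List.mem_map.2 ⟨ρ, hρ, h0⟩)] at this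
    split_ifs at this with h
    · exact hd y h this.symm
    · exact zero_ne_one this

end OpenXXX
end

/-! ### The concrete spin chain with a triangular twist. -/

open scoped Matrix
noncomputable section
namespace OpenXXX

section Concrete

variable {N : ℕ}

/-- The operator acting as `X` on the site `n`, as an endomorphism. -/
def siteEnd (n : Fin N) (X : Matrix (Fin 2) (Fin 2) ℂ) : Module.End ℂ ((Fin N → Fin 2) → ℂ) where
  toFun v := fun c => ∑ i, X (c n) i * v (Function.update c n i)
  map_add' v w := by
    funext c
    simp [mul_add, Finset.sum_add_distrib]
  map_smul' a v := by
    funext c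
    simp only [Pi.smul_apply, smul_eq_mul, RingHom.id_apply, Finset.mul_sum]
    exact Finset.sum_congr rfl fun i _ => by ring

theorem siteEnd_apply (n : Fin N) (X : Matrix (Fin 2) (Fin 2) ℂ) (v : (Fin N → Fin 2) → ℂ)
    (c : Fin N → Fin 2) : siteEnd n X v c = ∑ i, X (c n) i * v (Function.update c n i) := rfl

theorem siteOp_mulVec (n : Fin N) (X : Matrix (Fin 2) (Fin 2) ℂ) (v : (Fin N → Fin 2) → ℂ) :
    siteOp n X *ᵥ v = siteEnd n X v := by
  funext c
  rw [siteEnd_apply, Matrix.mulVec, dotProduct]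
  simp only [siteOp, ite_mul, zero_mul]
  rw [← Finset.sum_filter]
  refine Finset.sum_bij' (fun t _ => t n) (fun i _ => Function.update c n i) ?_ ?_ ?_ ?_ ?_
  · simp
  · intro i _
    simp only [Finset.mem_filter, Finset.mem_univ, true_and]
    exact fun k hk => (Function.update_of_ne hk _ _).symm
  · intro t ht
    simp only [Finset.mem_filter, Finset.mem_univ, true_and] at ht
    funext k
    by_cases hk : k = n
    · subst hk; simp
    · rw [Function.update_of_ne hk, ht k hk]
  · intro i _; simp
  · intro t ht
    simp only [Finset.mem_filter, Finset.mem_univ, true_and] at ht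
    congr 2
    funext k
    by_cases hk : k = n
    · subst hk; simp
    · rw [Function.update_of_ne hk, ht k hk]

theorem siteEnd_mul (n : Fin N) (X Y : Matrix (Fin 2) (Fin 2) ℂ) :
    siteEnd n X * siteEnd n Y = siteEnd n (X * Y) := by
  refine LinearMap.ext fun v => funext fun c => ?_
  simp only [Module.End.mul_apply, siteEnd_apply, Matrix.mul_apply, Function.update_self,
    Function.update_idem, Finset.mul_sum, Finset.sum_mul]
  rw [Finset.sum_comm]
  simp only [mul_assoc]

theorem siteEnd_one (n : Fin N) : siteEnd n 1 = 1 := by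
  refine LinearMap.ext fun v => funext fun c => ?_
  simp [siteEnd_apply, Matrix.one_apply]

theorem siteEnd_add (n : Fin N) (X Y : Matrix (Fin 2) (Fin 2) ℂ) :
    siteEnd n (X + Y) = siteEnd n X + siteEnd n Y := by
  refine LinearMap.ext fun v => funext fun c => ?_
  simp [siteEnd_apply, add_mul, Finset.sum_add_distrib]

theorem siteEnd_smul (n : Fin N) (a : ℂ) (X : Matrix (Fin 2) (Fin 2) ℂ) :
    siteEnd n (a • X) = a • siteEnd n X := by
  refine LinearMap.ext fun v => funext fun c => ?_
  simp only [siteEnd_apply, LinearMap.smul_apply, Pi.smul_apply, Matrix.smul_apply, smul_eq_mul,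
    Finset.mul_sum, mul_assoc]

theorem siteEnd_commute {n m : Fin N} (h : n ≠ m) (X Y : Matrix (Fin 2) (Fin 2) ℂ) :
    Commute (siteEnd n X) (siteEnd m Y) := by
  refine LinearMap.ext fun v => funext fun c => ?_
  simp only [Module.End.mul_apply, siteEnd_apply, Function.update_of_ne h,
    Function.update_of_ne h.symm, Finset.mul_sum]
  rw [Finset.sum_comm]
  refine Finset.sum_congr rfl fun i _ => Finset.sum_congr rfl fun j _ => ?_
  rw [Function.update_comm h]
  ring

/-- The matrix units of the site `n`. -/
def siteUnit (n : Fin N) (a b : Fin 2) : Module.End ℂ ((Fin N → Fin 2) → ℂ) :=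
  siteEnd n (Matrix.single a b 1)

theorem siteUnit_matUnits (n : Fin N) : MatUnits (siteUnit n) := by
  refine ⟨fun a b c d => ?_, ?_⟩
  · rw [siteUnit, siteUnit, siteEnd_mul]
    split_ifs with h
    · subst h
      simp [siteUnit]
    · rw [Matrix.single_mul_single_of_ne _ _ _ _ h]
      refine LinearMap.ext fun v => funext fun c => ?_
      simp [siteEnd_apply]
  · rw [siteUnit, siteUnit, ← siteEnd_add, ← siteEnd_one n]
    congr 1
    ext i j
    fin_cases i <;> fin_cases j <;> simp

/-- The sites `l` of the chain with the inhomogeneities `ρ`. -/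
def chainSites (ρ : Fin N → ℂ) (l : List (Fin N)) :
    List (Site (Module.End ℂ ((Fin N → Fin 2) → ℂ))) := l.map fun n => (ρ n, siteUnit n)

theorem chainSites_indep (ρ : Fin N → ℂ) {l : List (Fin N)} (hl : l.Nodup) :
    SitesIndep (chainSites ρ l) := by
  refine ⟨fun p hp => ?_, ?_⟩
  · obtain ⟨n, _, rfl⟩ := List.mem_map.1 hp
    exact siteUnit_matUnits n
  · rw [chainSites, List.pairwise_map]
    exact hl.imp fun h a b c d => siteEnd_commute h _ _

variable {A : Type*} [Ring A] [Algebra ℂ A]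

/-- A constant upper triangular matrix. -/
def triMat (b : ℂ) : Entries A := fun _ i j => (if i = j then 1 else if i = 0 then b else 0 : ℂ) • 1

/-- The entries are scalars, so the commutator vanishes; they do not depend on the spectral
parameter, so the right side vanishes as well. -/
theorem triMat_yangian (η b : ℂ) : Yangian η (triMat b : Entries A) := by
  intro u v i j k l
  simp only [triMat, smul_mul_smul_comm, mul_one]
  rw [sub_self, smul_zero, mul_comm, sub_self, smul_zero]

theorem triMat_unitsCommute (b : ℂ) (e : Fin 2 → Fin 2 → A) : UnitsCommute e (triMat b) :=
  fun _ _ _ _ _ => (Commute.one_right _).smul_right _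

theorem laxProd_append (η : ℂ) (l l' : List (Site A)) :
    laxProd η (l ++ l') = (laxProd η l).mul (laxProd η l') := by
  induction l with
  | nil => simp only [List.nil_append, laxProd, Entries.one_mul]
  | cons q l ih => simp only [List.cons_append, laxProd, ih, Entries.mul_assoc]

theorem siteUnit_vacuum (n : Fin N) (i j : Fin 2) (hij : j = 1 ∨ i = 0) :
    siteUnit n i j (vacuum N) = if i = 0 ∧ j = 0 then vacuum N else 0 := by
  funext c
  rw [siteUnit, siteEnd_apply]
  have h1 : ∀ c : Fin N → Fin 2, vacuum N (Function.update c n 1) = 0 := fun c => by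
    rw [vacuum, Pi.single_apply, if_neg fun h => ?_]
    simpa using congrFun h n
  have h0 : ∀ c : Fin N → Fin 2, c n = 0 → Function.update c n 0 = c := fun c hc => by
    rw [← hc, Function.update_eq_self]
  have h2 : c n = 1 → vacuum N c = 0 := fun h => by rw [← Function.update_eq_self n c, h, h1]
  have h3 : c n = 0 ∨ c n = 1 := by
    generalize c n = y
    fin_cases y <;> simp
  rcases h3 with h3 | h3
  · have h4 : vacuum N (Function.update c n 0) = vacuum N c := congrArg _ (h0 c h3)
    clear h0
    fin_cases i <;> fin_cases j <;> simp_all [Matrix.single_apply]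
  · fin_cases i <;> fin_cases j <;> simp_all [Matrix.single_apply]

/-- Each Lax matrix is triangular on the vacuum. The term with `e 0 1` of the first site after the
entry `0 1` of the rest vanishes once the unit is commuted through to the vacuum. -/
theorem laxProd_vacuum (η : ℂ) (ρ : Fin N → ℂ) (l : List (Fin N)) (hl : l.Nodup) (u : ℂ) :
    laxProd η (chainSites ρ l) u 0 0 (vacuum N) =
        (l.map fun n => u - ρ n + η).prod • vacuum N ∧
      laxProd η (chainSites ρ l) u 1 1 (vacuum N) = (l.map fun n => u - ρ n).prod • vacuum N ∧
      laxProd η (chainSites ρ l) u 1 0 (vacuum N) = 0 := by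
  induction l with
  | nil => simp [chainSites, laxProd, Entries.one]
  | cons n l ih =>
    have hl' := List.nodup_cons.1 hl
    obtain ⟨hA, hD, hC⟩ := ih hl'.2
    have hcomm : siteUnit n 0 1 (laxProd η (chainSites ρ l) u 0 1 (vacuum N)) =
        laxProd η (chainSites ρ l) u 0 1 (siteUnit n 0 1 (vacuum N)) :=
      LinearMap.congr_fun (unitsCommute_laxProd (e := siteUnit n) (l := chainSites ρ l)
        (fun q hq a b c d => by
          obtain ⟨m, hm, rfl⟩ := List.mem_map.1 hq
          exact siteEnd_commute (fun h => hl'.1 (by rwa [h])) _ _) η u 0 1 0 1).eq (vacuum N)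
    have h00 := siteUnit_vacuum n 0 0 (Or.inr rfl)
    have h01 := siteUnit_vacuum n 0 1 (Or.inr rfl)
    have h11 := siteUnit_vacuum n 1 1 (Or.inl rfl)
    simp only [and_self, if_true, one_ne_zero, and_false, if_false] at h00 h01 h11
    have e1 : laxProd η (chainSites ρ (n :: l)) =
      (lax η (ρ n) (siteUnit n)).mul (laxProd η (chainSites ρ l)) := rfl
    rw [e1]
    simp only [Entries.mul, Fin.sum_univ_two, LinearMap.add_apply, Module.End.mul_apply, hA, hD, hC,
      map_smul, map_zero, lax, LinearMap.smul_apply, if_true, one_ne_zero, zero_ne_one, if_false,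
      Module.End.one_apply, smul_zero, zero_add, add_zero, h00, h01, h11,
      List.map_cons, List.prod_cons]
    rw [hcomm, h01, map_zero, smul_zero, zero_add]
    exact ⟨by module, by module, trivial⟩

/-- The spin chain with the inhomogeneities `ρ` and a triangular twist. -/
def twistedChain (η b : ℂ) (ρ : Fin N → ℂ) : HighestWeight η ((Fin N → Fin 2) → ℂ) where
  T := (triMat b).mul (laxProd η (chainSites ρ (List.finRange N).reverse))
  yangian := (triMat_yangian η b).mul
    ((chainSites_indep ρ (List.nodup_reverse.2 (List.nodup_finRange N))).yangian η)
    (commutes_laxProd (fun p _ => triMat_unitsCommute b p.2) η)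
  Ω := vacuum N
  a u := ∏ n, (u - ρ n + η)
  d u := ∏ n, (u - ρ n)
  hA u := by
    obtain ⟨hA, hD, hC⟩ := laxProd_vacuum η ρ _ (List.nodup_reverse.2 (List.nodup_finRange N)) u
    simp [Entries.mul, triMat, Fin.sum_univ_two, hA, hC, List.map_reverse, List.prod_reverse,
      List.prod_ofFn, ← List.ofFn_eq_map]
  hD u := by
    obtain ⟨hA, hD, hC⟩ := laxProd_vacuum η ρ _ (List.nodup_reverse.2 (List.nodup_finRange N)) u
    simp [Entries.mul, triMat, hD, List.map_reverse, List.prod_reverse,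
      List.prod_ofFn, ← List.ofFn_eq_map]
  hC u := by
    obtain ⟨hA, hD, hC⟩ := laxProd_vacuum η ρ _ (List.nodup_reverse.2 (List.nodup_finRange N)) u
    simp [Entries.mul, triMat, hC]

/-- The chain with the distinguished sites `s :: l`. -/
def distinguishedChain (η b : ℂ) (ρ : Fin N → ℂ) (s : Fin N) (l r : List (Fin N))
    (h : (List.finRange N).reverse = r ++ s :: l) : SpinChain η ((Fin N → Fin 2) → ℂ) where
  toHighestWeight := twistedChain η b ρ
  W := (triMat b).mul (laxProd η (chainSites ρ r))
  s := (ρ s, siteUnit s)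
  l := chainSites ρ l
  hT := by
    have : chainSites ρ (List.finRange N).reverse =
        chainSites ρ r ++ ((ρ s, siteUnit s) :: chainSites ρ l) := by
      rw [h, chainSites, List.map_append]; rfl
    change (triMat b).mul (laxProd η (chainSites ρ (List.finRange N).reverse)) = _
    rw [this, laxProd_append, Entries.mul_assoc]
  hW := by
    have hn := List.nodup_reverse.2 (List.nodup_finRange N)
    rw [h] at hn
    exact (triMat_yangian η b).mul ((chainSites_indep ρ hn.of_append_left).yangian η)
      (commutes_laxProd (fun p _ => triMat_unitsCommute b p.2) η)
  hl := by
    have hn := List.nodup_reverse.2 (List.nodup_finRange N)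
    rw [h] at hn
    exact chainSites_indep ρ hn.of_append_right
  hc p hp := by
    have hn := List.nodup_reverse.2 (List.nodup_finRange N)
    rw [h] at hn
    have hp' : p ∈ chainSites ρ (s :: l) := hp
    obtain ⟨n, hn', rfl⟩ := List.mem_map.1 hp'
    refine UnitsCommute.mul (triMat_unitsCommute b _) (unitsCommute_laxProd (fun q hq a b c d => ?_) η)
    obtain ⟨m, hm, rfl⟩ := List.mem_map.1 hq
    exact siteEnd_commute (fun h => (List.disjoint_of_nodup_append hn) hm (by rwa [h] at hn')) _ _
  hd p hp := by
    have hp' : p ∈ chainSites ρ (s :: l) := hp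
    obtain ⟨n, hn', rfl⟩ := List.mem_map.1 hp'
    exact Finset.prod_eq_zero (Finset.mem_univ n) (sub_self _)

/-- The monodromy matrix takes the sites in decreasing order, so the sites to the right of `s`,
whose transfer matrices appear in the inverse problem, are those below `s`. -/
theorem exists_split (s : Fin N) : ∃ l r : List (Fin N), (List.finRange N).reverse = r ++ s :: l ∧
    (∀ k, k ∈ l ↔ k < s) ∧ ∀ k, k ∈ r ↔ s < k := by
  obtain ⟨r, l, h⟩ := List.append_of_mem (List.mem_reverse.2 (List.mem_finRange s))
  have hp : (List.finRange N).reverse.Pairwise fun a b => b < a := by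
    rw [List.pairwise_reverse]
    exact List.pairwise_lt_finRange N
  rw [h] at hp
  have hm : ∀ k, k ∈ r ∨ k = s ∨ k ∈ l := fun k => by
    have := List.mem_reverse.2 (List.mem_finRange k)
    rw [h] at this
    simpa using this
  have h1 := List.pairwise_append.1 hp
  have h2 := List.pairwise_cons.1 h1.2.1
  have hl : ∀ k ∈ l, k < s := h2.1
  have hr : ∀ k ∈ r, s < k := fun k hk => h1.2.2 k hk s (by simp)
  refine ⟨l, r, h, fun k => ⟨hl k, fun hk => ?_⟩, fun k => ⟨hr k, fun hk => ?_⟩⟩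
  · rcases hm k with h | h | h
    · exact absurd (hr k h) hk.not_gt
    · exact absurd h hk.ne
    · exact h
  · rcases hm k with h | h | h
    · exact h
    · exact absurd h hk.ne'
    · exact absurd (hl k h) hk.not_gt

end Concrete
end OpenXXX
end

/-! ### Continuity in the inhomogeneities and the bulk formulas. -/

open scoped Matrix
noncomputable section
namespace OpenXXX

section Continuity

variable {N : ℕ} {η b : ℂ}

theorem continuous_laxProd (ρ : ℂ → Fin N → ℂ) (hρ : Continuous ρ) (l : List (Fin N)) (u : ℂ)
    (i j : Fin 2) (v : ℂ → (Fin N → Fin 2) → ℂ) (hv : Continuous v) :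
    Continuous fun t => laxProd η (chainSites (ρ t) l) u i j (v t) := by
  induction l generalizing i with
  | nil =>
    have : (fun t => laxProd η (chainSites (ρ t) []) u i j (v t)) =
        fun t => (if i = j then 1 else 0 : Module.End ℂ ((Fin N → Fin 2) → ℂ)) (v t) := rfl
    rw [this]
    exact (LinearMap.continuous_of_finiteDimensional _).comp hv
  | cons n l ih =>
    have : (fun t => laxProd η (chainSites (ρ t) (n :: l)) u i j (v t)) = fun t =>
        (u - ρ t n) • laxProd η (chainSites (ρ t) l) u i j (v t) + η • ∑ k,
          siteUnit n k i (laxProd η (chainSites (ρ t) l) u k j (v t)) := by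
      funext t
      have e1 : laxProd η (chainSites (ρ t) (n :: l)) =
        (lax η (ρ t n) (siteUnit n)).mul (laxProd η (chainSites (ρ t) l)) := rfl
      rw [e1, lax_mul_apply]
      simp only [LinearMap.add_apply, LinearMap.smul_apply, LinearMap.sum_apply,
        Module.End.mul_apply]
    rw [this]
    have h1 : ∀ k, Continuous fun t =>
        siteUnit n k i (laxProd η (chainSites (ρ t) l) u k j (v t)) := fun k =>
      (LinearMap.continuous_of_finiteDimensional _).comp (ih k)
    have h2 := ih i
    fun_prop

theorem continuous_Φ (ρ : ℂ → Fin N → ℂ) (hρ : Continuous ρ) (I : Finset ℂ) :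
    Continuous fun t => (twistedChain η b (ρ t)).Φ I := by
  unfold HighestWeight.Φ
  generalize I.toList = l
  induction l with
  | nil => exact continuous_const
  | cons x l ih =>
    have : (fun t => ((x :: l).map fun x => (twistedChain η b (ρ t)).T x 0 1).prod
          (twistedChain η b (ρ t)).Ω) = fun t => ∑ k : Fin 2, (if 0 = k then 1 else b : ℂ) •
        laxProd η (chainSites (ρ t) (List.finRange N).reverse) x k 1
          ((l.map fun x => (twistedChain η b (ρ t)).T x 0 1).prod (twistedChain η b (ρ t)).Ω) := by
      funext t
      rw [List.map_cons, List.prod_cons, Module.End.mul_apply]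
      generalize (l.map fun x => (twistedChain η b (ρ t)).T x 0 1).prod _ = v
      have e1 : (twistedChain η b (ρ t)).T = (triMat b).mul
        (laxProd η (chainSites (ρ t) (List.finRange N).reverse)) := rfl
      rw [e1]
      simp [Entries.mul, triMat]
    rw [this]
    have h1 := fun k => continuous_laxProd (η := η) ρ hρ (List.finRange N).reverse x k 1 _ ih
    fun_prop

theorem continuous_a (ρ : ℂ → Fin N → ℂ) (hρ : Continuous ρ) (u : ℂ) :
    Continuous fun t => (twistedChain η b (ρ t)).a u := by
  have : (fun t => (twistedChain η b (ρ t)).a u) = fun t => ∏ n, (u - ρ t n + η) := rfl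
  rw [this]
  fun_prop

theorem continuous_exState (ρ : ℂ → Fin N → ℂ) (hρ : Continuous ρ) (g : ℂ → ℂ) (K Z : Finset ℂ) :
    Continuous fun t => (twistedChain η b (ρ t)).exState g K Z := by
  unfold HighestWeight.exState
  have h1 := fun z => continuous_a (η := η) (b := b) ρ hρ z
  have h2 := fun I => continuous_Φ (η := η) (b := b) ρ hρ I
  fun_prop

end Continuity

section Bulk

variable {N : ℕ} {η b : ℂ}

/-- The condition `d z ≠ 0` of `bulk_of_bethe` can fail only because of sites beyond `s`. Shifting
their inhomogeneities by `t` restores it outside a finite set of `t`, and continuity of both sides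
gives the formula at `t = 0`. -/
theorem twistedChain_bulk (hη : η ≠ 0) (ρ : Fin N → ℂ) (s : Fin N) {Λ K : Finset ℂ}
    (hinj : ∀ j ≤ s, ∀ k ≤ s, ρ j = ρ k → j = k) (hK : ∀ y, y ∈ K ↔ ∃ k < s, ρ k = y)
    (hg : GenericPoints η Λ (ρ s) K) (i j : Fin 2) {ι : Type} (S : Finset ι)
    (D : ι → Finset ℂ) (hD : ∀ i ∈ S, D i ⊆ insert (ρ s) Λ) (k : ι → ℂ)
    (hB : ∀ (V : Type) [AddCommGroup V] [Module ℂ V] (C : SpinChain η V),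
      ((C.s :: C.l).map Prod.fst).Nodup → C.s.1 = ρ s → C.K = K → C.Bethe Λ →
        C.BulkFormula Λ (ρ s) K (C.s.2 j i) S D k) :
    (twistedChain η b ρ).BulkFormula Λ (ρ s) K (siteUnit s j i) S D k := by
  obtain ⟨l, r, h, hl, hr⟩ := exists_split s
  -- The sites up to `s` stay fixed, so neither the points nor the coefficients `k` move with `t`.
  set ρt : ℂ → Fin N → ℂ := fun t k => ρ k + if s < k then t else 0 with hρt
  have hcont : Continuous ρt := continuous_pi fun k => by
    simp only [hρt]
    split_ifs <;> fun_prop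
  have hle : ∀ t, ∀ k ≤ s, ρt t k = ρ k := fun t k hk => by
    simp [hρt, hk.not_gt]
  have hls : ∀ n ∈ s :: l, n ≤ s := fun n hn => by
    rcases List.mem_cons.1 hn with rfl | hn
    exacts [le_rfl, ((hl n).1 hn).le]
  have hmap : ∀ t, (chainSites (ρt t) (s :: l)).map Prod.fst = (s :: l).map ρ := fun t => by
    rw [chainSites, List.map_map]
    exact List.map_congr_left fun n hn => hle t n (hls n hn)
  have hnd : (s :: l).Nodup := by
    have hn := List.nodup_reverse.2 (List.nodup_finRange N)
    rw [h] at hn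
    exact hn.of_append_right
  have hnodup : ((s :: l).map ρ).Nodup := List.Nodup.map_on
    (fun x hx y hy => hinj x (hls x hx) y (hls y hy)) hnd
  have hgen : ∀ t, (∀ z ∈ Λ, (twistedChain η b (ρt t)).d z ≠ 0) →
      (twistedChain η b (ρt t)).BulkFormula Λ (ρ s) K (siteUnit s j i) S D k := by
    intro t ht
    refine SpinChain.bulk_of_bethe hη hg i j S D hD k (xs := (s :: l).map ρ)
      (fun V _ _ C h1 => hB V C (h1 ▸ hnodup)) (distinguishedChain η b (ρt t) s l r h) (hmap t)
      (hle t s le_rfl) ?_ ht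
    ext y
    have e1 : (distinguishedChain η b (ρt t) s l r h).l.map Prod.fst = l.map ρ := by
      have := hmap t
      simp only [chainSites, List.map_cons, List.cons.injEq] at this
      exact this.2
    rw [SpinChain.K, e1, List.mem_toFinset, hK, List.mem_map]
    exact exists_congr fun k => and_congr_left fun _ => hl k
  have hfin : (⋃ z ∈ Λ, ⋃ n : Fin N, ({z - ρ n} : Set ℂ)).Finite :=
    Λ.finite_toSet.biUnion fun z _ => Set.finite_iUnion fun n => Set.finite_singleton _
  have hdense : Dense (⋃ z ∈ Λ, ⋃ n : Fin N, ({z - ρ n} : Set ℂ))ᶜ := hfin.countable.dense_compl ℝ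
  have hd : ∀ t ∈ (⋃ z ∈ Λ, ⋃ n : Fin N, ({z - ρ n} : Set ℂ))ᶜ, ∀ z ∈ Λ,
      (twistedChain η b (ρt t)).d z ≠ 0 := by
    intro t ht z hz
    change ∏ n, (z - ρt t n) ≠ 0
    refine Finset.prod_ne_zero_iff.2 fun n _ => ?_
    by_cases hn : s < n
    · intro h0
      refine ht ?_
      simp only [Set.mem_iUnion, Set.mem_singleton_iff]
      refine ⟨z, hz, n, ?_⟩
      simp only [hρt, hn, if_true] at h0
      linear_combination -h0
    · rw [hle t n (not_lt.1 hn)]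
      intro h0
      have h1 : z = ρ n := by linear_combination h0
      rcases (not_lt.1 hn).eq_or_lt with h2 | h2
      · exact hg.x_notMem (by rw [← h2, ← h1]; exact hz)
      · exact Finset.disjoint_left.1 hg.disj hz ((hK z).2 ⟨n, h2, h1.symm⟩)
  have h0 : ρt 0 = ρ := by
    funext k
    simp [hρt]
  rw [← h0]
  have h1 := fun z => continuous_a (η := η) (b := b) ρt hcont z
  have key : (fun t => ((∏ y ∈ insert (ρ s) K, (twistedChain η b (ρt t)).a y) *
        ∏ y ∈ insert (ρ s) K, ∏ z ∈ Λ, ff η z y) •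
          siteUnit s j i ((twistedChain η b (ρt t)).Φ Λ)) = fun t =>
      ∑ i ∈ S, ((∏ z ∈ D i, (twistedChain η b (ρt t)).a z) * k i) •
        (twistedChain η b (ρt t)).exState (betheRatio η Λ) K (insert (ρ s) Λ \ D i) := by
    refine Continuous.ext_on hdense ?_ ?_ fun t ht => hgen t (hd t ht)
    · have h2 : Continuous fun t => siteUnit s j i ((twistedChain η b (ρt t)).Φ Λ) :=
        (LinearMap.continuous_of_finiteDimensional _).comp (continuous_Φ ρt hcont Λ)
      fun_prop
    · have h2 := fun Z =>
        continuous_exState (η := η) (b := b) ρt hcont (betheRatio η Λ) K Z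
      fun_prop
  rw [h0]
  have := congrFun key 0
  rw [h0] at this
  exact this

variable (hη : η ≠ 0) (ρ : Fin N → ℂ) (s : Fin N) {Λ K : Finset ℂ}
    (hinj : ∀ j ≤ s, ∀ k ≤ s, ρ j = ρ k → j = k) (hK : ∀ y, y ∈ K ↔ ∃ k < s, ρ k = y)
    (hg : GenericPoints η Λ (ρ s) K)

include hη hinj hK hg

theorem bulk_minus : (twistedChain η b ρ).BulkFormula Λ (ρ s) K (siteUnit s 1 0) {()}
    (fun _ => ∅) fun _ => 1 := by
  refine twistedChain_bulk hη ρ s hinj hK hg 0 1 _ _ (fun i _ => Finset.empty_subset _) _ ?_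
  intro V _ _ C h1 h2 h3 h4
  rw [← h2, ← h3] at hg ⊢
  exact SpinChain.bulk_minus_bethe hη h1 hg h4

theorem bulk_E22 : (twistedChain η b ρ).BulkFormula Λ (ρ s) K (siteUnit s 1 1) Λ
    (fun b => {b}) (SpinChain.removeD η Λ (ρ s)) := by
  refine twistedChain_bulk hη ρ s hinj hK hg 1 1 _ _ (fun i hi => by simp [hi]) _ ?_
  intro V _ _ C h1 h2 h3 h4
  rw [← h2, ← h3] at hg ⊢
  exact SpinChain.bulk_E22_bethe hη h1 hg h4

theorem bulk_plus : (twistedChain η b ρ).BulkFormula Λ (ρ s) K (siteUnit s 0 1)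
    (Λ.sigma fun b => (insert (ρ s) Λ).erase b) (fun i => {i.1, i.2})
    (fun i => SpinChain.removeC η Λ (ρ s) i.1 i.2) := by
  refine twistedChain_bulk hη ρ s hinj hK hg 1 0 _ _ (fun i hi => ?_) _ ?_
  · rw [Finset.mem_sigma] at hi
    refine Finset.insert_subset (by simp [hi.1]) (Finset.singleton_subset_iff.2 ?_)
    exact Finset.mem_of_mem_erase hi.2
  intro V _ _ C h1 h2 h3 h4
  rw [← h2, ← h3] at hg ⊢
  exact SpinChain.bulk_plus_bethe hη h1 hg h4

end Bulk
end OpenXXX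
end

/-! ### The boundary operator in terms of the twisted bulk chain. -/

open scoped Matrix
noncomputable section
namespace OpenXXX

namespace Chain

variable {N : ℕ} (P : Chain N)

/-- The twisted bulk chain with the parameters of `P`. -/
def bulk : HighestWeight P.η ((Fin N → Fin 2) → ℂ) := twistedChain P.η (P.b / 2) P.ξ0

theorem bulk_a (u : ℂ) : P.bulk.a u = P.a u := by
  change ∏ n, (u - P.ξ0 n + P.η) = ∏ n, (u - P.ξ n + P.η / 2)
  refine Finset.prod_congr rfl fun n _ => ?_
  simp only [ξ0]; ring

theorem bulk_d (u : ℂ) : P.bulk.d u = P.d u := by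
  change ∏ n, (u - P.ξ0 n) = ∏ n, (u - P.ξ n - P.η / 2)
  refine Finset.prod_congr rfl fun n _ => ?_
  simp only [ξ0]; ring

theorem d_ξ0 (k : Fin N) : P.d (P.ξ0 k) = 0 :=
  Finset.prod_eq_zero (Finset.mem_univ k) (by simp only [ξ0]; ring)

theorem R0_apply (n : Fin N) (u : ℂ) (i j : Fin 2) :
    Matrix.toLin' (P.R0 n (u - P.ξ n - P.η / 2) i j) = lax P.η (P.ξ0 n) (siteUnit n) u i j := by
  refine LinearMap.ext fun v => ?_
  have h : (Matrix.of fun s t => P.R6v (u - P.ξ n - P.η / 2) (i, s) (j, t)) =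
      (u - P.ξ0 n) • (if i = j then 1 else 0 : Matrix (Fin 2) (Fin 2) ℂ) +
        P.η • Matrix.single j i 1 := by
    ext s t
    fin_cases i <;> fin_cases j <;> fin_cases s <;> fin_cases t <;>
      simp [R6v, ξ0, sub_sub]
  have h' : P.R0 n (u - P.ξ n - P.η / 2) i j =
    siteOp n (Matrix.of fun s t => P.R6v (u - P.ξ n - P.η / 2) (i, s) (j, t)) := rfl
  rw [Matrix.toLin'_apply, h', siteOp_mulVec, h, lax, siteUnit, siteEnd_add, siteEnd_smul,
    siteEnd_smul]
  congr 3
  split_ifs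
  · rw [siteEnd_one]
  · refine LinearMap.ext fun v => funext fun c => ?_
    simp [siteEnd_apply]

theorem monodromy_apply (u : ℂ) (i j : Fin 2) : Matrix.toLin' (P.monodromy u i j) =
    laxProd P.η (chainSites P.ξ0 (List.finRange N).reverse) u i j := by
  unfold monodromy
  generalize (List.finRange N).reverse = l
  induction l generalizing i with
  | nil =>
    simp only [List.map_nil, List.prod_nil, chainSites, laxProd, Entries.one, Matrix.one_apply]
    split_ifs <;> simp
    rfl
  | cons n l ih =>
    have e1 : laxProd P.η (chainSites P.ξ0 (n :: l)) =
      (lax P.η (P.ξ0 n) (siteUnit n)).mul (laxProd P.η (chainSites P.ξ0 l)) := rfl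
    rw [List.map_cons, List.prod_cons, Matrix.mul_apply, e1, Entries.mul, map_sum]
    refine Finset.sum_congr rfl fun k _ => ?_
    rw [← ih, ← R0_apply, Matrix.toLin'_mul]
    rfl

/-- The coefficients of the expansion of `B̄₊(λ)` over `B(ελ) D(-ελ)`. -/
def bcoef (ε : ℤˣ) (lam : ℂ) : ℂ := (-1 : ℂ) ^ N / P.ζ * ((2 * lam + P.η) / (2 * lam)) *
  (lam + ((ε : ℤ) : ℂ) * (P.ζ - P.η / 2))

/-- The off-diagonal element of `K̄₊` is `b / 2` times the difference of the diagonal ones. This is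
exactly what the twist by `b / 2` in both entries `0 1` produces, so only the diagonal of `K̄₊`
remains visible. -/
theorem Bplus_apply (lam : ℂ) (v : (Fin N → Fin 2) → ℂ) : P.Bplus lam *ᵥ v =
    (-1 : ℂ) ^ N • ((P.Kplus lam 0 0) • P.bulk.T lam 0 1 (P.bulk.T (-lam) 1 1 v) -
      (P.Kplus lam 1 1) • P.bulk.T lam 1 1 (P.bulk.T (-lam) 0 1 v)) := by
  have hM : ∀ u i j w, P.monodromy u i j *ᵥ w =
      laxProd P.η (chainSites P.ξ0 (List.finRange N).reverse) u i j w := fun u i j w => by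
    rw [← monodromy_apply, Matrix.toLin'_apply]
  have h01 : ∀ u w, P.bulk.T u 0 1 w = P.monodromy u 0 1 *ᵥ w +
      (P.b / 2) • (P.monodromy u 1 1 *ᵥ w) := fun u w => by
    simp [bulk, twistedChain, Entries.mul, triMat, hM]
  have h11 : ∀ u w, P.bulk.T u 1 1 w = P.monodromy u 1 1 *ᵥ w := fun u w => by
    simp [bulk, twistedChain, Entries.mul, triMat, hM]
  have hB : P.Bplus lam = (-1 : ℂ) ^ N • (P.Kplus lam 0 0 • (P.monodromy lam 0 1 *
      P.monodromy (-lam) 1 1) + P.Kplus lam 0 1 • (P.monodromy lam 1 1 * P.monodromy (-lam) 1 1) -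
      P.Kplus lam 1 1 • (P.monodromy lam 1 1 * P.monodromy (-lam) 0 1)) := by
    have hK : P.Kplus lam 1 0 = 0 := by simp [Kplus]
    simp only [Bplus, UplusT, monodromyHat, aux, Matrix.mul_apply, Fin.sum_univ_two,
      Matrix.transpose_apply, Matrix.map_apply, hK]
    simp [Algebra.algebraMap_eq_smul_one, smul_smul]
    have hI : Complex.I * ((-1) ^ N * Complex.I) = -(-1) ^ N := by
      linear_combination (-1) ^ N * Complex.I_mul_I
    rw [hI, add_mul, smul_mul_assoc, smul_mul_assoc]
    module
  have hK : P.Kplus lam 0 1 = P.b / 2 * (P.Kplus lam 0 0 - P.Kplus lam 1 1) := by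
    simp [Kplus]; ring
  simp only [hB, h01, h11, Matrix.smul_mulVec, Matrix.sub_mulVec, Matrix.add_mulVec,
    ← Matrix.mulVec_mulVec, Matrix.mulVec_add, Matrix.mulVec_smul, hK]
  module

/-- Moving `D(λ)` to the right of `B(-λ)` yields `B(-λ) D(λ)` and an exchange term proportional to
`B(λ) D(-λ)`, which joins the term already of this form. -/
theorem Bplus_expand {lam : ℂ} (hζ : P.ζ ≠ 0) (h : lam ≠ 0) (v : (Fin N → Fin 2) → ℂ) :
    P.Bplus lam *ᵥ v = ∑ ε : ℤˣ, P.bcoef ε lam •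
      P.bulk.T (((ε : ℤ) : ℂ) * lam) 0 1 (P.bulk.T (-(((ε : ℤ) : ℂ) * lam)) 1 1 v) := by
  have hne : lam ≠ -lam := fun h' => h (by linear_combination h' / 2)
  rw [Bplus_apply, P.bulk.D_B lam (-lam) hne]
  have hs : ∀ F : ℤˣ → ((Fin N → Fin 2) → ℂ), ∑ ε : ℤˣ, F ε = F 1 + F (-1) := fun F => by
    rw [show (Finset.univ : Finset ℤˣ) = {1, -1} from rfl, Finset.sum_pair (by decide)]
  rw [hs]
  have h2 : lam - -lam ≠ 0 := sub_ne_zero.2 hne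
  have h3 : -lam - lam ≠ 0 := sub_ne_zero.2 hne.symm
  simp only [bcoef, Kplus, ff]
  simp
  match_scalars
  · field_simp
    ring
  · field_simp
    ring

end Chain
end OpenXXX
end

/-! ### The coefficients `H` and sums over signs. -/

open scoped Matrix
noncomputable section
namespace OpenXXX

namespace Chain

variable {N : ℕ} (P : Chain N)

section Cross

variable {ι : Type} [LinearOrder ι]

/-- By symmetry of `g` the order within a pair is immaterial, so an element may be split off
wherever it stands in the ordering. -/
theorem prod_lt_insert {A : Finset ι} {i : ι} (hi : i ∉ A) (g : ι → ι → ℂ)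
    (hg : ∀ i j, g i j = g j i) :
    ∏ k ∈ insert i A, ∏ j ∈ insert i A with k < j, g k j =
      (∏ j ∈ A, g i j) * ∏ k ∈ A, ∏ j ∈ A with k < j, g k j := by
  simp only [Finset.prod_filter]
  rw [Finset.prod_insert hi, Finset.prod_insert hi, if_neg (lt_irrefl i), one_mul]
  have : ∀ k ∈ A, (∏ j ∈ insert i A, if k < j then g k j else 1) =
      (if k < i then g i k else 1) * ∏ j ∈ A, if k < j then g k j else 1 := fun k _ => by
    rw [Finset.prod_insert hi, hg]
  rw [Finset.prod_congr rfl this, Finset.prod_mul_distrib, ← mul_assoc, ← Finset.prod_mul_distrib]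
  congr 1
  refine Finset.prod_congr rfl fun k hk => ?_
  rcases lt_trichotomy i k with h | h | h
  · simp [h, h.not_gt]
  · exact absurd hk (h ▸ hi)
  · simp [h, h.not_gt]

/-- The factor of `H` attached to two signed variables. -/
def cross (x y : ℂ) : ℂ := (x + y - P.η) / (x + y)

theorem cross_comm (x y : ℂ) : P.cross x y = P.cross y x := by
  rw [cross, cross, add_comm]

theorem cross_eq_ff (x y : ℂ) : P.cross x y = ff P.η (-x) y := by
  rw [cross, ff, ← neg_div_neg_eq]
  congr 1 <;> ring

/-- The factor of `H` attached to a single variable. -/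
def hfac (ε : ℤˣ) (lam : ℂ) : ℂ := P.bcoef ε lam * P.d (-(((ε : ℤ) : ℂ) * lam))

theorem H_eq (S : Finset ι) (σ : ι → ℤˣ) (lam : ι → ℂ) : P.H S σ lam =
    (∏ j ∈ S, P.hfac (σ j) (lam j)) * ∏ i ∈ S, ∏ j ∈ S with i < j,
      P.cross (((σ i : ℤ) : ℂ) * lam i) (((σ j : ℤ) : ℂ) * lam j) := by
  rw [H]
  congr 1
  · refine Finset.prod_congr rfl fun j _ => ?_
    rw [hfac, bcoef]; ring
  · refine Finset.prod_congr rfl fun i _ => Finset.prod_congr rfl fun j _ => ?_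
    rw [cross_comm, cross]

theorem H_insert {S : Finset ι} {i : ι} (hi : i ∉ S) (σ : ι → ℤˣ) (lam : ι → ℂ) :
    P.H (insert i S) σ lam = P.hfac (σ i) (lam i) * (∏ j ∈ S,
      P.cross (((σ i : ℤ) : ℂ) * lam i) (((σ j : ℤ) : ℂ) * lam j)) * P.H S σ lam := by
  rw [H_eq, H_eq, Finset.prod_insert hi, prod_lt_insert hi
    (fun i j => P.cross (((σ i : ℤ) : ℂ) * lam i) (((σ j : ℤ) : ℂ) * lam j))
    fun _ _ => P.cross_comm _ _]
  ring

theorem H_empty (σ : ι → ℤˣ) (lam : ι → ℂ) : P.H ∅ σ lam = 1 := by simp [H]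

theorem H_congr {S : Finset ι} {σ σ' : ι → ℤˣ} (h : ∀ i ∈ S, σ i = σ' i) (lam : ι → ℂ) :
    P.H S σ lam = P.H S σ' lam := by
  simp only [H_eq]
  congr 1
  · exact Finset.prod_congr rfl fun j hj => by rw [h j hj]
  · refine Finset.prod_congr rfl fun i hi => Finset.prod_congr rfl fun j hj => ?_
    rw [h i hi, h j (Finset.mem_of_mem_filter j hj)]

end Cross

theorem sum_units {V : Type} [AddCommMonoid V] (F : ℤˣ → V) : ∑ ε : ℤˣ, F ε = F 1 + F (-1) := by
  rw [show (Finset.univ : Finset ℤˣ) = {1, -1} from rfl, Finset.sum_pair (by decide)]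

section Signs

variable {M : ℕ}

theorem mem_signs {A : Finset (Fin (M + 1))} {σ : Fin (M + 1) → ℤˣ} :
    σ ∈ signs A ↔ ∀ i, i ∉ A → σ i = 1 := by
  rw [signs, Fintype.mem_piFinset]
  refine forall_congr' fun i => ?_
  by_cases h : i ∈ A
  · simpa [h] using Int.units_eq_one_or (σ i)
  · simp [h]

theorem sum_signs_insert {V : Type} [AddCommMonoid V] {A : Finset (Fin (M + 1))}
    {i : Fin (M + 1)} (hi : i ∉ A) (F : (Fin (M + 1) → ℤˣ) → V) :
    ∑ σ ∈ signs (insert i A), F σ = ∑ σ ∈ signs A, ∑ ε : ℤˣ, F (Function.update σ i ε) := by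
  rw [← Finset.sum_product']
  symm
  refine Finset.sum_bij' (fun p _ => Function.update p.1 i p.2)
    (fun σ _ => (Function.update σ i 1, σ i)) ?_ ?_ ?_ ?_ ?_
  · rintro ⟨σ, ε⟩ h
    simp only [Finset.mem_product, Finset.mem_univ, and_true, mem_signs] at h ⊢
    intro j hj
    have hji : j ≠ i := fun h => hj (by simp [h])
    rw [Function.update_of_ne hji]
    exact h j fun h => hj (by simp [h])
  · intro σ h
    simp only [Finset.mem_product, Finset.mem_univ, and_true, mem_signs] at h ⊢
    intro j hj
    by_cases hji : j = i
    · rw [hji, Function.update_self]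
    · rw [Function.update_of_ne hji]
      exact h j (by simp [hji, hj])
  · rintro ⟨σ, ε⟩ h
    simp only [Finset.mem_product, Finset.mem_univ, and_true, mem_signs] at h
    simp [← h i hi]
  · intro σ _
    simp
  · intro _ _; rfl

theorem signed_update_of_ne {σ : Fin (M + 1) → ℤˣ} {i j : Fin (M + 1)} (h : j ≠ i) (ε : ℤˣ)
    (ν : Fin (M + 1) → ℂ) : signed (Function.update σ i ε) ν j = signed σ ν j := by
  rw [signed, signed, Function.update_of_ne h]

theorem signed_update_self (σ : Fin (M + 1) → ℤˣ) (i : Fin (M + 1)) (ε : ℤˣ)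
    (ν : Fin (M + 1) → ℂ) : signed (Function.update σ i ε) ν i = ((ε : ℤ) : ℂ) * ν i := by
  rw [signed, Function.update_self]

theorem image_signed_update {A : Finset (Fin (M + 1))} {σ : Fin (M + 1) → ℤˣ} {i : Fin (M + 1)}
    (h : i ∉ A) (ε : ℤˣ) (ν : Fin (M + 1) → ℂ) :
    A.image (signed (Function.update σ i ε) ν) = A.image (signed σ ν) :=
  Finset.image_congr fun _ hj => signed_update_of_ne (fun h' => h (by rwa [← h'])) ε ν

/-- The variables are nonzero, as are their pairwise sums and differences. -/
def SignGeneric (A : Finset (Fin (M + 1))) (ν : Fin (M + 1) → ℂ) : Prop :=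
  (∀ i ∈ A, ν i ≠ 0) ∧
    ∀ i ∈ A, ∀ j ∈ A, i ≠ j → ∀ ε δ : ℤˣ, ((ε : ℤ) : ℂ) * ν i + ((δ : ℤ) : ℂ) * ν j ≠ 0

theorem SignGeneric.mono {A B : Finset (Fin (M + 1))} {ν : Fin (M + 1) → ℂ}
    (h : SignGeneric A ν) (hB : B ⊆ A) : SignGeneric B ν :=
  ⟨fun i hi => h.1 i (hB hi), fun i hi j hj => h.2 i (hB hi) j (hB hj)⟩

theorem SignGeneric.injOn {A : Finset (Fin (M + 1))} {ν : Fin (M + 1) → ℂ}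
    (h : SignGeneric A ν) (σ : Fin (M + 1) → ℤˣ) : Set.InjOn (signed σ ν) A := by
  intro i hi j hj hij
  by_contra hne
  refine h.2 i hi j hj hne (σ i) (-σ j) ?_
  simp only [signed] at hij
  push_cast [hij]
  ring

/-- The coefficient of the boundary-bulk decomposition in the presence of the parameters `Γ`. -/
def dcoef (A : Finset (Fin (M + 1))) (Γ : Finset ℂ) (σ : Fin (M + 1) → ℤˣ)
    (ν : Fin (M + 1) → ℂ) : ℂ :=
  P.H A σ ν * ∏ i ∈ A, ∏ y ∈ Γ, P.cross (signed σ ν i) y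

theorem dcoef_insert {A : Finset (Fin (M + 1))} {Γ : Finset ℂ} {i : Fin (M + 1)} (hi : i ∉ A)
    (σ : Fin (M + 1) → ℤˣ) (ε : ℤˣ) (ν : Fin (M + 1) → ℂ) :
    P.dcoef (insert i A) Γ (Function.update σ i ε) ν = P.hfac ε (ν i) *
      ((∏ j ∈ A, P.cross (((ε : ℤ) : ℂ) * ν i) (signed σ ν j)) *
        ∏ y ∈ Γ, P.cross (((ε : ℤ) : ℂ) * ν i) y) * P.dcoef A Γ σ ν := by
  have hne : ∀ j ∈ A, j ≠ i := fun j hj h => hi (h ▸ hj)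
  rw [dcoef, H_insert P hi, Finset.prod_insert hi, signed_update_self, Function.update_self,
    H_congr P (σ := Function.update σ i ε) (σ' := σ)
      (fun j hj => by rw [Function.update_of_ne (hne j hj)])]
  have e1 : ∏ j ∈ A, P.cross (((ε : ℤ) : ℂ) * ν i)
      (((Function.update σ i ε j : ℤ) : ℂ) * ν j) =
      ∏ j ∈ A, P.cross (((ε : ℤ) : ℂ) * ν i) (signed σ ν j) :=
    Finset.prod_congr rfl fun j hj => by rw [Function.update_of_ne (hne j hj), signed]
  have e2 : ∏ j ∈ A, ∏ y ∈ Γ, P.cross (signed (Function.update σ i ε) ν j) y =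
      ∏ j ∈ A, ∏ y ∈ Γ, P.cross (signed σ ν j) y :=
    Finset.prod_congr rfl fun j hj => by rw [signed_update_of_ne (hne j hj)]
  rw [e1, e2, dcoef]
  ring

/-- Up to common factors the terms are `ε δ (ε x + c) (δ y + c) / (ε x + δ y)` with `c = ζ - η / 2`.
The terms of `(ε, δ)` and `(-ε, -δ)` add up to `2 c ε δ`, and the two such pairs cancel. -/
theorem bcoef_cancel {x y : ℂ} (h : ∀ ε δ : ℤˣ, ((ε : ℤ) : ℂ) * x + ((δ : ℤ) : ℂ) * y ≠ 0) :
    ∑ ε : ℤˣ, ∑ δ : ℤˣ, P.bcoef ε x * P.bcoef δ y /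
      (((ε : ℤ) : ℂ) * x + ((δ : ℤ) : ℂ) * y) = 0 := by
  have h1 := h 1 1
  have h2 := h 1 (-1)
  have h3 := h (-1) 1
  have h4 := h (-1) (-1)
  simp only [sum_units, bcoef]
  push_cast at *
  simp only [one_mul, neg_one_mul] at *
  rw [show -x + -y = -(x + y) by ring, show -x + y = -(x + -y) by ring]
  field_simp
  ring

end Signs

end Chain
end OpenXXX
end

/-! ### The boundary-bulk decomposition. -/

open scoped Matrix
noncomputable section
namespace OpenXXX

/-- In the exchange terms the pair `x`, `-x` takes the place of `p`. Such a vector does not see the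
sign of `x`, which makes the later cancellation possible. -/
theorem HighestWeight.BD_Φ {η : ℂ} (hη : η ≠ 0) {V : Type} [AddCommGroup V] [Module ℂ V]
    (Y : HighestWeight η V) {x : ℂ} (hx : x ≠ 0) {I : Finset ℂ} (h1 : x ∉ I) (h2 : -x ∉ I) :
    Y.T x 0 1 (Y.T (-x) 1 1 (Y.Φ I)) = (Y.d (-x) * ∏ y ∈ I, ff η (-x) y) • Y.Φ (insert x I) +
      ∑ p ∈ I, (η / (x + p) * (Y.d p * ∏ y ∈ I.erase p, ff η p y)) •
        Y.Φ (insert x (insert (-x) (I.erase p))) := by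
  rw [Y.D_Φ hη h2, map_add, map_smul, ← Y.Φ_insert hη h1, map_sum]
  congr 1
  refine Finset.sum_congr rfl fun p _ => ?_
  have h3 : x ∉ insert (-x) (I.erase p) := by
    rw [Finset.mem_insert]
    rintro (h | h)
    · exact hx (by linear_combination h / 2)
    · exact h1 (Finset.mem_of_mem_erase h)
  rw [map_smul, ← Y.Φ_insert hη h3]
  congr 2
  rw [← neg_div_neg_eq]
  congr 1 <;> ring

namespace Chain

variable {N M : ℕ} (P : Chain N)

theorem prod_cross_union {A : Finset (Fin (M + 1))} {Γ : Finset ℂ} {σ : Fin (M + 1) → ℤˣ}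
    {ν : Fin (M + 1) → ℂ} (hinj : Set.InjOn (signed σ ν) A) (hd : ∀ i ∈ A, signed σ ν i ∉ Γ)
    (x : ℂ) : (∏ j ∈ A, P.cross x (signed σ ν j)) * ∏ y ∈ Γ, P.cross x y =
      ∏ y ∈ Γ ∪ A.image (signed σ ν), ff P.η (-x) y := by
  rw [Finset.prod_union, Finset.prod_image hinj, mul_comm]
  · simp only [cross_eq_ff]
  · refine Finset.disjoint_right.2 fun y hy => ?_
    obtain ⟨i, hi, rfl⟩ := Finset.mem_image.1 hy
    exact hd i hi

theorem unit_sq_eq (ε : ℤˣ) (x : ℂ) : ((ε : ℤ) : ℂ) * x = x ∨ ((ε : ℤ) : ℂ) * x = -x := by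
  rcases Int.units_eq_one_or ε with rfl | rfl
  · left; simp
  · right; simp

theorem even_of_units {V : Type} (F : ℂ → V) (hF : ∀ x, F (-x) = F x) (ε : ℤˣ) (x : ℂ) :
    F (((ε : ℤ) : ℂ) * x) = F x := by
  rcases unit_sq_eq ε x with h | h
  · rw [h]
  · rw [h, hF]

/-- The off-diagonal terms of the action of `B̄₊` cancel. -/
theorem offdiag_cancel {A : Finset (Fin (M + 1))} {Γ : Finset ℂ} {ν : Fin (M + 1) → ℂ}
    {i j : Fin (M + 1)} (hj : j ∉ A) (hij : i ≠ j)
    (hg : SignGeneric (insert i (insert j A)) ν)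
    (hνΓ : ∀ k ∈ insert i (insert j A), ∀ ε : ℤˣ, ((ε : ℤ) : ℂ) * ν k ∉ Γ) :
    ∑ σ ∈ signs (insert j A), ∑ ε : ℤˣ, (P.dcoef (insert j A) Γ σ ν * P.bcoef ε (ν i) *
        (P.η / (((ε : ℤ) : ℂ) * ν i + signed σ ν j) * (P.d (signed σ ν j) *
          ∏ y ∈ (Γ ∪ (insert j A).image (signed σ ν)).erase (signed σ ν j),
            ff P.η (signed σ ν j) y))) •
        P.bulk.Φ (insert (((ε : ℤ) : ℂ) * ν i) (insert (-(((ε : ℤ) : ℂ) * ν i))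
          ((Γ ∪ (insert j A).image (signed σ ν)).erase (signed σ ν j)))) = 0 := by
  rw [sum_signs_insert hj]
  refine Finset.sum_eq_zero fun σ _ => ?_
  have hjA : insert j A ⊆ insert i (insert j A) := Finset.subset_insert _ _
  have hA : A ⊆ insert i (insert j A) := (Finset.subset_insert _ _).trans hjA
  set J := Γ ∪ A.image (signed σ ν) with hJ
  have herase : ∀ δ : ℤˣ, (Γ ∪ (insert j A).image (signed (Function.update σ j δ) ν)).erase
      (((δ : ℤ) : ℂ) * ν j) = J := by
    intro δ
    rw [Finset.image_insert, image_signed_update hj, signed_update_self, Finset.union_insert,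
      Finset.erase_insert]
    rw [Finset.mem_union, not_or]
    refine ⟨hνΓ j (by simp) δ, fun h => ?_⟩
    obtain ⟨k, hk, hk'⟩ := Finset.mem_image.1 h
    refine hg.2 k (hA hk) j (by simp) (fun h => hj (h ▸ hk)) (σ k) (-δ) ?_
    rw [signed] at hk'
    push_cast [hk']
    ring
  -- The factors of the variable `j` collect in the even function `F`, and the vector `G` is even in
  -- the variable `i`. The two signs survive only in the summand of `bcoef_cancel`.
  set F : ℂ → ℂ := fun x => P.d (-x) * P.d x * ∏ y ∈ J, (ff P.η (-x) y * ff P.η x y) with hF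
  have hFe : ∀ x, F (-x) = F x := fun x => by
    simp only [hF, neg_neg, mul_comm]
  set G : ℂ → (Fin N → Fin 2) → ℂ := fun x => P.bulk.Φ (insert x (insert (-x) J)) with hG
  have hGe : ∀ x, G (-x) = G x := fun x => by
    simp only [hG, neg_neg]
    rw [Finset.insert_comm]
  have hterm : ∀ δ ε : ℤˣ, (P.dcoef (insert j A) Γ (Function.update σ j δ) ν * P.bcoef ε (ν i) *
        (P.η / (((ε : ℤ) : ℂ) * ν i + signed (Function.update σ j δ) ν j) *
          (P.d (signed (Function.update σ j δ) ν j) *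
          ∏ y ∈ (Γ ∪ (insert j A).image (signed (Function.update σ j δ) ν)).erase
            (signed (Function.update σ j δ) ν j),
            ff P.η (signed (Function.update σ j δ) ν j) y))) •
        P.bulk.Φ (insert (((ε : ℤ) : ℂ) * ν i) (insert (-(((ε : ℤ) : ℂ) * ν i))
          ((Γ ∪ (insert j A).image (signed (Function.update σ j δ) ν)).erase
            (signed (Function.update σ j δ) ν j)))) =
      (P.η * P.dcoef A Γ σ ν * F (ν j) * (P.bcoef ε (ν i) * P.bcoef δ (ν j) /
        (((ε : ℤ) : ℂ) * ν i + ((δ : ℤ) : ℂ) * ν j))) • G (ν i) := by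
    intro δ ε
    rw [dcoef_insert P hj, prod_cross_union P ((hg.mono hA).injOn σ)
      (fun k hk => hνΓ k (hA hk) (σ k)), signed_update_self, herase, ← hJ,
      ← even_of_units F hFe δ, ← even_of_units G hGe ε, hfac]
    congr 1
    simp only [hF, Finset.prod_mul_distrib]
    ring
  simp only [hterm, ← Finset.sum_smul, ← Finset.mul_sum]
  rw [Finset.sum_comm, bcoef_cancel P (hg.2 i (by simp) j (by simp) hij), mul_zero, zero_smul]

/-- The boundary-bulk decomposition. -/
theorem boundary_decomposition (hη : P.η ≠ 0) (hζ : P.ζ ≠ 0) {Γ : Finset ℂ}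
    {ν : Fin (M + 1) → ℂ} (hΓ : ∀ y ∈ Γ, P.d y = 0) (l : List (Fin (M + 1))) (hl : l.Nodup)
    (hg : SignGeneric l.toFinset ν) (hνΓ : ∀ i ∈ l, ∀ ε : ℤˣ, ((ε : ℤ) : ℂ) * ν i ∉ Γ) :
    (l.map fun i => P.Bplus (ν i)).prod *ᵥ P.bulk.Φ Γ = ∑ σ ∈ signs l.toFinset,
      P.dcoef l.toFinset Γ σ ν • P.bulk.Φ (Γ ∪ l.toFinset.image (signed σ ν)) := by
  induction l with
  | nil =>
    have : signs (∅ : Finset (Fin (M + 1))) = {1} := by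
      ext σ
      simp [mem_signs, funext_iff]
    simp [this, dcoef, H_empty]
  | cons i l ih =>
    have hl' := List.nodup_cons.1 hl
    have hi : i ∉ l.toFinset := by simpa using hl'.1
    rw [List.map_cons, List.prod_cons, ← Matrix.mulVec_mulVec, List.toFinset_cons] at *
    rw [ih hl'.2 (hg.mono (Finset.subset_insert _ _)) fun k hk => hνΓ k (by simp [hk])]
    have hνΓ' : ∀ k ∈ insert i l.toFinset, ∀ ε : ℤˣ, ((ε : ℤ) : ℂ) * ν k ∉ Γ :=
      fun k hk => hνΓ k (by simpa using hk)
    generalize l.toFinset = A at *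
    have hAi : A ⊆ insert i A := Finset.subset_insert _ _
    rw [Matrix.mulVec_sum, sum_signs_insert hi]
    simp only [Matrix.mulVec_smul]
    have hnot : ∀ (σ : Fin (M + 1) → ℤˣ) (ε : ℤˣ),
        ((ε : ℤ) : ℂ) * ν i ∉ Γ ∪ A.image (signed σ ν) := by
      intro σ ε
      rw [Finset.mem_union, not_or]
      refine ⟨hνΓ' i (by simp) ε, fun h => ?_⟩
      obtain ⟨k, hk, hk'⟩ := Finset.mem_image.1 h
      refine hg.2 k (hAi hk) i (by simp) (fun h => hi (h ▸ hk)) (σ k) (-ε) ?_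
      rw [signed] at hk'
      push_cast [hk']
      ring
    -- Each sign of the new variable gives the wanted vector and exchange terms. Exchange with a
    -- point of `Γ` is excluded by `d = 0`; exchange with the variables in `A` is cancelled
    -- afterwards by the sum over signs.
    have hstep : ∀ σ ∈ signs A, P.dcoef A Γ σ ν • (P.Bplus (ν i) *ᵥ
          P.bulk.Φ (Γ ∪ A.image (signed σ ν))) =
        ∑ ε : ℤˣ, P.dcoef (insert i A) Γ (Function.update σ i ε) ν •
          P.bulk.Φ (Γ ∪ (insert i A).image (signed (Function.update σ i ε) ν)) +
        ∑ j ∈ A, ∑ ε : ℤˣ, (P.dcoef A Γ σ ν * P.bcoef ε (ν i) *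
          (P.η / (((ε : ℤ) : ℂ) * ν i + signed σ ν j) * (P.d (signed σ ν j) *
          ∏ y ∈ (Γ ∪ A.image (signed σ ν)).erase (signed σ ν j), ff P.η (signed σ ν j) y))) •
        P.bulk.Φ (insert (((ε : ℤ) : ℂ) * ν i) (insert (-(((ε : ℤ) : ℂ) * ν i))
          ((Γ ∪ A.image (signed σ ν)).erase (signed σ ν j)))) := by
      intro σ _
      rw [Bplus_expand P hζ (hg.1 i (by simp)), Finset.smul_sum, Finset.sum_comm,
        ← Finset.sum_add_distrib]
      refine Finset.sum_congr rfl fun ε _ => ?_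
      have hx0 : ((ε : ℤ) : ℂ) * ν i ≠ 0 := by
        rcases unit_sq_eq ε (ν i) with h | h <;> rw [h]
        · exact hg.1 i (by simp)
        · exact neg_ne_zero.2 (hg.1 i (by simp))
      have hneg : -(((ε : ℤ) : ℂ) * ν i) ∉ Γ ∪ A.image (signed σ ν) := by
        have := hnot σ (-ε)
        push_cast at this
        rwa [neg_mul] at this
      rw [P.bulk.BD_Φ hη hx0 (hnot σ ε) hneg, smul_add, smul_add, Finset.smul_sum, Finset.smul_sum]
      congr 1
      · rw [dcoef_insert P hi, prod_cross_union P ((hg.mono hAi).injOn σ)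
          (fun k hk => hνΓ' k (hAi hk) (σ k)), Finset.image_insert, image_signed_update hi,
          signed_update_self, Finset.union_insert, smul_smul, smul_smul, hfac, bulk_d]
        congr 1
        ring
      · rw [Finset.sum_union, Finset.sum_eq_zero, zero_add,
          Finset.sum_image ((hg.mono hAi).injOn σ)]
        · refine Finset.sum_congr rfl fun j _ => ?_
          rw [smul_smul, smul_smul, bulk_d, mul_assoc (P.dcoef A Γ σ ν)]
        · intro y hy
          rw [bulk_d, hΓ y hy, zero_mul, mul_zero, zero_smul, smul_zero, smul_zero]
        · refine Finset.disjoint_right.2 fun y hy => ?_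
          obtain ⟨k, hk, rfl⟩ := Finset.mem_image.1 hy
          exact hνΓ' k (hAi hk) (σ k)
    rw [Finset.sum_congr rfl hstep, Finset.sum_add_distrib]
    conv_rhs => rw [← add_zero (Finset.sum _ _)]
    congr 1
    rw [Finset.sum_comm]
    refine Finset.sum_eq_zero fun j hj => ?_
    have hA : A = insert j (A.erase j) := (Finset.insert_erase hj).symm
    have hij : i ≠ j := fun h => hi (h ▸ hj)
    have key := offdiag_cancel P (A := A.erase j) (Γ := Γ) (ν := ν) (i := i) (j := j)
      (Finset.notMem_erase _ _) hij
      (by rwa [← hA]) (by rwa [← hA])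
    rwa [← hA] at key

/-- The states of the parameters at the inhomogeneities. -/
theorem inhom_state (hη : P.η ≠ 0) (hζ : P.ζ ≠ 0) (l : List (Fin N)) (hl : l.Nodup)
    (hinj : ∀ j ∈ l, ∀ k ∈ l, P.ξ0 j = P.ξ0 k → j = k)
    (hsum : ∀ j ∈ l, ∀ k ∈ l, P.ξ0 j + P.ξ0 k ≠ 0) :
    (l.map fun i => P.Bplus (P.ξ0 i)).prod *ᵥ vacuum N =
      P.H l.toFinset 1 P.ξ0 • P.bulk.Φ (l.toFinset.image P.ξ0) := by
  induction l with
  | nil => simp [H_empty, HighestWeight.Φ_empty]; rfl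
  | cons i l ih =>
    have hl' := List.nodup_cons.1 hl
    have hi : i ∉ l.toFinset := by simpa using hl'.1
    rw [List.map_cons, List.prod_cons, ← Matrix.mulVec_mulVec,
      ih hl'.2 (fun j hj k hk => hinj j (by simp [hj]) k (by simp [hk]))
        (fun j hj k hk => hsum j (by simp [hj]) k (by simp [hk])), Matrix.mulVec_smul,
      List.toFinset_cons, H_insert P hi]
    have hx0 : P.ξ0 i ≠ 0 := fun h => hsum i (by simp) i (by simp) (by simp [h])
    have h1 : P.ξ0 i ∉ l.toFinset.image P.ξ0 := by
      intro h
      obtain ⟨k, hk, hk'⟩ := Finset.mem_image.1 h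
      have hk2 : k ∈ l := by simpa using hk
      exact hl'.1 (hinj k (by simp [hk2]) i (by simp) hk' ▸ hk2)
    have h2 : -P.ξ0 i ∉ l.toFinset.image P.ξ0 := by
      intro h
      obtain ⟨k, hk, hk'⟩ := Finset.mem_image.1 h
      have hk2 : k ∈ l := by simpa using hk
      exact hsum k (by simp [hk2]) i (by simp) (by rw [hk']; ring)
    have hz : ∀ p ∈ l.toFinset.image P.ξ0, P.bulk.d p = 0 := fun p hp => by
      obtain ⟨k, _, rfl⟩ := Finset.mem_image.1 hp
      rw [bulk_d, d_ξ0]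
    have hzero : ∀ x, x ∉ l.toFinset.image P.ξ0 → ∀ c : ℂ, c = P.bulk.d x →
        P.bulk.T x 1 1 (P.bulk.Φ (l.toFinset.image P.ξ0)) =
          (c * ∏ y ∈ l.toFinset.image P.ξ0, ff P.η x y) •
            P.bulk.Φ (l.toFinset.image P.ξ0) := by
      rintro x hx c rfl
      rw [P.bulk.D_Φ hη hx, Finset.sum_eq_zero, add_zero]
      intro p hp
      rw [hz p hp, zero_mul, mul_zero, zero_smul]
    have hI : Set.InjOn P.ξ0 l.toFinset := fun j hj k hk =>
      hinj j (by simpa using Or.inr hj) k (by simpa using Or.inr hk)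
    -- For the sign `-1` the operator applied first is `D` at `ξ0 i`; all its coefficients contain
    -- `d` at inhomogeneities. Only the sign `+1` survives.
    rw [Bplus_expand P hζ hx0, sum_units]
    push_cast
    rw [neg_one_mul, neg_neg, one_mul, hzero _ h1 0 (by rw [bulk_d, d_ξ0]),
      hzero _ h2 (P.d (-P.ξ0 i)) (by rw [bulk_d]), zero_mul, zero_smul, map_zero, smul_zero,
      add_zero, map_smul, ← P.bulk.Φ_insert hη h1, Finset.image_insert, smul_smul, smul_smul,
      Finset.prod_image hI]
    congr 1
    simp only [hfac, cross_eq_ff, Pi.one_apply]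
    push_cast
    simp only [one_mul]
    ring

end Chain
end OpenXXX
end

/-! ### Sums over subsets, and the determinant `S` as an exchange coefficient. -/

open scoped Matrix
noncomputable section
namespace OpenXXX

theorem prod_lt_orderEmb {ι : Type} [LinearOrder ι] (A : Finset ι) {n : ℕ} (h : A.card = n)
    (g : ι → ι → ℂ) : ∏ i ∈ A, ∏ j ∈ A with j < i, g i j =
      ∏ j : Fin n, ∏ i ∈ Finset.Ioi j, g (A.orderEmbOfFin h i) (A.orderEmbOfFin h j) := by
  have e : ∀ F : ι → ℂ, ∏ i ∈ A, F i = ∏ i : Fin n, F (A.orderEmbOfFin h i) := fun F => by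
    conv_lhs => rw [← Finset.map_orderEmbOfFin_univ A h, Finset.prod_map]
    rfl
  simp only [Finset.prod_filter]
  rw [e]
  simp only [e]
  rw [Finset.prod_comm]
  refine Finset.prod_congr rfl fun j _ => ?_
  rw [← Finset.filter_lt_eq_Ioi, Finset.prod_filter]
  simp only [OrderEmbedding.lt_iff_lt]

/-- Pairs of subsets of different sizes contribute nothing, so any bound on the common size that
reaches the smaller cardinality gives the full sum. -/
theorem sum_powersetCard_range {V : Type} [AddCommMonoid V] {α β : Type} [DecidableEq α]
    [DecidableEq β] (A : Finset α) (B : Finset β) {n : ℕ} (hn : min A.card B.card ≤ n)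
    (F : Finset α → Finset β → V) (hF : ∀ a b, a.card ≠ b.card → F a b = 0) :
    ∑ k ∈ Finset.range (n + 1), ∑ a ∈ Finset.powersetCard k A,
      ∑ b ∈ Finset.powersetCard k B, F a b = ∑ b ∈ B.powerset, ∑ a ∈ A.powerset, F a b := by
  rw [Finset.sum_comm (s := B.powerset), Finset.sum_powerset]
  have h1 : ∀ k, ∀ a ∈ Finset.powersetCard k A, ∑ b ∈ B.powerset, F a b =
      ∑ b ∈ Finset.powersetCard k B, F a b := by
    intro k a ha
    refine (Finset.sum_subset ?_ fun b _ hb => hF a b fun h => hb ?_).symm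
    · exact fun b hb => Finset.mem_powerset.2 (Finset.mem_powersetCard.1 hb).1
    · exact Finset.mem_powersetCard.2 ⟨Finset.mem_powerset.1 ‹_›,
        h ▸ (Finset.mem_powersetCard.1 ha).2⟩
  rw [Finset.sum_congr rfl fun k _ => Finset.sum_congr rfl (h1 k)]
  have h2 : ∀ m, min A.card B.card ≤ m → ∀ k, k ∉ Finset.range (m + 1) →
      ∑ a ∈ Finset.powersetCard k A, ∑ b ∈ Finset.powersetCard k B, F a b = 0 := by
    intro m hm k hk
    rw [Finset.mem_range, not_lt] at hk
    rcases min_le_iff.1 hm with h | h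
    · rw [Finset.powersetCard_eq_empty.2 (by omega), Finset.sum_empty]
    · refine Finset.sum_eq_zero fun a _ => ?_
      rw [Finset.powersetCard_eq_empty.2 (by omega), Finset.sum_empty]
  -- All bounds are compared with the common one `max n A.card`; the second alternative is ruled out
  -- in both uses.
  have h3 : ∀ m, min A.card B.card ≤ m → ∑ k ∈ Finset.range (m + 1),
      ∑ a ∈ Finset.powersetCard k A, ∑ b ∈ Finset.powersetCard k B, F a b =
      ∑ k ∈ Finset.range (max n A.card + 1),
        ∑ a ∈ Finset.powersetCard k A, ∑ b ∈ Finset.powersetCard k B, F a b ∨ max n A.card < m := by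
    intro m hm
    rcases le_or_gt m (max n A.card) with h | h
    · left
      exact Finset.sum_subset (Finset.range_mono (by omega)) fun k _ hk => h2 m hm k hk
    · exact Or.inr h
  rw [(h3 n hn).resolve_right (by simp), (h3 A.card (min_le_left _ _)).resolve_right (by simp)]

namespace HighestWeight

variable {η : ℂ} {V : Type} [AddCommGroup V] [Module ℂ V] (Y : HighestWeight η V)

theorem sum_powerset_image {W : Type} [AddCommMonoid W] {ι : Type} [DecidableEq ι]
    {X : ι → ℂ} (hX : Function.Injective X) (B : Finset ι) (F : Finset ℂ → W) :
    ∑ a ∈ (B.image X).powerset, F a = ∑ a ∈ B.powerset, F (a.image X) := by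
  rw [Finset.powerset_image, Finset.sum_image (Finset.image_injective hX).injOn]

/-- `exState` in terms of index sets. -/
theorem exState_image {ι κ : Type} [DecidableEq ι] [DecidableEq κ] {X : ι → ℂ} {x : κ → ℂ}
    (hX : Function.Injective X) (hx : Function.Injective x) (ρ : ℂ → ℂ) (I : Finset κ)
    (B : Finset ι) (hd : ∀ i ∈ B, ∀ k ∈ I, X i ≠ x k) : Y.exState ρ (I.image x) (B.image X) = ∑ γ ∈ I.powerset, ∑ α ∈ B.powerset,
      ((∏ i ∈ α, Y.a (X i)) * (∏ k ∈ I \ γ, Y.a (x k)) *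
        ((∏ j ∈ α, ∏ i ∈ B \ α, ff η (X i) (X j)) *
          chat η (exW η ρ (B.image X) (α.image X)) (α.image X) (γ.image x) *
          ∏ k ∈ I \ γ, (∏ i ∈ B \ α, ff η (X i) (x k)) * ∏ i ∈ γ, ff η (x i) (x k))) •
        Y.Φ (γ.image x ∪ (B \ α).image X) := by
  rw [exState, sum_powerset_image hx]
  refine Finset.sum_congr rfl fun γ hγ => ?_
  rw [sum_powerset_image hX]
  refine Finset.sum_congr rfl fun α hα => ?_
  have hdis : Disjoint ((B \ α).image X) (γ.image x) := by
    refine Finset.disjoint_left.2 fun z hz hz' => ?_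
    obtain ⟨i, hi, rfl⟩ := Finset.mem_image.1 hz
    obtain ⟨k, hk, hk'⟩ := Finset.mem_image.1 hz'
    exact hd i (Finset.sdiff_subset hi) k (Finset.mem_powerset.1 hγ hk) hk'.symm
  rw [exCoeff, ← Finset.image_sdiff _ _ hX, ← Finset.image_sdiff _ _ hx,
    Finset.prod_image hX.injOn, Finset.prod_image hX.injOn, Finset.prod_image hx.injOn,
    Finset.prod_image hx.injOn, Finset.union_comm (γ.image x)]
  simp only [Finset.prod_union hdis, Finset.prod_image hX.injOn, Finset.prod_image hx.injOn]

end HighestWeight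

namespace Chain

variable {N M : ℕ} (P : Chain N)

theorem fProd_fam {ι κ : Type} (A : Finset ι) (B : Finset κ) (X : ι → ℂ) (Y : κ → ℂ) :
    P.fProd (fam A X) (fam B Y) = ∏ i ∈ A, ∏ j ∈ B, ff P.η (X i) (Y j) := by
  simp only [fProd, fam, Multiset.map_map]
  rfl

theorem fProd_fam_singleton {ι : Type} (A : Finset ι) (X : ι → ℂ) (y : ℂ) :
    P.fProd (fam A X) {y} = ∏ i ∈ A, ff P.η (X i) y := by
  simp only [fProd, fam, Multiset.map_map, Multiset.map_singleton, Multiset.prod_singleton]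
  rfl

theorem fProd_singleton_fam {ι : Type} (A : Finset ι) (X : ι → ℂ) (y : ℂ) :
    P.fProd {y} (fam A X) = ∏ i ∈ A, ff P.η y (X i) := by
  simp only [fProd, fam, Multiset.map_map, Multiset.map_singleton, Multiset.prod_singleton]
  rfl

/-- The coefficient `w` of the second term of the matrix entries. -/
def wS (s : Fin N) (α extra : Finset (Fin (M + 1))) (X : Fin (M + 1) → ℂ) (j : Fin (M + 1)) : ℂ :=
  if j = Fin.last M then 0 else
    (∏ i ∈ α.erase j ∪ extra, ff P.η (X i) (X j)) / (∏ i ∈ α.erase j ∪ extra, ff P.η (X j) (X i)) *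
      (ff P.η (X j) (P.ξ0 s) / ff P.η (P.ξ0 s) (X j))

/-- The prefactor of `S` belonging to row `j` clears its denominators. The quotient of the factors
`f` over `γ` becomes the quotient of the products with `-η` and `+η`, which is the shape of
`slavMat`. -/
theorem Mentry_mul {s : Fin N} {γ : Finset (Fin N)} (hs : s ∉ γ) {α extra : Finset (Fin (M + 1))}
    {X : Fin (M + 1) → ℂ} {j : Fin (M + 1)} {k : Fin N} (hk : k ∈ γ)
    (h1 : ∀ k ∈ γ, P.ξ0 k - X j ≠ 0) (h2 : ∀ k ∈ γ, P.ξ0 k - X j + P.η ≠ 0)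
    (h3 : ∀ k ∈ γ, X j - P.ξ0 k + P.η ≠ 0) :
    (∏ i ∈ γ, (P.ξ0 i - X j + P.η)) * P.Mentry s γ α extra X j k =
      P.η / (P.ξ0 k - X j) * (∏ i ∈ γ.erase k, (P.ξ0 i - X j + P.η) -
        P.wS s α extra X j * ∏ i ∈ γ.erase k, (P.ξ0 i - X j - P.η)) := by
  have hA : ∏ i ∈ γ, (P.ξ0 i - X j + P.η) ≠ 0 := Finset.prod_ne_zero_iff.2 h2
  have e1 : (∏ i ∈ γ, ff P.η (X j) (P.ξ0 i)) / (∏ i ∈ γ, ff P.η (P.ξ0 i) (X j)) =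
      (∏ i ∈ γ, (P.ξ0 i - X j - P.η)) / ∏ i ∈ γ, (P.ξ0 i - X j + P.η) := by
    rw [← Finset.prod_div_distrib, ← Finset.prod_div_distrib]
    refine Finset.prod_congr rfl fun i hi => ?_
    have n1 := h1 i hi
    have n2 := h2 i hi
    have n3 : X j - P.ξ0 i ≠ 0 := by
      rw [← neg_ne_zero, neg_sub]; exact n1
    unfold ff
    field_simp
    ring
  have n1 := h1 k hk
  have n2 := h2 k hk
  have n3 := h3 k hk
  have n4 : X j - P.ξ0 k ≠ 0 := by
    rw [← neg_ne_zero, neg_sub]; exact n1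
  rw [Mentry, fProd_fam_singleton, fProd_singleton_fam, fProd_singleton_fam, fProd_fam_singleton,
    Finset.prod_insert hs, Finset.prod_insert hs, mul_div_mul_comm, e1, wS]
  have e2 := Finset.mul_prod_erase γ (fun i => P.ξ0 i - X j + P.η) hk
  have e3 := Finset.mul_prod_erase γ (fun i => P.ξ0 i - X j - P.η) hk
  rw [← e3]
  have e4 : P.r (P.ξ0 k) (X j) * ∏ i ∈ γ, (P.ξ0 i - X j + P.η) =
      P.η / (P.ξ0 k - X j) * ∏ i ∈ γ.erase k, (P.ξ0 i - X j + P.η) := by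
    rw [← e2, r]
    field_simp
  have e5 : P.r (X j) (P.ξ0 k) * (P.ξ0 k - X j - P.η) = P.η / (P.ξ0 k - X j) := by
    rw [r]
    field_simp
    ring
  split_ifs with h
  · linear_combination e4
  · generalize (∏ i ∈ α.erase j ∪ extra, ff P.η (X i) (X j)) /
      (∏ i ∈ α.erase j ∪ extra, ff P.η (X j) (X i)) = u at *
    generalize ff P.η (X j) (P.ξ0 s) / ff P.η (P.ξ0 s) (X j) = v at *
    generalize ∏ i ∈ γ, (P.ξ0 i - X j + P.η) = A at *
    generalize ∏ i ∈ γ.erase k, (P.ξ0 i - X j - P.η) = A' at *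
    have e6 : A * (v * ((P.ξ0 k - X j - P.η) * A' / A)) = v * ((P.ξ0 k - X j - P.η) * A') := by
      field_simp
    linear_combination e4 - P.r (X j) (P.ξ0 k) * u * e6 - u * v * A' * e5

/-- The double product in `S` is distributed over the rows of the determinant, and its two ordered
products are the Vandermonde determinants in `ξ0` and in `-X`. -/
theorem S_eq_chat {s : Fin N} {γ : Finset (Fin N)} (hs : s ∉ γ)
    {α extra : Finset (Fin (M + 1))} {X : Fin (M + 1) → ℂ} (hX : Function.Injective X)
    (hY : Function.Injective P.ξ0) (h1 : ∀ j ∈ α, ∀ k ∈ γ, P.ξ0 k - X j ≠ 0)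
    (h2 : ∀ j ∈ α, ∀ k ∈ γ, P.ξ0 k - X j + P.η ≠ 0)
    (h3 : ∀ j ∈ α, ∀ k ∈ γ, X j - P.ξ0 k + P.η ≠ 0) {w : ℂ → ℂ}
    (hw : ∀ j ∈ α, w (X j) = P.wS s α extra X j) :
    P.S s γ α extra X = chat P.η w (α.image X) (γ.image P.ξ0) := by
  by_cases h : α.card = γ.card
  · rw [S, dif_pos h, chat_eq (n := γ.card) P.η w (lam := X ∘ α.orderEmbOfFin h)
      (x := P.ξ0 ∘ γ.orderEmbOfFin rfl) (hX.comp (α.orderEmbOfFin h).injective)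
      (hY.comp (γ.orderEmbOfFin rfl).injective), slav, vdm, vdm, Matrix.det_vandermonde,
      Matrix.det_vandermonde, prod_lt_orderEmb γ rfl, prod_lt_orderEmb α h, div_mul_eq_mul_div]
    · congr 1
      · have e1 : ∏ k ∈ γ, ∏ j ∈ α, (P.ξ0 k - X j + P.η) =
            ∏ i, ∏ k ∈ γ, (P.ξ0 k - X (α.orderEmbOfFin h i) + P.η) := by
          rw [Finset.prod_comm]
          conv_lhs => rw [← Finset.map_orderEmbOfFin_univ α h, Finset.prod_map]
          rfl
        rw [e1, ← Matrix.det_mul_column]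
        congr 1
        ext i k
        have hi := α.orderEmbOfFin_mem h i
        simp only [Matrix.of_apply, slavMat, Function.comp_apply]
        rw [P.Mentry_mul hs (γ.orderEmbOfFin_mem rfl k) (h1 _ hi) (h2 _ hi) (h3 _ hi), hw _ hi]
        have e2 : γ.erase (γ.orderEmbOfFin rfl k) =
            (Finset.univ.erase k).map (γ.orderEmbOfFin rfl).toEmbedding := by
          rw [Finset.map_erase, Finset.map_orderEmbOfFin_univ]
          rfl
        rw [e2, Finset.prod_map, Finset.prod_map]
        rfl
      · congr 1
        · refine Finset.prod_congr rfl fun i _ => Finset.prod_congr rfl fun j _ => ?_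
          simp only [Function.comp_apply, ξ0]
          ring
        · refine Finset.prod_congr rfl fun i _ => Finset.prod_congr rfl fun j _ => ?_
          simp only [Function.comp_apply, Pi.neg_apply]
          ring
    · intro z
      rw [Finset.mem_image]
      constructor
      · rintro ⟨j, hj, rfl⟩
        rw [← Finset.map_orderEmbOfFin_univ α h, Finset.mem_map] at hj
        obtain ⟨i, _, rfl⟩ := hj
        exact ⟨i, rfl⟩
      · rintro ⟨i, rfl⟩
        exact ⟨_, α.orderEmbOfFin_mem h i, rfl⟩
    · intro z
      rw [Finset.mem_image]
      constructor
      · rintro ⟨j, hj, rfl⟩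
        rw [← Finset.map_orderEmbOfFin_univ γ rfl, Finset.mem_map] at hj
        obtain ⟨i, _, rfl⟩ := hj
        exact ⟨i, rfl⟩
      · rintro ⟨i, rfl⟩
        exact ⟨_, γ.orderEmbOfFin_mem rfl i, rfl⟩
  · rw [S, dif_neg h, mul_zero, chat_of_card_ne]
    rwa [Finset.card_image_of_injective _ hX, Finset.card_image_of_injective _ hY]

end Chain
end OpenXXX
end

/-! ### Expansion of the resulting states, and the Bethe ratio in the determinant. -/

open scoped Matrix
noncomputable section
namespace OpenXXX

namespace Chain

variable {N M : ℕ} (P : Chain N)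

/-- The consequences of the genericity assumptions that the proof uses. -/
structure Generic (s : Fin N) (ν : Fin (M + 1) → ℂ) : Prop where
  hη : P.η ≠ 0
  hζ : P.ζ ≠ 0
  last : ν (Fin.last M) = P.ξ0 s
  inj : Function.Injective P.ξ0
  sum_ne : ∀ j ≤ s, ∀ k ≤ s, P.ξ0 j + P.ξ0 k ≠ 0
  a_ne : ∀ k, P.a (P.ξ0 k) ≠ 0
  H_ne : ∀ γ : Finset (Fin N), (∀ k ∈ γ, k ≤ s) → P.H γ 1 P.ξ0 ≠ 0
  sign : SignGeneric Finset.univ ν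
  ne : ∀ σ i, ∀ k < s, signed σ ν i ≠ P.ξ0 k
  shift : ∀ σ : Fin (M + 1) → ℤˣ, σ (Fin.last M) = 1 →
    ∀ i j, signed σ ν i - signed σ ν j + P.η ≠ 0
  shift_left : ∀ σ i, ∀ k < s, signed σ ν i - P.ξ0 k + P.η ≠ 0
  shift_right : ∀ σ : Fin (M + 1) → ℤˣ, σ (Fin.last M) = 1 → ∀ i, ∀ k < s,
    P.ξ0 k - signed σ ν i + P.η ≠ 0

theorem H_union {ι : Type} [LinearOrder ι] {A B : Finset ι} (h : Disjoint A B) (σ : ι → ℤˣ)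
    (lam : ι → ℂ) : P.H (A ∪ B) σ lam = P.H A σ lam * P.H B σ lam *
      ∏ i ∈ A, ∏ j ∈ B, P.cross (((σ i : ℤ) : ℂ) * lam i) (((σ j : ℤ) : ℂ) * lam j) := by
  induction A using Finset.induction_on with
  | empty => simp [H_empty]
  | insert i A hi ih =>
    rw [Finset.disjoint_insert_left] at h
    rw [Finset.insert_union, H_insert P (by simp [hi, h.1]), ih h.2, H_insert P hi,
      Finset.prod_union h.2, Finset.prod_insert hi]
    ring

theorem H_eq_zero {ι : Type} [LinearOrder ι] {A : Finset ι} {i : ι} (hi : i ∈ A) {σ : ι → ℤˣ}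
    {lam : ι → ℂ} (h : P.d (-(((σ i : ℤ) : ℂ) * lam i)) = 0) : P.H A σ lam = 0 := by
  rw [H_eq, Finset.prod_eq_zero hi, zero_mul]
  rw [hfac, h, mul_zero]

theorem map_a_fam {ι : Type} (A : Finset ι) (X : ι → ℂ) :
    ((fam A X).map P.a).prod = ∏ i ∈ A, P.a (X i) := by
  simp only [fam, Multiset.map_map]
  rfl

theorem fProd_add (X X' Y : Multiset ℂ) :
    P.fProd (X + X') Y = P.fProd X Y * P.fProd X' Y := by
  simp [fProd]

/-- A family `± ν` is unchanged by sign flips, so it may be written with any choice of signs; this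
allows a comparison sign by sign. -/
theorem fProd_pmFam {ι : Type} (A : Finset (Fin (M + 1))) (ν : Fin (M + 1) → ℂ)
    (σ : Fin (M + 1) → ℤˣ) (B : Finset ι) (Y : ι → ℂ) : P.fProd (pmFam A ν) (fam B Y) =
      (∏ i ∈ A, ∏ j ∈ B, ff P.η (signed σ ν i) (Y j)) *
        ∏ i ∈ A, ∏ j ∈ B, ff P.η (-signed σ ν i) (Y j) := by
  rw [pmFam, fProd_add, fProd_fam, fProd_fam, ← Finset.prod_mul_distrib, ← Finset.prod_mul_distrib]
  refine Finset.prod_congr rfl fun i _ => ?_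
  exact (even_of_units (fun x => (∏ j ∈ B, ff P.η x (Y j)) * ∏ j ∈ B, ff P.η (-x) (Y j))
    (fun x => by rw [neg_neg, mul_comm]) (σ i) (ν i)).symm

/-- The operators at the inhomogeneities act first and give a single bulk vector; the others are
then decomposed in the presence of these points, where `d` vanishes. -/
theorem newState_eq {s : Fin N} {ν : Fin (M + 1) → ℂ} (hg : P.Generic s ν)
    (A : Finset (Fin (M + 1))) {γ : Finset (Fin N)} (hγ : ∀ k ∈ γ, k < s) :
    P.newState ν A γ = ∑ σ ∈ signs A, (P.H γ 1 P.ξ0 * P.dcoef A (γ.image P.ξ0) σ ν) •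
      P.bulk.Φ (γ.image P.ξ0 ∪ A.image (signed σ ν)) := by
  have hγ' : ∀ k ∈ γ.sort (· ≤ ·), k < s := fun k hk => hγ k (by simpa using hk)
  have h1 := P.inhom_state hg.hη hg.hζ (γ.sort (· ≤ ·)) (γ.sort_nodup _)
    (fun j _ k _ h => hg.inj h) fun j hj k hk => hg.sum_ne j (hγ' j hj).le k (hγ' k hk).le
  have h2 := P.boundary_decomposition hg.hη hg.hζ (Γ := γ.image P.ξ0) (ν := ν)
    (fun y hy => by
      obtain ⟨k, _, rfl⟩ := Finset.mem_image.1 hy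
      exact P.d_ξ0 k) (A.sort (· ≤ ·)) (A.sort_nodup _)
    (hg.sign.mono (Finset.subset_univ _)) (fun i _ ε h => by
      obtain ⟨k, hk, hk'⟩ := Finset.mem_image.1 h
      exact hg.ne (fun _ => ε) i k (hγ k hk) hk'.symm)
  rw [Finset.sort_toFinset] at h1 h2
  rw [newState, sepState, List.map_append, List.prod_append, ← Matrix.mulVec_mulVec, List.map_map,
    List.map_map]
  have h1' : (List.map (P.Bplus ∘ P.ξ0) (γ.sort (· ≤ ·))).prod *ᵥ vacuum N =
    P.H γ 1 P.ξ0 • P.bulk.Φ (γ.image P.ξ0) := h1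
  rw [h1', Matrix.mulVec_smul]
  have h2' : (List.map (P.Bplus ∘ ν) (A.sort (· ≤ ·))).prod *ᵥ P.bulk.Φ (γ.image P.ξ0) = _ := h2
  rw [h2', Finset.smul_sum]
  exact Finset.sum_congr rfl fun σ _ => smul_smul _ _ _

theorem sum_signs_union {V : Type} [AddCommGroup V] [Module ℂ V] {A B : Finset (Fin (M + 1))}
    (h : Disjoint A B) (F : (Fin (M + 1) → ℤˣ) → ℂ) (G : (Fin (M + 1) → ℤˣ) → V)
    (hF : ∀ σ σ', (∀ i ∈ A, σ i = σ' i) → F σ = F σ')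
    (hG : ∀ σ σ', (∀ i ∈ B, σ i = σ' i) → G σ = G σ') :
    (∑ σ ∈ signs A, F σ) • ∑ σ ∈ signs B, G σ = ∑ σ ∈ signs (A ∪ B), F σ • G σ := by
  rw [Finset.sum_smul_sum, ← Finset.sum_product']
  refine Finset.sum_bij' (fun p _ => p.1 * p.2)
    (fun σ _ => (fun i => if i ∈ A then σ i else 1, fun i => if i ∈ B then σ i else 1))
    ?_ ?_ ?_ ?_ ?_
  · rintro ⟨σ, τ⟩ hp
    simp only [Finset.mem_product, mem_signs, Finset.mem_union, not_or] at hp ⊢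
    exact fun i hi => by rw [Pi.mul_apply, hp.1 i hi.1, hp.2 i hi.2, one_mul]
  · intro σ hσ
    simp only [Finset.mem_product, mem_signs]
    exact ⟨fun i hi => if_neg hi, fun i hi => if_neg hi⟩
  · rintro ⟨σ, τ⟩ hp
    simp only [Finset.mem_product, mem_signs] at hp
    refine Prod.ext (funext fun i => ?_) (funext fun i => ?_)
    · by_cases hi : i ∈ A
      · simp [hi, hp.2 i (Finset.disjoint_left.1 h hi)]
      · simp [hi, hp.1 i hi]
    · by_cases hi : i ∈ B
      · simp [hi, hp.1 i (Finset.disjoint_right.1 h hi)]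
      · simp [hi, hp.2 i hi]
  · intro σ hσ
    rw [mem_signs] at hσ
    funext i
    by_cases hA : i ∈ A
    · simp [hA, Finset.disjoint_left.1 h hA]
    · by_cases hB : i ∈ B
      · simp [hA, hB]
      · simp [hA, hB, hσ i (by simp [hA, hB])]
  · rintro ⟨σ, τ⟩ hp
    simp only [Finset.mem_product, mem_signs] at hp
    rw [hF σ (σ * τ) fun i hi => by
        rw [Pi.mul_apply, hp.2 i (Finset.disjoint_left.1 h hi), mul_one],
      hG τ (σ * τ) fun i hi => by
        rw [Pi.mul_apply, hp.1 i (Finset.disjoint_right.1 h hi), one_mul]]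

theorem sum_signs_univ {V : Type} [AddCommMonoid V] (F : (Fin (M + 1) → ℤˣ) → V)
    (h : ∀ σ : Fin (M + 1) → ℤˣ, σ (Fin.last M) = -1 → F σ = 0) :
    ∑ σ ∈ signs Finset.univ, F σ = ∑ σ ∈ signs (Finset.univ.erase (Fin.last M)), F σ := by
  rw [← Finset.insert_erase (Finset.mem_univ (Fin.last M)),
    sum_signs_insert (Finset.notMem_erase _ _)]
  simp only [Finset.erase_insert (Finset.notMem_erase _ _)]
  refine Finset.sum_congr rfl fun σ hσ => ?_
  rw [sum_units, h _ (Function.update_self _ _ _), add_zero]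
  congr 1
  rw [← mem_signs.1 hσ (Fin.last M) (Finset.notMem_erase _ _), Function.update_eq_self]

/-- The quotient over `Z \ α` cancels the corresponding factors of the Bethe ratio, leaving those of
`α.erase j ∪ D`. The last index is absent from the Bethe ratio, which accounts for the extra
quotient with `ξ0 s`. At the last index itself both sides vanish: this is the origin of the
exceptional row of the determinant. -/
theorem exW_eq_wS {s : Fin N} {ν : Fin (M + 1) → ℂ} (hg : P.Generic s ν)
    {σ : Fin (M + 1) → ℤˣ} (hσ : σ (Fin.last M) = 1) {D α : Finset (Fin (M + 1))}
    (hα : α ⊆ Finset.univ \ D) {j : Fin (M + 1)} (hj : j ∈ α) :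
    exW P.η (betheRatio P.η ((Finset.univ.erase (Fin.last M)).image (signed σ ν)))
      ((Finset.univ \ D).image (signed σ ν)) (α.image (signed σ ν)) (signed σ ν j) =
      P.wS s α D (signed σ ν) j := by
  have hX : Function.Injective (signed σ ν) := fun i j h =>
    hg.sign.injOn σ (Finset.mem_coe.2 (Finset.mem_univ i)) (Finset.mem_coe.2 (Finset.mem_univ j)) h
  have hlast : signed σ ν (Fin.last M) = P.ξ0 s := by
    rw [signed, hσ, hg.last]; simp
  rw [exW, wS]
  by_cases h : j = Fin.last M
  · rw [if_pos h, betheRatio, if_neg, zero_mul]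
    rw [Finset.mem_image]
    rintro ⟨i, hi, hi'⟩
    exact Finset.ne_of_mem_erase hi ((hX hi').trans h)
  · have hne : ∀ i k, i ≠ k → ff P.η (signed σ ν i) (signed σ ν k) ≠ 0 := fun i k hik =>
      ff_ne_zero (hg.shift σ hσ i k) (hX.ne hik)
    have hsplit : ∀ g : Fin (M + 1) → ℂ, (∏ i ∈ α.erase j ∪ D, g i) *
        ∏ i ∈ (Finset.univ \ D) \ α, g i =
        g (Fin.last M) * ∏ i ∈ (Finset.univ.erase (Fin.last M)).erase j, g i := by
      intro g
      rw [Finset.erase_right_comm, Finset.mul_prod_erase _ g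
        (Finset.mem_erase.2 ⟨Ne.symm h, Finset.mem_univ _⟩), ← Finset.prod_union]
      · congr 1
        ext i
        have := fun h : i ∈ α => (Finset.mem_sdiff.1 (hα h)).2
        have hjD := (Finset.mem_sdiff.1 (hα hj)).2
        simp only [Finset.mem_union, Finset.mem_erase, Finset.mem_sdiff, Finset.mem_univ, true_and,
          and_true]
        constructor
        · rintro ((h | h) | h) <;> rintro rfl <;> tauto
        · tauto
      · refine Finset.disjoint_left.2 fun i hi hi' => ?_
        simp only [Finset.mem_union, Finset.mem_erase, Finset.mem_sdiff, Finset.mem_univ,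
          true_and] at hi hi'
        tauto
    rw [if_neg h, betheRatio, if_pos (Finset.mem_image.2 ⟨j, by simp [h], rfl⟩),
      ← Finset.image_sdiff _ _ hX, ← Finset.image_erase hX, Finset.prod_image hX.injOn,
      Finset.prod_image hX.injOn, Finset.prod_image hX.injOn, Finset.prod_image hX.injOn, ← hlast]
    have s1 := hsplit fun i => ff P.η (signed σ ν i) (signed σ ν j)
    have s2 := hsplit fun i => ff P.η (signed σ ν j) (signed σ ν i)
    have n1 := hne _ _ h
    have n2 := hne _ _ (Ne.symm h)
    have n3 : ∏ i ∈ α.erase j ∪ D, ff P.η (signed σ ν j) (signed σ ν i) ≠ 0 :=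
      Finset.prod_ne_zero_iff.2 fun i hi => hne _ _ (by
        rintro rfl
        rcases Finset.mem_union.1 hi with h | h
        · exact Finset.notMem_erase _ _ h
        · exact (Finset.mem_sdiff.1 (hα hj)).2 h)
    have n4 : ∏ i ∈ (Finset.univ \ D) \ α, ff P.η (signed σ ν i) (signed σ ν j) ≠ 0 :=
      Finset.prod_ne_zero_iff.2 fun i hi => hne _ _ (by
        rintro rfl; exact (Finset.mem_sdiff.1 hi).2 hj)
    have n5 : ∏ i ∈ (Finset.univ.erase (Fin.last M)).erase j,
        ff P.η (signed σ ν j) (signed σ ν i) ≠ 0 :=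
      Finset.prod_ne_zero_iff.2 fun i hi => hne _ _ (Finset.ne_of_mem_erase hi).symm
    field_simp
    linear_combination (-(ff P.η (signed σ ν j) (signed σ ν (Fin.last M)) * ∏ i ∈ (Finset.univ.erase (Fin.last M)).erase j,
        ff P.η (signed σ ν j) (signed σ ν i))) * s1 + (ff P.η (signed σ ν (Fin.last M)) (signed σ ν j) * ∏ i ∈ (Finset.univ.erase (Fin.last M)).erase j, ff P.η (signed σ ν i) (signed σ ν j)) * s2

end Chain
end OpenXXX
end

/-! ### Comparison of boundary and bulk coefficients. -/

open scoped Matrix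
noncomputable section
namespace OpenXXX

namespace Chain

variable {N M : ℕ} (P : Chain N)

/-- Among the factors for `± ν`, those with the sign opposite to `σ` are factors `cross`. Over `γ`
they cancel the product which `dcoef` contributes; over `α` they are the mixed factors of `H`. -/
theorem R_eq {s : Fin N} {ν : Fin (M + 1) → ℂ} (hg : P.Generic s ν) (σ : Fin (M + 1) → ℤˣ)
    {γ : Finset (Fin N)} (hγ : γ ⊆ Finset.Iio s) (α A : Finset (Fin (M + 1))) :
    P.R γ (Finset.Iio s \ γ) (fam α (signed σ ν)) (pmFam A ν) *
        ∏ i ∈ A, ∏ y ∈ γ.image P.ξ0, P.cross (signed σ ν i) y =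
      (∏ i ∈ α, P.a (signed σ ν i)) *
        (∏ j ∈ α, ∏ i ∈ A, ff P.η (signed σ ν i) (signed σ ν j)) *
        (∏ j ∈ α, ∏ i ∈ A, P.cross (signed σ ν j) (signed σ ν i)) *
        ((∏ k ∈ Finset.Iio s \ γ, P.a (P.ξ0 k)) *
          ∏ k ∈ Finset.Iio s \ γ, ∏ i ∈ γ, ff P.η (P.ξ0 i) (P.ξ0 k)) /
      ((∏ k ∈ Finset.Iio s, P.a (P.ξ0 k)) *
        (∏ i ∈ α, ∏ k ∈ Finset.Iio s, ff P.η (signed σ ν i) (P.ξ0 k)) *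
        ∏ i ∈ A, ∏ k ∈ γ, ff P.η (signed σ ν i) (P.ξ0 k)) := by
  have hlt : ∀ k ∈ γ, k < s := fun k hk => Finset.mem_Iio.1 (hγ hk)
  have e1 : ∏ i ∈ A, ∏ y ∈ γ.image P.ξ0, P.cross (signed σ ν i) y =
      ∏ i ∈ A, ∏ k ∈ γ, ff P.η (-signed σ ν i) (P.ξ0 k) :=
    Finset.prod_congr rfl fun i _ => by
      rw [Finset.prod_image hg.inj.injOn]
      exact Finset.prod_congr rfl fun k _ => P.cross_eq_ff _ _
  have hneg : ∀ i, -signed σ ν i = signed (-σ) ν i := fun i => by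
    simp [signed]
  have e2 : ∏ i ∈ A, ∏ k ∈ γ, ff P.η (-signed σ ν i) (P.ξ0 k) ≠ 0 :=
    Finset.prod_ne_zero_iff.2 fun i _ => Finset.prod_ne_zero_iff.2 fun k hk => by
      rw [hneg]
      exact ff_ne_zero (hg.shift_left (-σ) i k (hlt k hk)) (hg.ne (-σ) i k (hlt k hk))
  have e3 : ∏ i ∈ A, ∏ j ∈ α, ff P.η (-signed σ ν i) (signed σ ν j) =
      ∏ j ∈ α, ∏ i ∈ A, P.cross (signed σ ν j) (signed σ ν i) := by
    rw [Finset.prod_comm]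
    refine Finset.prod_congr rfl fun j _ => Finset.prod_congr rfl fun i _ => ?_
    rw [cross_comm, cross_eq_ff]
  rw [R, τ, τ, τ, map_a_fam, map_a_fam, map_a_fam, Finset.union_sdiff_of_subset hγ, fProd_fam,
    fProd_fam, P.fProd_pmFam A ν σ, P.fProd_pmFam A ν σ, e1, e3,
    Finset.prod_comm (s := A) (t := α), Finset.prod_comm (s := γ)]
  generalize ∏ i ∈ A, ∏ k ∈ γ, ff P.η (-signed σ ν i) (P.ξ0 k) = X1 at *
  conv_rhs => rw [← mul_div_mul_right _ _ e2]
  rw [div_mul_eq_mul_div]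
  congr 1 <;> ring

/-- The comparison of the coefficients in the boundary and in the bulk formula. -/
theorem term_eq {s : Fin N} {ν : Fin (M + 1) → ℂ} (hg : P.Generic s ν)
    {σ : Fin (M + 1) → ℤˣ} (hσ : σ (Fin.last M) = 1) {D α : Finset (Fin (M + 1))}
    (hα : α ⊆ Finset.univ \ D) {γ : Finset (Fin N)} (hγ : γ ⊆ Finset.Iio s) (G : ℂ) :
    G * P.H α σ ν / P.H γ 1 P.ξ0 *
        P.R γ (Finset.Iio s \ γ) (fam α (signed σ ν)) (pmFam ((Finset.univ \ D) \ α) ν) *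
        P.S s γ α D (signed σ ν) *
        (P.H γ 1 P.ξ0 * P.dcoef ((Finset.univ \ D) \ α) (γ.image P.ξ0) σ ν) =
      G * P.H (Finset.univ \ D) σ ν / ((∏ k ∈ Finset.Iio s, P.a (P.ξ0 k)) *
        ∏ i ∈ Finset.univ \ D, ∏ k ∈ Finset.Iio s, ff P.η (signed σ ν i) (P.ξ0 k)) *
      ((∏ i ∈ α, P.bulk.a (signed σ ν i)) * (∏ k ∈ Finset.Iio s \ γ, P.bulk.a (P.ξ0 k)) *
        ((∏ j ∈ α, ∏ i ∈ (Finset.univ \ D) \ α, ff P.η (signed σ ν i) (signed σ ν j)) *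
          chat P.η (exW P.η (betheRatio P.η ((Finset.univ.erase (Fin.last M)).image (signed σ ν)))
            ((Finset.univ \ D).image (signed σ ν)) (α.image (signed σ ν)))
            (α.image (signed σ ν)) (γ.image P.ξ0) *
          ∏ k ∈ Finset.Iio s \ γ, (∏ i ∈ (Finset.univ \ D) \ α,
            ff P.η (signed σ ν i) (P.ξ0 k)) * ∏ i ∈ γ, ff P.η (P.ξ0 i) (P.ξ0 k))) := by
  have hX : Function.Injective (signed σ ν) := fun i j h =>
    hg.sign.injOn σ (Finset.mem_coe.2 (Finset.mem_univ i)) (Finset.mem_coe.2 (Finset.mem_univ j)) h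
  have hlt : ∀ k ∈ γ, k < s := fun k hk => Finset.mem_Iio.1 (hγ hk)
  have hs : s ∉ γ := fun h => lt_irrefl s (hlt s h)
  rw [P.S_eq_chat hs hX hg.inj (fun j _ k hk => sub_ne_zero.2 (hg.ne σ j k (hlt k hk)).symm)
    (fun j _ k hk => hg.shift_right σ hσ j k (hlt k hk))
    (fun j _ k hk => hg.shift_left σ j k (hlt k hk)) fun j hj => P.exW_eq_wS hg hσ hα hj]
  set B := Finset.univ \ D with hB
  set w := exW P.η (betheRatio P.η ((Finset.univ.erase (Fin.last M)).image (signed σ ν)))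
            (B.image (signed σ ν)) (α.image (signed σ ν))
  have hR := P.R_eq hg σ hγ α (B \ α)
  -- The mixed factors needed to join `H` over `α` and over `B \ α` are the ones provided by `R_eq`.
  have hH := P.H_union (Finset.disjoint_sdiff : Disjoint α (B \ α)) σ ν
  rw [Finset.union_sdiff_of_subset hα] at hH
  have hH' : P.H B σ ν = P.H α σ ν * P.H (B \ α) σ ν *
    ∏ j ∈ α, ∏ i ∈ B \ α, P.cross (signed σ ν j) (signed σ ν i) := hH
  have hγ0 := hg.H_ne γ fun k hk => (hlt k hk).le
  have hff : ∀ i, ∀ k ∈ Finset.Iio s, ff P.η (signed σ ν i) (P.ξ0 k) ≠ 0 := fun i k hk =>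
    ff_ne_zero (hg.shift_left σ i k (Finset.mem_Iio.1 hk)) (hg.ne σ i k (Finset.mem_Iio.1 hk))
  have n1 : ∏ k ∈ Finset.Iio s, P.a (P.ξ0 k) ≠ 0 := Finset.prod_ne_zero_iff.2 fun k _ => hg.a_ne k
  have n2 : ∏ i ∈ α, ∏ k ∈ Finset.Iio s, ff P.η (signed σ ν i) (P.ξ0 k) ≠ 0 :=
    Finset.prod_ne_zero_iff.2 fun i _ => Finset.prod_ne_zero_iff.2 (hff i)
  have n3 : ∏ i ∈ B \ α, ∏ k ∈ γ, ff P.η (signed σ ν i) (P.ξ0 k) ≠ 0 :=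
    Finset.prod_ne_zero_iff.2 fun i _ => Finset.prod_ne_zero_iff.2 fun k hk => hff i k (hγ hk)
  have n4 : ∏ i ∈ B \ α, ∏ k ∈ Finset.Iio s \ γ, ff P.η (signed σ ν i) (P.ξ0 k) ≠ 0 :=
    Finset.prod_ne_zero_iff.2 fun i _ => Finset.prod_ne_zero_iff.2 fun k hk =>
      hff i k (Finset.sdiff_subset hk)
  have e1 : ∏ i ∈ B, ∏ k ∈ Finset.Iio s, ff P.η (signed σ ν i) (P.ξ0 k) =
      (∏ i ∈ α, ∏ k ∈ Finset.Iio s, ff P.η (signed σ ν i) (P.ξ0 k)) *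
      ((∏ i ∈ B \ α, ∏ k ∈ γ, ff P.η (signed σ ν i) (P.ξ0 k)) *
        ∏ i ∈ B \ α, ∏ k ∈ Finset.Iio s \ γ, ff P.η (signed σ ν i) (P.ξ0 k)) := by
    rw [← Finset.prod_mul_distrib, ← Finset.prod_sdiff hα, mul_comm]
    congr 1
    refine Finset.prod_congr rfl fun i _ => ?_
    rw [← Finset.prod_sdiff hγ, mul_comm]
  simp only [bulk_a]
  rw [dcoef, Finset.prod_mul_distrib (s := Finset.Iio s \ γ),
    Finset.prod_comm (s := Finset.Iio s \ γ) (t := B \ α), e1, hH']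
  have step : G * P.H α σ ν / P.H γ 1 P.ξ0 *
        P.R γ (Finset.Iio s \ γ) (fam α (signed σ ν)) (pmFam (B \ α) ν) *
        chat P.η w (α.image (signed σ ν)) (γ.image P.ξ0) *
        (P.H γ 1 P.ξ0 * (P.H (B \ α) σ ν *
          ∏ i ∈ B \ α, ∏ y ∈ γ.image P.ξ0, P.cross (signed σ ν i) y)) =
      G * P.H α σ ν * P.H (B \ α) σ ν * chat P.η w (α.image (signed σ ν)) (γ.image P.ξ0) *
        (P.R γ (Finset.Iio s \ γ) (fam α (signed σ ν)) (pmFam (B \ α) ν) *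
          ∏ i ∈ B \ α, ∏ y ∈ γ.image P.ξ0, P.cross (signed σ ν i) y) := by
    field_simp
  rw [step, hR]
  field_simp

end Chain
end OpenXXX
end

/-! ### Summation over partitions and signs. -/

open scoped Matrix
noncomputable section
namespace OpenXXX

namespace Chain

variable {N M : ℕ} (P : Chain N)

theorem signed_congr {σ σ' : Fin (M + 1) → ℤˣ} {A : Finset (Fin (M + 1))}
    (h : ∀ i ∈ A, σ i = σ' i) (ν : Fin (M + 1) → ℂ) : ∀ i ∈ A, signed σ ν i = signed σ' ν i :=
  fun i hi => by rw [signed, signed, h i hi]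

theorem fam_congr {A : Finset (Fin (M + 1))} {X Y : Fin (M + 1) → ℂ} (h : ∀ i ∈ A, X i = Y i) :
    fam A X = fam A Y := Multiset.map_congr rfl h

theorem Mentry_congr (s : Fin N) (γ : Finset (Fin N)) {α D : Finset (Fin (M + 1))}
    {X Y : Fin (M + 1) → ℂ} (h : ∀ i ∈ D ∪ α, X i = Y i) {j : Fin (M + 1)} (hj : j ∈ α)
    (k : Fin N) : P.Mentry s γ α D X j k = P.Mentry s γ α D Y j k := by
  have h1 : fam (α.erase j ∪ D) X = fam (α.erase j ∪ D) Y := fam_congr fun i hi => h i (by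
    simp only [Finset.mem_union, Finset.mem_erase] at hi ⊢
    tauto)
  rw [Mentry, Mentry, h1, h j (by simp [hj])]

theorem S_congr (s : Fin N) (γ : Finset (Fin N)) {α D : Finset (Fin (M + 1))}
    {X Y : Fin (M + 1) → ℂ} (h : ∀ i ∈ D ∪ α, X i = Y i) :
    P.S s γ α D X = P.S s γ α D Y := by
  have hα : ∀ i ∈ α, X i = Y i := fun i hi => h i (by simp [hi])
  unfold S
  congr 1
  · congr 1
    · exact Finset.prod_congr rfl fun k _ => Finset.prod_congr rfl fun j hj => by rw [hα j hj]
    · congr 1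
      refine Finset.prod_congr rfl fun i hi => Finset.prod_congr rfl fun j hj => ?_
      rw [hα i hi, hα j (Finset.mem_of_mem_filter j hj)]
  · split_ifs with hc
    · congr 1
      ext j k
      exact P.Mentry_congr s γ h (α.orderEmbOfFin_mem hc j) _
    · rfl

/-- The boundary expansion over the partitions of the complement of `D`, as a sum over all signs of
bulk states. -/
theorem boundary_sum {s : Fin N} {ν : Fin (M + 1) → ℂ} (hg : P.Generic s ν)
    (D : Finset (Fin (M + 1))) (G : (Fin (M + 1) → ℤˣ) → ℂ)
    (hG : ∀ σ σ', (∀ i ∈ D, σ i = σ' i) → G σ = G σ')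
    (hG0 : Fin.last M ∈ D → ∀ σ : Fin (M + 1) → ℤˣ, σ (Fin.last M) = -1 → G σ = 0)
    {n : ℕ} (hn : min (Finset.univ \ D).card (s : ℕ) ≤ n) :
    ∑ m ∈ Finset.range (n + 1), ∑ α ∈ Finset.powersetCard m (Finset.univ \ D),
      ∑ γ ∈ Finset.powersetCard m (Finset.Iio s),
        (∑ σ ∈ signs (D ∪ α), G σ * P.H α σ ν / P.H γ 1 P.ξ0 *
          P.R γ (Finset.Iio s \ γ) (fam α (signed σ ν)) (pmFam ((Finset.univ \ D) \ α) ν) *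
          P.S s γ α D (signed σ ν)) • P.newState ν ((Finset.univ \ D) \ α) γ =
    ∑ σ ∈ signs (Finset.univ.erase (Fin.last M)),
      (G σ * P.H (Finset.univ \ D) σ ν / ((∏ k ∈ Finset.Iio s, P.a (P.ξ0 k)) *
        ∏ i ∈ Finset.univ \ D, ∏ k ∈ Finset.Iio s, ff P.η (signed σ ν i) (P.ξ0 k))) •
      P.bulk.exState (betheRatio P.η ((Finset.univ.erase (Fin.last M)).image (signed σ ν)))
        ((Finset.Iio s).image P.ξ0) ((Finset.univ \ D).image (signed σ ν)) := by
  rw [sum_powersetCard_range _ _ (by rwa [Fin.card_Iio])]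
  swap
  · intro α γ h
    rw [Finset.sum_eq_zero, zero_smul]
    intro σ _
    rw [S, dif_neg h, mul_zero, mul_zero]
  set B := Finset.univ \ D with hB
  -- A negative sign at the last index produces the factor `d (ξ0 s) = 0`, so this sign may be fixed
  -- to `+`.
  have hlast : ∀ σ : Fin (M + 1) → ℤˣ, σ (Fin.last M) = -1 → ∀ A, Fin.last M ∈ A →
      P.H A σ ν = 0 := by
    intro σ hσ A hA
    refine P.H_eq_zero hA ?_
    rw [hσ, hg.last]
    simpa using P.d_ξ0 s
  have hterm : ∀ γ ∈ (Finset.Iio s).powerset, ∀ α ∈ B.powerset,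
      (∑ σ ∈ signs (D ∪ α), G σ * P.H α σ ν / P.H γ 1 P.ξ0 *
          P.R γ (Finset.Iio s \ γ) (fam α (signed σ ν)) (pmFam (B \ α) ν) *
          P.S s γ α D (signed σ ν)) • P.newState ν (B \ α) γ =
      ∑ σ ∈ signs (Finset.univ.erase (Fin.last M)),
        (G σ * P.H α σ ν / P.H γ 1 P.ξ0 *
          P.R γ (Finset.Iio s \ γ) (fam α (signed σ ν)) (pmFam (B \ α) ν) *
          P.S s γ α D (signed σ ν)) • ((P.H γ 1 P.ξ0 * P.dcoef (B \ α) (γ.image P.ξ0) σ ν) •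
          P.bulk.Φ (γ.image P.ξ0 ∪ (B \ α).image (signed σ ν))) := by
    intro γ hγ α hα
    have hγ' := Finset.mem_powerset.1 hγ
    have hα' := Finset.mem_powerset.1 hα
    have hαD : ∀ i ∈ α, i ∉ D := fun i hi => (Finset.mem_sdiff.1 (hα' hi)).2
    have hdis : Disjoint (D ∪ α) (B \ α) := by
      refine Finset.disjoint_left.2 fun i hi hi' => ?_
      simp only [hB, Finset.mem_union, Finset.mem_sdiff, Finset.mem_univ, true_and] at hi hi'
      tauto
    -- The signs on `D ∪ α` come from the coefficient, those on the complement from the state;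
    -- together they form one sum over all signs.
    have huniv : D ∪ α ∪ (B \ α) = Finset.univ := by
      ext i
      have := hαD i
      simp only [hB, Finset.mem_union, Finset.mem_sdiff, Finset.mem_univ, true_and]
      tauto
    rw [P.newState_eq hg _ fun k hk => Finset.mem_Iio.1 (hγ' hk), sum_signs_union hdis, huniv,
      sum_signs_univ]
    · intro σ hσ
      have hmem : Fin.last M ∈ D ∪ α ∪ (B \ α) := huniv ▸ Finset.mem_univ _
      rw [Finset.mem_union, Finset.mem_union] at hmem
      rcases hmem with (h | h) | h
      · rw [hG0 h σ hσ]; simp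
      · rw [hlast σ hσ α h]; simp
      · rw [dcoef, hlast σ hσ _ h]; simp
    · intro σ σ' h
      have hα2 : ∀ i ∈ α, σ i = σ' i := fun i hi => h i (by simp [hi])
      rw [hG σ σ' fun i hi => h i (by simp [hi]), P.H_congr hα2,
        fam_congr (signed_congr hα2 ν), P.S_congr s γ (signed_congr h ν)]
    · intro σ σ' h
      have e1 : (B \ α).image (signed σ ν) = (B \ α).image (signed σ' ν) :=
        Finset.image_congr fun i hi => signed_congr h ν i hi
      rw [dcoef, dcoef, P.H_congr h, e1, Finset.prod_congr rfl fun i hi =>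
        Finset.prod_congr rfl fun y _ => by rw [signed_congr h ν i hi]]
  rw [Finset.sum_congr rfl fun γ hγ => Finset.sum_congr rfl (hterm γ hγ)]
  have hswap : ∀ T : Finset (Fin N) → Finset (Fin (M + 1)) → (Fin (M + 1) → ℤˣ) →
      ((Fin N → Fin 2) → ℂ), ∑ γ ∈ (Finset.Iio s).powerset, ∑ α ∈ B.powerset,
        ∑ σ ∈ signs (Finset.univ.erase (Fin.last M)), T γ α σ =
      ∑ σ ∈ signs (Finset.univ.erase (Fin.last M)), ∑ γ ∈ (Finset.Iio s).powerset,
        ∑ α ∈ B.powerset, T γ α σ := fun T => by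
    rw [Finset.sum_comm]
    simp only [Finset.sum_comm (s := (Finset.Iio s).powerset)
      (t := signs (Finset.univ.erase (Fin.last M)))]
    rw [Finset.sum_comm]
    refine Finset.sum_congr rfl fun σ _ => Finset.sum_comm
  rw [hswap]
  refine Finset.sum_congr rfl fun σ hσ => ?_
  have hσ1 : σ (Fin.last M) = 1 := mem_signs.1 hσ _ (Finset.notMem_erase _ _)
  have hX : Function.Injective (signed σ ν) := fun i j h =>
    hg.sign.injOn σ (Finset.mem_coe.2 (Finset.mem_univ i)) (Finset.mem_coe.2 (Finset.mem_univ j)) h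
  -- For fixed signs, the sum over `γ` and `α` is a single vector `exState`.
  rw [P.bulk.exState_image hX hg.inj _ _ _ fun i _ k hk => hg.ne σ i k (Finset.mem_Iio.1 hk),
    Finset.smul_sum]
  refine Finset.sum_congr rfl fun γ hγ => ?_
  rw [Finset.smul_sum]
  refine Finset.sum_congr rfl fun α hα => ?_
  rw [smul_smul, smul_smul, P.term_eq hg hσ1 (Finset.mem_powerset.1 hα) (Finset.mem_powerset.1 hγ)]

end Chain
end OpenXXX
end

/-! ### The bulk formulas for signed parameters. -/

open scoped Matrix
noncomputable section
namespace OpenXXX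

namespace Chain

variable {N M : ℕ} {P : Chain N} {s : Fin N} {ν : Fin (M + 1) → ℂ}

theorem H_singleton {ι : Type} [LinearOrder ι] (i : ι) (σ : ι → ℤˣ) (lam : ι → ℂ) :
    P.H {i} σ lam = P.hfac (σ i) (lam i) := by
  rw [← insert_empty_eq, H_insert P (Finset.notMem_empty i), H_empty]
  simp

/-- The indices of `μ₁, …, μ_M`. -/
abbrev bulkIndex (M : ℕ) : Finset (Fin (M + 1)) := Finset.univ.erase (Fin.last M)

theorem Generic.signed_injective (hg : P.Generic s ν) (σ : Fin (M + 1) → ℤˣ) :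
    Function.Injective (signed σ ν) := fun i j h =>
  hg.sign.injOn σ (Finset.mem_coe.2 (Finset.mem_univ i)) (Finset.mem_coe.2 (Finset.mem_univ j)) h

theorem Generic.signed_last (hg : P.Generic s ν) {σ : Fin (M + 1) → ℤˣ}
    (hσ : σ (Fin.last M) = 1) : signed σ ν (Fin.last M) = P.ξ0 s := by
  rw [signed, hσ, hg.last]; simp

/-- Reversing the sign of the variable `i` turns the numerator into minus a shifted difference,
which is nonzero by `shift`. -/
theorem Generic.cross_ne (hg : P.Generic s ν) (σ : Fin (M + 1) → ℤˣ) {i : Fin (M + 1)} (hi : i ≠ Fin.last M) :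
    P.cross (signed σ ν i) (P.ξ0 s) ≠ 0 := by
  have h1 := hg.shift (Function.update (-σ) (Fin.last M) 1) (Function.update_self _ _ _) i
    (Fin.last M)
  rw [signed_update_of_ne hi, signed_update_self, hg.last] at h1
  have h2 := hg.sign.2 i (Finset.mem_univ i) (Fin.last M) (Finset.mem_univ _) hi (σ i) 1
  rw [hg.last] at h2
  simp only [signed, Pi.neg_apply] at h1
  push_cast at h1 h2
  rw [one_mul] at h1 h2
  refine div_ne_zero (fun h => h1 ?_) h2
  rw [signed] at h
  linear_combination -h

theorem Generic.points (hg : P.Generic s ν) {σ : Fin (M + 1) → ℤˣ}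
    (hσ : σ (Fin.last M) = 1) : GenericPoints P.η ((bulkIndex M).image (signed σ ν)) (P.ξ0 s)
      ((Finset.Iio s).image P.ξ0) := by
  have hins : ∀ p ∈ insert (P.ξ0 s) ((bulkIndex M).image (signed σ ν)), ∃ i, signed σ ν i = p := by
    intro p hp
    rcases Finset.mem_insert.1 hp with rfl | hp
    · exact ⟨_, hg.signed_last hσ⟩
    · obtain ⟨i, _, rfl⟩ := Finset.mem_image.1 hp
      exact ⟨i, rfl⟩
  refine ⟨fun p hp q hq => ?_, fun h => ?_, fun h => ?_, ?_, fun y hy z hz => ?_⟩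
  · obtain ⟨i, rfl⟩ := hins p hp
    obtain ⟨j, rfl⟩ := hins q hq
    exact hg.shift σ hσ i j
  · obtain ⟨i, hi, hi'⟩ := Finset.mem_image.1 h
    rw [← hg.signed_last hσ] at hi'
    exact Finset.ne_of_mem_erase hi (hg.signed_injective σ hi')
  · obtain ⟨k, hk, hk'⟩ := Finset.mem_image.1 h
    exact (Finset.mem_Iio.1 hk).ne (hg.inj hk')
  · refine Finset.disjoint_left.2 fun z hz hz' => ?_
    obtain ⟨i, _, rfl⟩ := Finset.mem_image.1 hz
    obtain ⟨k, hk, hk'⟩ := Finset.mem_image.1 hz'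
    exact hg.ne σ i k (Finset.mem_Iio.1 hk) hk'.symm
  · obtain ⟨i, _, rfl⟩ := Finset.mem_image.1 hz
    obtain ⟨k, hk, rfl⟩ := Finset.mem_image.1 hy
    exact hg.shift_right σ hσ i k (Finset.mem_Iio.1 hk)

/-- The common prefactor of the bulk formulas. -/
def prefactor (P : Chain N) (s : Fin N) (X : Fin (M + 1) → ℂ) : ℂ :=
  P.a (P.ξ0 s) * (∏ k ∈ Finset.Iio s, P.a (P.ξ0 k)) *
    ((∏ i ∈ bulkIndex M, ff P.η (X i) (P.ξ0 s)) *
      ∏ i ∈ bulkIndex M, ∏ k ∈ Finset.Iio s, ff P.η (X i) (P.ξ0 k))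

theorem Generic.ff_ne (hg : P.Generic s ν) {σ : Fin (M + 1) → ℤˣ} (hσ : σ (Fin.last M) = 1)
    {i j : Fin (M + 1)} (hij : i ≠ j) : ff P.η (signed σ ν i) (signed σ ν j) ≠ 0 :=
  ff_ne_zero (hg.shift σ hσ i j) ((hg.signed_injective σ).ne hij)

theorem Generic.prod_ff_ne (hg : P.Generic s ν) (σ : Fin (M + 1) → ℤˣ) (i : Fin (M + 1)) :
    ∏ k ∈ Finset.Iio s, ff P.η (signed σ ν i) (P.ξ0 k) ≠ 0 :=
  Finset.prod_ne_zero_iff.2 fun k hk => ff_ne_zero (hg.shift_left σ i k (Finset.mem_Iio.1 hk))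
    (hg.ne σ i k (Finset.mem_Iio.1 hk))

theorem Generic.prefactor_ne (hg : P.Generic s ν) {σ : Fin (M + 1) → ℤˣ}
    (hσ : σ (Fin.last M) = 1) : P.prefactor s (signed σ ν) ≠ 0 := by
  refine mul_ne_zero (mul_ne_zero (hg.a_ne s) (Finset.prod_ne_zero_iff.2 fun k _ => hg.a_ne k))
    (mul_ne_zero (Finset.prod_ne_zero_iff.2 fun i hi => ?_)
      (Finset.prod_ne_zero_iff.2 fun i _ => hg.prod_ff_ne σ i))
  rw [← hg.signed_last hσ]
  exact hg.ff_ne hσ (Finset.ne_of_mem_erase hi)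

theorem Generic.insert_image (hg : P.Generic s ν) {σ : Fin (M + 1) → ℤˣ}
    (hσ : σ (Fin.last M) = 1) : insert (P.ξ0 s) ((bulkIndex M).image (signed σ ν)) =
      Finset.univ.image (signed σ ν) := by
  rw [← hg.signed_last hσ, ← Finset.image_insert, Finset.insert_erase (Finset.mem_univ _)]

theorem Generic.bulk_apply (hg : P.Generic s ν) {σ : Fin (M + 1) → ℤˣ}
    (hσ : σ (Fin.last M) = 1) {X : Module.End ℂ ((Fin N → Fin 2) → ℂ)} {ι : Type} {S : Finset ι}
    {D : ι → Finset ℂ} {k : ι → ℂ}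
    (h : P.bulk.BulkFormula ((bulkIndex M).image (signed σ ν)) (P.ξ0 s)
      ((Finset.Iio s).image P.ξ0) X S D k) :
    P.prefactor s (signed σ ν) • X (P.bulk.Φ ((bulkIndex M).image (signed σ ν))) =
    ∑ i ∈ S, ((∏ z ∈ D i, P.bulk.a z) * k i) •
      P.bulk.exState (betheRatio P.η ((bulkIndex M).image (signed σ ν)))
        ((Finset.Iio s).image P.ξ0) (Finset.univ.image (signed σ ν) \ D i) := by
  rw [HighestWeight.BulkFormula] at h
  rw [← hg.insert_image hσ, ← h]
  congr 1
  have hs := (hg.points hσ).x_notMem_K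
  rw [Finset.prod_insert hs, Finset.prod_insert hs, Finset.prod_image hg.inj.injOn,
    Finset.prod_image hg.inj.injOn, Finset.prod_image (hg.signed_injective σ).injOn]
  simp only [Finset.prod_image (hg.signed_injective σ).injOn, bulk_a]
  rw [Finset.prod_comm (s := Finset.Iio s), prefactor]

theorem Generic.points_inj (hg : P.Generic s ν) : ∀ j ≤ s, ∀ k ≤ s, P.ξ0 j = P.ξ0 k → j = k :=
  fun _ _ _ _ h => hg.inj h

theorem mem_image_Iio (P : Chain N) (s : Fin N) (y : ℂ) :
    y ∈ (Finset.Iio s).image P.ξ0 ↔ ∃ k < s, P.ξ0 k = y := by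
  simp

theorem sum_bulkIndex {V : Type} [AddCommMonoid V] (F : Fin (M + 1) → V) :
    ∑ i ∈ bulkIndex M, F i = ∑ a : Fin M, F a.castSucc := by
  rw [show bulkIndex M = Finset.univ.map Fin.castSuccEmb by
    ext i
    simp only [Finset.mem_erase, Finset.mem_univ, and_true, Finset.mem_map, true_and]
    refine Fin.lastCases ?_ (fun i => ?_) i
    · simp
    · simp, Finset.sum_map]
  rfl

/-- The action of the local operators on `Φ`, over index sets. -/
theorem Generic.minus_apply (hg : P.Generic s ν) {σ : Fin (M + 1) → ℤˣ}
    (hσ : σ (Fin.last M) = 1) :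
    siteUnit s 1 0 (P.bulk.Φ ((bulkIndex M).image (signed σ ν))) =
      (P.prefactor s (signed σ ν))⁻¹ •
        P.bulk.exState (betheRatio P.η ((bulkIndex M).image (signed σ ν)))
          ((Finset.Iio s).image P.ξ0) (Finset.univ.image (signed σ ν)) := by
  have h := hg.bulk_apply hσ (bulk_minus (b := P.b / 2) hg.hη P.ξ0 s hg.points_inj
    (mem_image_Iio P s) (hg.points hσ))
  rw [eq_inv_smul_iff₀ (hg.prefactor_ne hσ), h]
  simp

theorem Generic.E22_apply (hg : P.Generic s ν) {σ : Fin (M + 1) → ℤˣ}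
    (hσ : σ (Fin.last M) = 1) :
    siteUnit s 1 1 (P.bulk.Φ ((bulkIndex M).image (signed σ ν))) =
      ∑ a : Fin M, ((P.prefactor s (signed σ ν))⁻¹ * (P.a (signed σ ν a.castSucc) *
        SpinChain.removeD P.η ((bulkIndex M).image (signed σ ν)) (P.ξ0 s)
          (signed σ ν a.castSucc))) •
        P.bulk.exState (betheRatio P.η ((bulkIndex M).image (signed σ ν)))
          ((Finset.Iio s).image P.ξ0) ((Finset.univ \ {a.castSucc}).image (signed σ ν)) := by
  have h := hg.bulk_apply hσ (bulk_E22 (b := P.b / 2) hg.hη P.ξ0 s hg.points_inj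
    (mem_image_Iio P s) (hg.points hσ))
  refine smul_right_injective _ (hg.prefactor_ne hσ) ?_
  beta_reduce
  rw [h, Finset.sum_image (hg.signed_injective σ).injOn, sum_bulkIndex, Finset.smul_sum]
  refine Finset.sum_congr rfl fun a _ => ?_
  rw [smul_smul, mul_inv_cancel_left₀ (hg.prefactor_ne hσ), Finset.prod_singleton, bulk_a,
    Finset.image_sdiff _ _ (hg.signed_injective σ), Finset.image_singleton]

theorem Generic.plus_apply (hg : P.Generic s ν) {σ : Fin (M + 1) → ℤˣ}
    (hσ : σ (Fin.last M) = 1) :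
    siteUnit s 0 1 (P.bulk.Φ ((bulkIndex M).image (signed σ ν))) =
      ∑ a : Fin M, ∑ p ∈ Finset.univ.erase a.castSucc, ((P.prefactor s (signed σ ν))⁻¹ *
        (P.a (signed σ ν a.castSucc) * P.a (signed σ ν p) *
        SpinChain.removeC P.η ((bulkIndex M).image (signed σ ν)) (P.ξ0 s)
          (signed σ ν a.castSucc) (signed σ ν p))) •
        P.bulk.exState (betheRatio P.η ((bulkIndex M).image (signed σ ν)))
          ((Finset.Iio s).image P.ξ0) ((Finset.univ \ {a.castSucc, p}).image (signed σ ν)) := by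
  have h := hg.bulk_apply hσ (bulk_plus (b := P.b / 2) hg.hη P.ξ0 s hg.points_inj
    (mem_image_Iio P s) (hg.points hσ))
  refine smul_right_injective _ (hg.prefactor_ne hσ) ?_
  beta_reduce
  rw [h, Finset.sum_sigma, Finset.sum_image (hg.signed_injective σ).injOn, sum_bulkIndex,
    Finset.smul_sum]
  refine Finset.sum_congr rfl fun a _ => ?_
  rw [hg.insert_image hσ, ← Finset.image_erase (hg.signed_injective σ),
    Finset.sum_image (hg.signed_injective σ).injOn, Finset.smul_sum]
  refine Finset.sum_congr rfl fun p hp => ?_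
  rw [smul_smul, mul_inv_cancel_left₀ (hg.prefactor_ne hσ), Finset.prod_pair
    ((hg.signed_injective σ).ne (Finset.ne_of_mem_erase hp).symm), bulk_a, bulk_a,
    Finset.image_sdiff _ _ (hg.signed_injective σ), Finset.image_insert, Finset.image_singleton]

/-- The boundary state of the parameters `μ`. -/
theorem Generic.sepState_eq (hg : P.Generic s ν) (μ : Fin M → ℂ)
    (hμ : ∀ i, ν i.castSucc = μ i) : P.sepState (List.ofFn μ) =
      ∑ σ ∈ signs (bulkIndex M), P.H (bulkIndex M) σ ν •
        P.bulk.Φ ((bulkIndex M).image (signed σ ν)) := by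
  set l := (List.finRange M).map Fin.castSucc with hl
  have hlA : l.toFinset = bulkIndex M := by
    ext i
    simp only [hl, List.mem_toFinset, List.mem_map, List.mem_finRange, true_and, Finset.mem_erase,
      Finset.mem_univ, and_true]
    refine Fin.lastCases ?_ (fun i => ?_) i <;> simp
  have h := P.boundary_decomposition hg.hη hg.hζ (Γ := ∅) (ν := ν) (by simp) l
    ((List.nodup_finRange M).map (Fin.castSucc_injective M)) (hg.sign.mono (Finset.subset_univ _))
    (by simp)
  have hv : P.bulk.Φ ∅ = vacuum N := HighestWeight.Φ_empty _
  have hlist : (List.ofFn μ).map P.Bplus = l.map fun i => P.Bplus (ν i) := by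
    rw [hl, List.map_map, List.ofFn_eq_map, List.map_map]
    exact List.map_congr_left fun i _ => by simp [hμ]
  rw [sepState, hlist, ← hv, h, hlA]
  refine Finset.sum_congr rfl fun σ _ => ?_
  rw [dcoef, Finset.empty_union]
  simp

theorem siteOp_single_mulVec (X : Matrix (Fin 2) (Fin 2) ℂ) (i j : Fin 2)
    (hX : X = Matrix.single i j 1) (v : (Fin N → Fin 2) → ℂ) :
    siteOp s X *ᵥ v = siteUnit s i j v := by
  rw [siteOp_mulVec, hX, siteUnit]

end Chain
end OpenXXX
end

/-! ### Matching the weights of the three expansions. -/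

open scoped Matrix
noncomputable section
namespace OpenXXX

namespace Chain

variable {N M : ℕ} {P : Chain N} {s : Fin N} {ν : Fin (M + 1) → ℂ}

theorem fProd_pmFam_singleton (P : Chain N) (A : Finset (Fin (M + 1))) (ν : Fin (M + 1) → ℂ)
    (σ : Fin (M + 1) → ℤˣ) (y : ℂ) : P.fProd (pmFam A ν) {y} =
      (∏ i ∈ A, ff P.η (signed σ ν i) y) * ∏ i ∈ A, P.cross (signed σ ν i) y := by
  have h := P.fProd_pmFam A ν σ ({()} : Finset Unit) fun _ => y
  have e : fam ({()} : Finset Unit) (fun _ => y) = {y} := by simp [fam]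
  rw [e] at h
  simpa only [Finset.prod_singleton, ← cross_eq_ff] using h

/-- As `ξ1 = ξ0 - η`, the factor `f(ξ1|x)` is inverse to `f(x|ξ0)`. -/
theorem Generic.prod_ξ1 (hg : P.Generic s ν) (σ : Fin (M + 1) → ℤˣ) (i : Fin (M + 1)) :
    ∏ k ∈ Finset.Iio s, ff P.η (P.ξ1 k) (signed σ ν i) =
      (∏ k ∈ Finset.Iio s, ff P.η (signed σ ν i) (P.ξ0 k))⁻¹ := by
  rw [← Finset.prod_inv_distrib]
  refine Finset.prod_congr rfl fun k hk => ?_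
  have hk' := Finset.mem_Iio.1 hk
  have h1 : signed σ ν i - P.ξ0 k ≠ 0 := sub_ne_zero.2 (hg.ne σ i k hk')
  have h2 := hg.shift_left σ i k hk'
  have h3 : P.ξ1 k - signed σ ν i ≠ 0 := by
    intro h
    refine h2 ?_
    simp only [ξ0, ξ1] at h ⊢
    linear_combination -h
  have h4 : P.ξ1 k = P.ξ0 k - P.η := by
    simp only [ξ0, ξ1]; ring
  rw [h4] at h3 ⊢
  unfold ff
  field_simp
  ring

theorem Generic.tau_eq (hg : P.Generic s ν) (σ : Fin (M + 1) → ℤˣ) (A : Finset (Fin (M + 1))) (j : Fin (M + 1)) :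
    P.τ {signed σ ν j} (pmFam A ν + fam (Finset.Iio s) P.ξ1) = P.a (signed σ ν j) *
      ((∏ i ∈ A, ff P.η (signed σ ν i) (signed σ ν j)) *
        (∏ i ∈ A, P.cross (signed σ ν j) (signed σ ν i)) *
        (∏ k ∈ Finset.Iio s, ff P.η (signed σ ν j) (P.ξ0 k))⁻¹) := by
  rw [τ, fProd_add, P.fProd_pmFam_singleton A ν σ, fProd_fam_singleton, hg.prod_ξ1 σ]
  simp [P.cross_comm]

/-- The weight of the `σ⁻` expansion. -/
def weightMinus (P : Chain N) (s : Fin N) (ν : Fin (M + 1) → ℂ) : ℂ :=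
  1 / (P.H {s} 1 P.ξ0 * P.τ {P.ξ0 s} (pmFam (bulkIndex M) ν + fam (Finset.Iio s) P.ξ1))

/-- The weight of the `E²²` expansion. -/
def weight22 (P : Chain N) (s : Fin N) (ν : Fin (M + 1) → ℂ) (a : Fin (M + 1))
    (σ : Fin (M + 1) → ℤˣ) : ℂ :=
  P.η * P.τ {signed σ ν a} (pmFam ((bulkIndex M).erase a) ν + fam (Finset.Iio s) P.ξ1) /
      ((signed σ ν a - P.ξ1 s) * P.τ {P.ξ0 s}
        (pmFam ((bulkIndex M).erase a) ν + fam (Finset.Iio s) P.ξ1)) *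
    (P.H {a} σ ν / P.H {s} 1 P.ξ0)

/-- The weight of the `σ⁺` expansion. -/
def weightPlus (P : Chain N) (s : Fin N) (ν : Fin (M + 1) → ℂ) (a p : Fin (M + 1))
    (σ : Fin (M + 1) → ℤˣ) : ℂ :=
  P.weight22 s ν a σ * (P.H {p} σ ν * (P.η * P.τ {signed σ ν p}
    (pmFam ((Finset.univ.erase a).erase p) ν + fam (Finset.Iio s) P.ξ1) /
      (P.ξ0 s - signed σ ν p + P.η)))

theorem Generic.H_site (hg : P.Generic s ν) {σ : Fin (M + 1) → ℤˣ}
    (hσ : σ (Fin.last M) = 1) :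
    P.hfac (σ (Fin.last M)) (ν (Fin.last M)) = P.H {s} 1 P.ξ0 := by
  rw [H_singleton, hσ, hg.last]; rfl

theorem Generic.H_erase (A : Finset (Fin (M + 1))) {i : Fin (M + 1)} (hi : i ∈ A)
    (σ : Fin (M + 1) → ℤˣ) : P.H A σ ν = P.hfac (σ i) (ν i) *
      (∏ j ∈ A.erase i, P.cross (signed σ ν i) (signed σ ν j)) * P.H (A.erase i) σ ν := by
  conv_lhs => rw [← Finset.insert_erase hi]
  exact H_insert P (Finset.notMem_erase _ _) σ ν

theorem Generic.prod_cross_ne (hg : P.Generic s ν) {σ : Fin (M + 1) → ℤˣ}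
    (hσ : σ (Fin.last M) = 1) {A : Finset (Fin (M + 1))} (hA : Fin.last M ∉ A) :
    ∏ i ∈ A, P.cross (signed σ ν (Fin.last M)) (signed σ ν i) ≠ 0 :=
  Finset.prod_ne_zero_iff.2 fun i hi => by
    rw [cross_comm, hg.signed_last hσ]
    exact hg.cross_ne σ fun h => hA (h ▸ hi)

/-- Enlarging `H` by the last index costs the factor of the site `s` and the mixed factors. These,
together with the `ff` factors at `ξ0 s`, are what `τ` of `ξ0 s` contains. -/
theorem Generic.weightMinus_eq (hg : P.Generic s ν) {σ : Fin (M + 1) → ℤˣ}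
    (hσ : σ (Fin.last M) = 1) :
    P.H (bulkIndex M) σ ν * (P.prefactor s (signed σ ν))⁻¹ =
      P.weightMinus s ν * P.H Finset.univ σ ν / ((∏ k ∈ Finset.Iio s, P.a (P.ξ0 k)) *
        ∏ i, ∏ k ∈ Finset.Iio s, ff P.η (signed σ ν i) (P.ξ0 k)) := by
  have hl := hg.signed_last hσ
  have h1 := hg.tau_eq σ (bulkIndex M) (Fin.last M)
  have h2 := Generic.H_erase (P := P) (ν := ν) Finset.univ (Finset.mem_univ (Fin.last M)) σ
  have n0 : P.H {s} 1 P.ξ0 ≠ 0 := hg.H_ne _ (by simp)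
  have n1 := hg.prod_cross_ne hσ (Finset.notMem_erase (Fin.last M) Finset.univ)
  have n2 := hg.prod_ff_ne σ (Fin.last M)
  have n3 : ∏ i ∈ bulkIndex M, ff P.η (signed σ ν i) (signed σ ν (Fin.last M)) ≠ 0 :=
    Finset.prod_ne_zero_iff.2 fun i hi => hg.ff_ne hσ (Finset.ne_of_mem_erase hi)
  have n4 : ∏ i ∈ bulkIndex M, ∏ k ∈ Finset.Iio s, ff P.η (signed σ ν i) (P.ξ0 k) ≠ 0 :=
    Finset.prod_ne_zero_iff.2 fun i _ => hg.prod_ff_ne σ i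
  have n5 : ∏ k ∈ Finset.Iio s, P.a (P.ξ0 k) ≠ 0 :=
    Finset.prod_ne_zero_iff.2 fun k _ => hg.a_ne k
  have n6 := hg.a_ne s
  rw [hg.H_site hσ] at h2
  rw [weightMinus, prefactor, ← hl, h1, h2, ← Finset.mul_prod_erase Finset.univ
    (fun i => ∏ k ∈ Finset.Iio s, ff P.η (signed σ ν i) (P.ξ0 k)) (Finset.mem_univ (Fin.last M))]
  rw [← hl] at n6
  field_simp

/-- Passing from the bulk indices to all indices but `a` trades `a` for the last index; the quotient
of the two `τ` records this trade. -/
theorem Generic.weight22_eq (hg : P.Generic s ν) {σ : Fin (M + 1) → ℤˣ}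
    (hσ : σ (Fin.last M) = 1) {a : Fin (M + 1)} (ha : a ≠ Fin.last M) :
    P.H (bulkIndex M) σ ν * ((P.prefactor s (signed σ ν))⁻¹ * (P.a (signed σ ν a) *
        SpinChain.removeD P.η ((bulkIndex M).image (signed σ ν)) (P.ξ0 s) (signed σ ν a))) =
      P.weight22 s ν a σ * P.H (Finset.univ.erase a) σ ν /
        ((∏ k ∈ Finset.Iio s, P.a (P.ξ0 k)) *
        ∏ i ∈ Finset.univ.erase a, ∏ k ∈ Finset.Iio s, ff P.η (signed σ ν i) (P.ξ0 k)) := by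
  have hl := hg.signed_last hσ
  have hmem : a ∈ bulkIndex M := Finset.mem_erase.2 ⟨ha, Finset.mem_univ _⟩
  have hmem' : Fin.last M ∈ Finset.univ.erase a :=
    Finset.mem_erase.2 ⟨ha.symm, Finset.mem_univ _⟩
  have hEE : (Finset.univ.erase a).erase (Fin.last M) = (bulkIndex M).erase a :=
    Finset.erase_right_comm
  have h1 := hg.tau_eq σ ((bulkIndex M).erase a) (Fin.last M)
  have h1' := hg.tau_eq σ ((bulkIndex M).erase a) a
  have h2 := Generic.H_erase (P := P) (ν := ν) _ hmem' σ
  have h3 := Generic.H_erase (P := P) (ν := ν) _ hmem σ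
  have n0 : P.H {s} 1 P.ξ0 ≠ 0 := hg.H_ne _ (by simp)
  have n1 := hg.prod_cross_ne hσ (A := (bulkIndex M).erase a) (by simp)
  have n2 := hg.prod_ff_ne σ (Fin.last M)
  have n2' := hg.prod_ff_ne σ a
  have n3 : ∏ i ∈ (bulkIndex M).erase a, ff P.η (signed σ ν i) (signed σ ν (Fin.last M)) ≠ 0 :=
    Finset.prod_ne_zero_iff.2 fun i hi => hg.ff_ne hσ
      (Finset.ne_of_mem_erase (Finset.mem_of_mem_erase hi))
  have n4 : ∏ i ∈ (bulkIndex M).erase a, ∏ k ∈ Finset.Iio s,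
      ff P.η (signed σ ν i) (P.ξ0 k) ≠ 0 :=
    Finset.prod_ne_zero_iff.2 fun i _ => hg.prod_ff_ne σ i
  have n5 : ∏ k ∈ Finset.Iio s, P.a (P.ξ0 k) ≠ 0 :=
    Finset.prod_ne_zero_iff.2 fun k _ => hg.a_ne k
  have n6 := hg.a_ne s
  have n7 : signed σ ν a - signed σ ν (Fin.last M) ≠ 0 :=
    sub_ne_zero.2 ((hg.signed_injective σ).ne ha)
  have n8 := hg.shift σ hσ a (Fin.last M)
  have e1 : signed σ ν a - P.ξ1 s = signed σ ν a - signed σ ν (Fin.last M) + P.η := by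
    rw [hl]; simp only [ξ0, ξ1]; ring
  have n9 := hg.ff_ne hσ ha
  rw [hg.H_site hσ, hEE] at h2
  rw [weight22, prefactor, SpinChain.removeD, ← Finset.image_erase (hg.signed_injective σ),
    Finset.prod_image (hg.signed_injective σ).injOn, e1, ← hl, h1, h1', h2, h3, H_singleton,
    ← Finset.mul_prod_erase (Finset.univ.erase a)
    (fun i => ∏ k ∈ Finset.Iio s, ff P.η (signed σ ν i) (P.ξ0 k)) hmem', hEE,
    ← Finset.mul_prod_erase (bulkIndex M)
    (fun i => ∏ k ∈ Finset.Iio s, ff P.η (signed σ ν i) (P.ξ0 k)) hmem,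
    ← Finset.mul_prod_erase (bulkIndex M)
    (fun i => ff P.η (signed σ ν i) (signed σ ν (Fin.last M))) hmem]
  rw [← hl] at n6
  generalize ∏ i ∈ (bulkIndex M).erase a, ff P.η (signed σ ν i) (signed σ ν (Fin.last M)) = A1 at *
  -- The denominator of `removeD` lacks the shift by `η` present in the weight. The factor of `a` at
  -- `ξ0 s` in the prefactor makes up the difference.
  have e2 : P.η / (signed σ ν a - signed σ ν (Fin.last M)) =
      ff P.η (signed σ ν a) (signed σ ν (Fin.last M)) *
        (P.η / (signed σ ν a - signed σ ν (Fin.last M) + P.η)) := by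
    unfold ff; field_simp
  rw [e2]
  field_simp

/-- The removal of `p` after that of `a` multiplies the previous identity by one more factor `τ`. -/
theorem Generic.weightPlus_eq (hg : P.Generic s ν) {σ : Fin (M + 1) → ℤˣ}
    (hσ : σ (Fin.last M) = 1) {a p : Fin (M + 1)} (ha : a ≠ Fin.last M) (hp : p ≠ a) :
    P.H (bulkIndex M) σ ν * ((P.prefactor s (signed σ ν))⁻¹ *
        (P.a (signed σ ν a) * P.a (signed σ ν p) *
        SpinChain.removeC P.η ((bulkIndex M).image (signed σ ν)) (P.ξ0 s) (signed σ ν a)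
          (signed σ ν p))) =
      P.weightPlus s ν a p σ * P.H ((Finset.univ.erase a).erase p) σ ν /
        ((∏ k ∈ Finset.Iio s, P.a (P.ξ0 k)) *
        ∏ i ∈ (Finset.univ.erase a).erase p,
          ∏ k ∈ Finset.Iio s, ff P.η (signed σ ν i) (P.ξ0 k)) := by
  have hmem : p ∈ Finset.univ.erase a := Finset.mem_erase.2 ⟨hp, Finset.mem_univ _⟩
  have key := hg.weight22_eq hσ ha
  have h1 := hg.tau_eq σ ((Finset.univ.erase a).erase p) p
  have h2 := Generic.H_erase (P := P) (ν := ν) _ hmem σ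
  have n2 := hg.prod_ff_ne σ p
  have n5 : ∏ k ∈ Finset.Iio s, P.a (P.ξ0 k) ≠ 0 :=
    Finset.prod_ne_zero_iff.2 fun k _ => hg.a_ne k
  have n4 : ∏ i ∈ (Finset.univ.erase a).erase p, ∏ k ∈ Finset.Iio s,
      ff P.η (signed σ ν i) (P.ξ0 k) ≠ 0 :=
    Finset.prod_ne_zero_iff.2 fun i _ => hg.prod_ff_ne σ i
  have hr : SpinChain.removeC P.η ((bulkIndex M).image (signed σ ν)) (P.ξ0 s) (signed σ ν a)
      (signed σ ν p) = SpinChain.removeD P.η ((bulkIndex M).image (signed σ ν)) (P.ξ0 s)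
        (signed σ ν a) * ((∏ i ∈ (Finset.univ.erase a).erase p,
          ff P.η (signed σ ν i) (signed σ ν p)) * (P.η / (P.ξ0 s - signed σ ν p + P.η))) := by
    rw [SpinChain.removeC, hg.insert_image hσ, ← Finset.image_erase (hg.signed_injective σ),
      ← Finset.image_erase (hg.signed_injective σ), Finset.prod_image (hg.signed_injective σ).injOn]
  have step : ∀ A B C D E F : ℂ, A * (B * (C * D * (E * F))) = A * (B * (C * E)) * (D * F) := by
    intros; ring
  rw [hr, step, key, weightPlus, h1, h2, H_singleton, ← Finset.mul_prod_erase (Finset.univ.erase a)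
    (fun i => ∏ k ∈ Finset.Iio s, ff P.η (signed σ ν i) (P.ξ0 k)) hmem]
  field_simp

end Chain
end OpenXXX
end

/-! ### The three formulas and the genericity conditions. -/

open scoped Matrix
noncomputable section
namespace OpenXXX

namespace Chain

variable {N M : ℕ} {P : Chain N} {s : Fin N} {ν : Fin (M + 1) → ℂ}

theorem Iio_last (M : ℕ) : Finset.Iio (Fin.last M) = bulkIndex M := by
  ext i
  rw [Finset.mem_Iio, Fin.lt_last_iff_ne_last, bulkIndex]
  simp

theorem coeff22_eq (γ : Finset (Fin N)) (α : Finset (Fin (M + 1)))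
    (a : Fin (M + 1)) (A : Finset (Fin (M + 1))) :
    P.coeff22 s ν γ (Finset.Iio s \ γ) α a A = ∑ σ ∈ signs ({a} ∪ α),
      P.weight22 s ν a σ * P.H α σ ν / P.H γ 1 P.ξ0 *
        P.R γ (Finset.Iio s \ γ) (fam α (signed σ ν)) (pmFam A ν) *
        P.S s γ α {a} (signed σ ν) := by
  rw [coeff22, ← Finset.insert_eq, Iio_last]
  refine Finset.sum_congr rfl fun σ _ => ?_
  rw [weight22, mul_div_mul_comm (P.H α σ ν)]
  ring

theorem coeffMinus_eq (γ : Finset (Fin N)) (α A : Finset (Fin (M + 1))) :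
    P.coeffMinus s ν γ (Finset.Iio s \ γ) α A = ∑ σ ∈ signs (∅ ∪ α),
      P.weightMinus s ν * P.H α σ ν / P.H γ 1 P.ξ0 *
        P.R γ (Finset.Iio s \ γ) (fam α (signed σ ν)) (pmFam A ν) *
        P.S s γ α ∅ (signed σ ν) := by
  rw [coeffMinus, Finset.empty_union, Iio_last, Finset.sum_div]
  refine Finset.sum_congr rfl fun σ _ => ?_
  rw [weightMinus, mul_assoc (P.H γ 1 P.ξ0), ← div_div]
  ring

theorem coeffPlus_eq (γ : Finset (Fin N)) (α : Finset (Fin (M + 1)))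
    (a p : Fin (M + 1)) (A : Finset (Fin (M + 1))) :
    P.coeffPlus s ν γ (Finset.Iio s \ γ) α a p A = ∑ σ ∈ signs ({a, p} ∪ α),
      P.weightPlus s ν a p σ * P.H α σ ν / P.H γ 1 P.ξ0 *
        P.R γ (Finset.Iio s \ γ) (fam α (signed σ ν)) (pmFam A ν) *
        P.S s γ α {a, p} (signed σ ν) := by
  rw [coeffPlus, Finset.insert_union, ← Finset.insert_eq, Iio_last]
  refine Finset.sum_congr rfl fun σ _ => ?_
  rw [weightPlus, weight22]
  simp only [div_eq_mul_inv, mul_inv]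
  ring

theorem weight22_congr {a : Fin (M + 1)} {σ σ' : Fin (M + 1) → ℤˣ} (h : σ a = σ' a) :
    P.weight22 s ν a σ = P.weight22 s ν a σ' := by
  have h1 : signed σ ν a = signed σ' ν a := by rw [signed, signed, h]
  rw [weight22, weight22, h1, P.H_congr (S := {a}) (σ := σ) (σ' := σ') (by simpa using h)]

/-- Both sides are expanded over the signs of the bulk indices and agree for each choice of signs;
the other two formulas follow the same pattern. -/
theorem Generic.minus_formula (hg : P.Generic s ν) {μ : Fin M → ℂ}
    (hμ : ∀ i, ν i.castSucc = μ i) : sigmaMinus s *ᵥ P.sepState (List.ofFn μ) =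
      ∑ n ∈ Finset.range (min (s : ℕ) (M + 1) + 1),
        ∑ αp ∈ Finset.powersetCard n (Finset.univ : Finset (Fin (M + 1))),
          ∑ γp ∈ Finset.powersetCard n (Finset.Iio s),
            P.coeffMinus s ν γp (Finset.Iio s \ γp) αp (Finset.univ \ αp) •
              P.newState ν (Finset.univ \ αp) γp := by
  have key := P.boundary_sum hg ∅ (fun _ => P.weightMinus s ν) (fun _ _ _ => rfl) (by simp)
    (n := min (s : ℕ) (M + 1)) (by simp)
  simp only [coeffMinus_eq]
  rw [Finset.sdiff_empty] at key
  rw [key, hg.sepState_eq μ hμ, sigmaMinus, siteOp_single_mulVec _ 1 0 (by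
    ext i j; fin_cases i <;> fin_cases j <;> simp), map_sum]
  refine Finset.sum_congr rfl fun σ hσ => ?_
  have hσ1 : σ (Fin.last M) = 1 := mem_signs.1 hσ _ (Finset.notMem_erase _ _)
  rw [map_smul, hg.minus_apply hσ1, smul_smul, hg.weightMinus_eq hσ1]

theorem Generic.E22_formula (hg : P.Generic s ν) {μ : Fin M → ℂ}
    (hμ : ∀ i, ν i.castSucc = μ i) : E22 s *ᵥ P.sepState (List.ofFn μ) =
      ∑ a : Fin M, ∑ n ∈ Finset.range (min (s : ℕ) M + 1),
        ∑ αp ∈ Finset.powersetCard n (Finset.univ.erase a.castSucc),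
          ∑ γp ∈ Finset.powersetCard n (Finset.Iio s),
            P.coeff22 s ν γp (Finset.Iio s \ γp) αp a.castSucc
                (Finset.univ.erase a.castSucc \ αp) •
              P.newState ν (Finset.univ.erase a.castSucc \ αp) γp := by
  have key := fun a : Fin M => P.boundary_sum hg {a.castSucc} (P.weight22 s ν a.castSucc)
    (fun σ σ' h => weight22_congr (h _ (by simp)))
    (fun h => absurd (Finset.mem_singleton.1 h).symm (Fin.castSucc_ne_last a))
    (n := min (s : ℕ) M) (by
      rw [Finset.sdiff_singleton_eq_erase, Finset.card_erase_of_mem (Finset.mem_univ _)]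
      simp)
  simp only [coeff22_eq]
  simp only [Finset.sdiff_singleton_eq_erase] at key
  rw [Finset.sum_congr rfl fun a _ => key a, hg.sepState_eq μ hμ, E22,
    siteOp_single_mulVec _ 1 1 (by
    ext i j; fin_cases i <;> fin_cases j <;> simp), map_sum, Finset.sum_comm]
  refine Finset.sum_congr rfl fun σ hσ => ?_
  have hσ1 : σ (Fin.last M) = 1 := mem_signs.1 hσ _ (Finset.notMem_erase _ _)
  rw [map_smul, hg.E22_apply hσ1, Finset.smul_sum]
  refine Finset.sum_congr rfl fun a _ => ?_
  rw [smul_smul, hg.weight22_eq hσ1 (Fin.castSucc_ne_last a), Finset.sdiff_singleton_eq_erase]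

theorem Generic.plus_formula (hg : P.Generic s ν) {μ : Fin M → ℂ}
    (hμ : ∀ i, ν i.castSucc = μ i) : sigmaPlus s *ᵥ P.sepState (List.ofFn μ) =
      ∑ a : Fin M, ∑ p ∈ (Finset.univ : Finset (Fin (M + 1))).erase a.castSucc,
        ∑ n ∈ Finset.range (min (s : ℕ) M + 1),
          ∑ αp ∈ Finset.powersetCard n ((Finset.univ.erase a.castSucc).erase p),
            ∑ γp ∈ Finset.powersetCard n (Finset.Iio s),
              P.coeffPlus s ν γp (Finset.Iio s \ γp) αp a.castSucc p
                  ((Finset.univ.erase a.castSucc).erase p \ αp) •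
                P.newState ν ((Finset.univ.erase a.castSucc).erase p \ αp) γp := by
  have hset : ∀ a p : Fin (M + 1), Finset.univ \ {a, p} = (Finset.univ.erase a).erase p := by
    intro a p
    ext i
    simp only [Finset.mem_sdiff, Finset.mem_univ, true_and, Finset.mem_insert,
      Finset.mem_singleton, Finset.mem_erase, and_true]
    tauto
  have key := fun (a : Fin M) (p : Fin (M + 1)) (hp : p ∈ Finset.univ.erase a.castSucc) =>
    P.boundary_sum hg {a.castSucc, p} (P.weightPlus s ν a.castSucc p)
    (fun σ σ' h => by
      have h1 : signed σ ν p = signed σ' ν p := signed_congr h ν p (by simp)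
      rw [weightPlus, weightPlus, weight22_congr (h a.castSucc (by simp)), h1,
        P.H_congr (S := {p}) (σ := σ) (σ' := σ') fun i hi => h i (by
          rw [Finset.mem_singleton.1 hi]; simp)])
    -- Here the removed index `p` may be the last one; a negative sign then makes `H {p}` vanish.
    (fun h σ hσ => by
      have hp : p = Fin.last M := by
        rcases Finset.mem_insert.1 h with h | h
        · exact absurd h.symm (Fin.castSucc_ne_last a)
        · exact (Finset.mem_singleton.1 h).symm
      rw [weightPlus, P.H_eq_zero (Finset.mem_singleton_self p), zero_mul, mul_zero]
      rw [hp, hσ, hg.last]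
      simpa using P.d_ξ0 s)
    -- Only `M - 1` indices remain, so the bound is not sharp; the additional terms are empty.
    (n := min (s : ℕ) M) (by
      rw [hset, Finset.card_erase_of_mem hp, Finset.card_erase_of_mem (Finset.mem_univ _)]
      simp only [Finset.card_univ, Fintype.card_fin]
      omega)
  simp only [coeffPlus_eq]
  simp only [hset] at key
  rw [Finset.sum_congr rfl fun a _ => Finset.sum_congr rfl (key a), hg.sepState_eq μ hμ, sigmaPlus,
    siteOp_single_mulVec _ 0 1 (by
    ext i j; fin_cases i <;> fin_cases j <;> simp), map_sum]
  rw [Finset.sum_congr rfl fun a _ => Finset.sum_comm, Finset.sum_comm]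
  refine Finset.sum_congr rfl fun σ hσ => ?_
  have hσ1 : σ (Fin.last M) = 1 := mem_signs.1 hσ _ (Finset.notMem_erase _ _)
  rw [map_smul, hg.plus_apply hσ1, Finset.smul_sum]
  refine Finset.sum_congr rfl fun a _ => ?_
  rw [Finset.smul_sum]
  refine Finset.sum_congr rfl fun p hp => ?_
  rw [smul_smul, hg.weightPlus_eq hσ1 (Fin.castSucc_ne_last a) (Finset.ne_of_mem_erase hp), hset]

/-- The shifts by `η / 2` turn sums of two `ξ0` into `ξ j + ξ k + η`, and differences are unchanged.
The excluded values `0`, `±η` thus cover the required conditions once the parameter `ξ0 s` is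
treated separately. -/
theorem generic_ext (hη : P.η ≠ 0) (hζ : P.ζ ≠ 0) (hξ : P.Inhomogeneous)
    (hξη : ∀ k ≤ s, 2 * P.ξ k + P.η ≠ 0) (hξζ : ∀ k ≤ s, P.ξ k + P.ζ ≠ 0)
    {μ : Fin M → ℂ} (hμ0 : ∀ i, μ i ≠ 0)
    (hμμ : ∀ i j, i ≠ j → ∀ ε : ℤˣ, μ i + ((ε : ℤ) : ℂ) * μ j ∉ ({0, -P.η, P.η} : Set ℂ))
    (hμξ : ∀ i, ∀ k ≤ s, ∀ ε : ℤˣ,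
      ((ε : ℤ) : ℂ) * μ i ∉ ({P.ξ0 k, P.ξ1 k, P.ξ0 k + P.η} : Set ℂ)) :
    P.Generic s (P.ext s μ) := by
  simp only [Set.mem_insert_iff, Set.mem_singleton_iff, not_or] at hμμ hμξ
  obtain ⟨hξ0, hξξ⟩ := hξ
  simp only [Set.mem_insert_iff, Set.mem_singleton_iff, not_or] at hξ0 hξξ
  have hlast : P.ext s μ (Fin.last M) = P.ξ0 s := by simp [ext]
  have hcast : ∀ i : Fin M, P.ext s μ i.castSucc = μ i := fun i => by simp [ext]
  have hinj : Function.Injective P.ξ0 := fun j k h => by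
    by_contra hne
    refine (hξξ j k hne).2.1 ?_
    simp only [ξ0] at h
    linear_combination h
  have hsum : ∀ j, ∀ k ≤ s, P.ξ0 j + P.ξ0 k ≠ 0 := fun j k hk h => by
    by_cases hjk : j = k
    · refine hξη k hk ?_
      rw [hjk] at h
      simp only [ξ0] at h
      linear_combination h
    · refine (hξξ j k hjk).1.2.1 ?_
      simp only [ξ0] at h
      linear_combination h
  have hdiff : ∀ j k, P.ξ0 j - P.ξ0 k + P.η ≠ 0 := fun j k h => by
    by_cases hjk : j = k
    · rw [hjk] at h
      exact hη (by linear_combination h)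
    · refine (hξξ j k hjk).2.2.1 ?_
      simp only [ξ0] at h
      linear_combination h
  -- For `j = k` the expression is `2 * P.ξ k`, which is where `P.ξ k ≠ 0` enters.
  have hsum' : ∀ j k, P.ξ0 j + P.ξ0 k - P.η ≠ 0 := fun j k h => by
    by_cases hjk : j = k
    · refine (hξ0 k).1 ?_
      rw [hjk] at h
      simp only [ξ0] at h
      linear_combination h / 2
    · refine (hξξ j k hjk).1.1 ?_
      simp only [ξ0] at h
      linear_combination h
  have hξ1 : ∀ k, P.ξ1 k = P.ξ0 k - P.η := fun k => by
    simp only [ξ0, ξ1]; ring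
  refine
    { hη := hη
      hζ := hζ
      last := hlast
      inj := hinj
      sum_ne := fun j _ k hk => hsum j k hk
      a_ne := fun k => ?_
      H_ne := fun γ hγ => ?_
      sign := ⟨fun i _ => ?_, fun i _ j _ hij ε δ h => ?_⟩
      ne := fun σ i k hk h => ?_
      shift := fun σ hσ i j h => ?_
      shift_left := fun σ i k hk h => ?_
      shift_right := fun σ hσ i k hk h => ?_ }
  · rw [a, Finset.prod_ne_zero_iff]
    intro n _ h
    refine hdiff k n ?_
    simp only [ξ0] at h ⊢
    linear_combination h
  · rw [H_eq]
    refine mul_ne_zero (Finset.prod_ne_zero_iff.2 fun k hk => ?_)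
      (Finset.prod_ne_zero_iff.2 fun i hi => Finset.prod_ne_zero_iff.2 fun j hj => ?_)
    · have hks := hγ k hk
      have h0 : P.ξ0 k ≠ 0 := fun h => hξη k hks (by
        simp only [ξ0] at h
        linear_combination 2 * h)
      rw [hfac, bcoef]
      refine mul_ne_zero (mul_ne_zero (mul_ne_zero (div_ne_zero (pow_ne_zero _ (by norm_num)) hζ)
        (div_ne_zero (fun h => (hξ0 k).2.1 ?_) (by simpa using h0))) fun h => hξζ k hks ?_) ?_
      · simp only [ξ0] at h
        linear_combination h / 2
      · simp only [ξ0, Pi.one_apply] at h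
        push_cast at h
        linear_combination h
      · rw [d, Finset.prod_ne_zero_iff]
        intro n _ h
        refine hsum n k hks ?_
        simp only [ξ0, Pi.one_apply] at h ⊢
        push_cast at h
        linear_combination -h
    · have hjs := hγ j (Finset.mem_of_mem_filter j hj)
      have h1 := hsum' i j
      have h2 := hsum i j hjs
      simp only [cross, Pi.one_apply]
      push_cast
      rw [one_mul, one_mul]
      exact div_ne_zero h1 h2
  · refine Fin.lastCases ?_ (fun i => ?_) i
    · rw [hlast]
      exact fun h => hsum s s le_rfl (by simp [h])
    · rw [hcast]
      exact hμ0 i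
  · have aux : ∀ i : Fin M, ∀ ε δ : ℤˣ,
        ((ε : ℤ) : ℂ) * μ i + ((δ : ℤ) : ℂ) * P.ξ0 s ≠ 0 := fun i ε δ h => by
      refine (hμξ i s le_rfl (-(ε * δ))).1 ?_
      rcases Int.units_eq_one_or ε with rfl | rfl <;>
        rcases Int.units_eq_one_or δ with rfl | rfl <;> push_cast at h ⊢ <;>
        first | linear_combination h | linear_combination -h
    induction i using Fin.lastCases with
    | last =>
      induction j using Fin.lastCases with
      | last => exact hij rfl
      | cast j =>
        rw [hlast, hcast] at h
        exact aux j δ ε (by rw [← h]; ring)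
    | cast i =>
      induction j using Fin.lastCases with
      | last =>
        rw [hlast, hcast] at h
        exact aux i ε δ h
      | cast j =>
        rw [hcast, hcast] at h
        refine (hμμ i j (fun h => hij (by rw [h])) (ε * δ)).1 ?_
        rcases Int.units_eq_one_or ε with rfl | rfl <;>
          rcases Int.units_eq_one_or δ with rfl | rfl <;> push_cast at h ⊢ <;>
          first | linear_combination h | linear_combination -h
  · rw [signed] at h
    induction i using Fin.lastCases with
    | last =>
      rw [hlast] at h
      rcases Int.units_eq_one_or (σ (Fin.last M)) with h1 | h1 <;> rw [h1] at h <;>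
        push_cast at h
      · exact hk.ne (hinj (by linear_combination -h))
      · exact hsum s k hk.le (by linear_combination -h)
    | cast i =>
      rw [hcast] at h
      exact (hμξ i k hk.le (σ i.castSucc)).1 h
  · by_cases hij : i = j
    · rw [hij] at h
      exact hη (by linear_combination h)
    rw [signed, signed] at h
    induction i using Fin.lastCases with
    | last =>
      induction j using Fin.lastCases with
      | last => exact hij rfl
      | cast j =>
        rw [hlast, hcast, hσ] at h
        push_cast at h
        exact (hμξ j s le_rfl (σ j.castSucc)).2.2 (by linear_combination -h)
    | cast i =>
      induction j using Fin.lastCases with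
      | last =>
        rw [hlast, hcast, hσ] at h
        push_cast at h
        exact (hμξ i s le_rfl (σ i.castSucc)).2.1 (by rw [hξ1]; linear_combination h)
      | cast j =>
        rw [hcast, hcast] at h
        have key := hμμ i j fun h => hij (by rw [h])
        rcases Int.units_eq_one_or (σ i.castSucc) with h1 | h1 <;>
          rcases Int.units_eq_one_or (σ j.castSucc) with h2 | h2 <;> rw [h1, h2] at h <;>
          push_cast at h
        · exact (key (-1)).2.1 (by push_cast; linear_combination h)
        · exact (key 1).2.1 (by push_cast; linear_combination h)
        · exact (key 1).2.2 (by push_cast; linear_combination -h)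
        · exact (key (-1)).2.2 (by push_cast; linear_combination -h)
  · rw [signed] at h
    induction i using Fin.lastCases with
    | last =>
      rw [hlast] at h
      rcases Int.units_eq_one_or (σ (Fin.last M)) with h1 | h1 <;> rw [h1] at h <;>
        push_cast at h
      · exact hdiff s k (by linear_combination h)
      · exact hsum' s k (by linear_combination -h)
    | cast i =>
      rw [hcast] at h
      exact (hμξ i k hk.le (σ i.castSucc)).2.1 (by rw [hξ1]; linear_combination h)
  · rw [signed] at h
    induction i using Fin.lastCases with
    | last =>
      rw [hlast, hσ] at h
      push_cast at h
      exact hdiff k s (by linear_combination h)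
    | cast i =>
      rw [hcast] at h
      exact (hμξ i k hk.le (σ i.castSucc)).2.2 (by linear_combination -h)

end Chain
end OpenXXX
end

theorem mainTheorem8 {N M : ℕ} (P : OpenXXX.Chain N) (hη : P.η ≠ 0) (hζ : P.ζ ≠ 0)
    (hξ : P.Inhomogeneous)
    -- `s` is the site `m + 1`, so `m = (s : ℕ)`, and `Finset.Iio s` is the set `{1, …, m}`
    (s : Fin N)
    (hξη : ∀ k ≤ s, 2 * P.ξ k + P.η ≠ 0) (hξζ : ∀ k ≤ s, P.ξ k + P.ζ ≠ 0)
    (μ : Fin M → ℂ) (hμ0 : ∀ i, μ i ≠ 0)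
    (hμμ : ∀ i j, i ≠ j → ∀ ε : ℤˣ,
      μ i + ((ε : ℤ) : ℂ) * μ j ∉ ({0, -P.η, P.η} : Set ℂ))
    (hμξ : ∀ i, ∀ k ≤ s, ∀ ε : ℤˣ,
      ((ε : ℤ) : ℂ) * μ i ∉ ({P.ξ0 k, P.ξ1 k, P.ξ0 k + P.η} : Set ℂ)) :
    (OpenXXX.E22 s *ᵥ P.sepState (List.ofFn μ) =
      ∑ a : Fin M, ∑ n ∈ Finset.range (min (s : ℕ) M + 1),
        ∑ αp ∈ Finset.powersetCard n (Finset.univ.erase a.castSucc),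
          ∑ γp ∈ Finset.powersetCard n (Finset.Iio s),
            P.coeff22 s (P.ext s μ) γp (Finset.Iio s \ γp) αp a.castSucc
                (Finset.univ.erase a.castSucc \ αp) •
              P.newState (P.ext s μ) (Finset.univ.erase a.castSucc \ αp) γp) ∧
    (OpenXXX.sigmaMinus s *ᵥ P.sepState (List.ofFn μ) =
      ∑ n ∈ Finset.range (min (s : ℕ) (M + 1) + 1),
        ∑ αp ∈ Finset.powersetCard n (Finset.univ : Finset (Fin (M + 1))),
          ∑ γp ∈ Finset.powersetCard n (Finset.Iio s),
            P.coeffMinus s (P.ext s μ) γp (Finset.Iio s \ γp) αp (Finset.univ \ αp) •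
              P.newState (P.ext s μ) (Finset.univ \ αp) γp) ∧
    (OpenXXX.sigmaPlus s *ᵥ P.sepState (List.ofFn μ) =
      ∑ a : Fin M, ∑ p ∈ (Finset.univ : Finset (Fin (M + 1))).erase a.castSucc,
        ∑ n ∈ Finset.range (min (s : ℕ) M + 1),
          ∑ αp ∈ Finset.powersetCard n ((Finset.univ.erase a.castSucc).erase p),
            ∑ γp ∈ Finset.powersetCard n (Finset.Iio s),
              P.coeffPlus s (P.ext s μ) γp (Finset.Iio s \ γp) αp a.castSucc p
                  ((Finset.univ.erase a.castSucc).erase p \ αp) •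
                P.newState (P.ext s μ) ((Finset.univ.erase a.castSucc).erase p \ αp) γp) := by
  have hg := OpenXXX.Chain.generic_ext hη hζ hξ hξη hξζ hμ0 hμμ hμξ
  have hμ : ∀ i, P.ext s μ (Fin.castSucc i) = μ i := fun i => by simp [OpenXXX.Chain.ext]
  exact ⟨hg.E22_formula hμ, hg.minus_formula hμ, hg.plus_formula hμ⟩
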